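/- Let $E^X$ and $E^Y$ be locally compact separable metric spaces, $m^X$ and $m^Y$ Radon measures with full support on $E^X$ and $E^Y$, and put $E=E^X\times E^Y$, $m=m^X\times m^Y$. Conventions. A Markov process on a space $S$ is a family $(\Omega,(X_t)_{t\ge 0},(P_x)_{x\in S\cup\{\Delta\}})$ with values in $S\cup\{\Delta\}$, where $\Delta$ is a cemetery that the process does not leave, with $P_x(X_0=x)=1$, with $x\mapsto P_x(X_t\in A)$ measurable, and with the Markov property for some filtration. Its transition function is $p_t f(x)=\int f(y)\,P_x(X_t\in dy)$ (the integral being over $S$), and it is $\mu$-symmetric if $\int f\,p_tg\,d\mu=\int p_tf\,g\,d\mu$ for all measurable $f,g\ge 0$. A Dirichlet form on $L^2(S,\mu)$ is a non-negative definite symmetric bilinear form $\mathcal E$ with dense domain $\mathcal F$ that is closed and Markovian; $\mathcal E_1(u,v)=\mathcal E(u,v)+(u,v)_\mu$ and $\|u\|_{\mathcal E_1}=\mathcal E_1(u,u)^{1/2}$. It is the Dirichlet form of a $\mu$-symmetric Markov process if $\mathcal F$ is the set of $u\in L^2(S,\mu)$ for which $\lim_{t\downarrow 0}\frac1t(u-p_tu,u)_\mu$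 exists and is finite, and $\mathcal E(u,v)=\lim_{t\downarrow 0}\frac1t(u-p_tu,v)_\mu$ for $u,v\in\mathcal F$. A core is a subset of $\mathcal F\cap C_{\mathrm c}(S)$ which is dense in $\mathcal F$ for $\|\cdot\|_{\mathcal E_1}$ and dense in $C_{\mathrm c}(S)$ for the uniform norm; the form is regular if $\mathcal F\cap C_{\mathrm c}(S)$ is a core. Let $X$ be an $m^X$-symmetric Markov process on $E^X$ whose Dirichlet form $(\mathcal E^X,\mathcal F^X)$ on $L^2(E^X,m^X)$ is regular, and $Y$ an $m^Y$-symmetric Markov process on $E^Y$ whose Dirichlet form $(\mathcal E^Y,\mathcal F^Y)$ on $L^2(E^Y,m^Y)$ is regular. Let $Z=(X,Y)$ be their independent coupling: the process on $\Omega^X\times\Omega^Y$ which under $P_{(x,y)}=P^X_x\otimes P^Y_y$ is given by $Z_t=(X_t,Y_t)$ as long as both components are alive, and by $Z_t=\Delta$ afterwards. Set $$L^2(E^Y,\mathcal F^X)=\{u\in L^2(E,m): u(\cdot,y)\in\mathcal F^X \text{ for } m^Y\text{-a.e. } y,\ \|u(\cdot,y)\|_{\mathcal E^X_1}\in L^2(E^Y,m^Y)\},$$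 $$L^2(E^X,\mathcal F^Y)=\{u\in L^2(E,m): u(x,\cdot)\in\mathcal F^Y \text{ for } m^X\text{-a.e. } x,\ \|u(x,\cdot)\|_{\mathcal E^Y_1}\in L^2(E^X,m^X)\}.$$ Then $Z$ is an $m$-symmetric Markov process on $E$, and $$\mathcal F=L^2(E^Y,\mathcal F^X)\cap L^2(E^X,\mathcal F^Y),$$ $$\mathcal E(u,v)=\int_{E^Y}\mathcal E^X(u(\cdot,y),v(\cdot,y))\,m^Y(dy)+\int_{E^X}\mathcal E^Y(u(x,\cdot),v(x,\cdot))\,m^X(dx),\qquad u,v\in\mathcal F$$ (both integrands being integrable) defines a regular Dirichlet form on $L^2(E,m)$, which is the Dirichlet form of $Z$. Moreover, if $\mathcal C^X$ is a core of $(\mathcal E^X,\mathcal F^X)$ and $\mathcal C^Y$ is a core of $(\mathcal E^Y,\mathcal F^Y)$, then the tensor product $\mathcal C^X\otimes\mathcal C^Y$, i.e. the linear span of the functions $(x,y)\mapsto f(x)g(y)$ with $f\in\mathcal C^X$ and $g\in\mathcal C^Y$, is a core of $(\mathcal E,\mathcal F)$. -/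

import Mathlib

open MeasureTheory Filter Topology
open scoped NNReal ENNReal CompactlySupported

/-! ## Dirichlet forms -/

/-- A (symmetric) Dirichlet form `(𝓔, 𝓕)` on `L²(E, m)`: a non-negative definite symmetric bilinear
form `form` with dense domain `domain`, closed and Markovian. -/
structure DirichletForm {E : Type*} [MeasurableSpace E] (m : Measure E) where
  /-- the domain `𝓕` -/
  domain : Submodule ℝ (Lp ℝ 2 m)
  /-- the form `𝓔` -/
  form : LinearMap.BilinForm ℝ domain
  symm : ∀ u v, form u v = form v u
  nonneg : ∀ u, 0 ≤ form u u
  dense : Dense (domain : Set (Lp ℝ 2 m))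
  /-- closedness: every `𝓔₁`-Cauchy sequence in `𝓕` is `𝓔₁`-convergent in `𝓕`, where
  `𝓔₁(w, w) = 𝓔(w, w) + (w, w)` -/
  closed : ∀ u : ℕ → domain,
    (∀ ε > 0, ∃ N, ∀ i ≥ N, ∀ j ≥ N,
      form (u i - u j) (u i - u j) + inner ℝ (u i - u j) (u i - u j) < ε) →
    ∃ v : domain,
      Tendsto (fun n => form (u n - v) (u n - v) + inner ℝ (u n - v) (u n - v)) atTop (𝓝 0)
  /-- Markov property: the unit contraction `u ↦ (0 ∨ u) ∧ 1` operates on the form -/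
  markov : ∀ u : domain, ∃ v : domain,
    ((v : Lp ℝ 2 m) : E → ℝ) =ᵐ[m] (fun x => min (max 0 (((u : Lp ℝ 2 m) : E → ℝ) x)) 1) ∧
      form v v ≤ form u u

namespace DirichletForm

variable {E : Type*} [MeasurableSpace E] {m : Measure E}

/-- `𝓔₁(u, v) = 𝓔(u, v) + (u, v)`, the inner product being that of `L²(E, m)`. -/
noncomputable def form₁ (D : DirichletForm m) (u v : D.domain) : ℝ :=
  D.form u v + inner ℝ (u : Lp ℝ 2 m) (v : Lp ℝ 2 m)

/-- A function `f` belongs to `𝓕`, i.e. `f` is square integrable and its class is in the domain. -/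
def MemFun (D : DirichletForm m) (f : E → ℝ) : Prop :=
  ∃ h : MemLp f 2 m, h.toLp f ∈ D.domain

open Classical in
/-- `𝓔(f, g)` for functions `f, g` which belong to `𝓕` (and, by convention, `0` otherwise). -/
noncomputable def formFun (D : DirichletForm m) (f g : E → ℝ) : ℝ :=
  if h : D.MemFun f ∧ D.MemFun g then
    D.form ⟨h.1.choose.toLp f, h.1.choose_spec⟩ ⟨h.2.choose.toLp g, h.2.choose_spec⟩
  else 0

/-- The norm `‖f‖_{𝓔₁} = (𝓔(f, f) + ∫ f² dm)^{1/2}` of a function `f` which belongs to `𝓕`. -/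
noncomputable def norm₁Fun (D : DirichletForm m) (f : E → ℝ) : ℝ :=
  Real.sqrt (D.formFun f f + ∫ x, f x ^ 2 ∂m)

/-- A core of `(𝓔, 𝓕)`: a subset of `𝓕 ∩ C_c(E)` which is dense in `𝓕` for the `𝓔₁`-norm and dense
in `C_c(E)` for the uniform norm. -/
structure IsCore [TopologicalSpace E] (D : DirichletForm m) (C : Set C_c(E, ℝ)) : Prop where
  memFun : ∀ f ∈ C, D.MemFun f
  dense_domain : ∀ u : D.domain, ∀ ε > 0, ∃ f ∈ C, ∃ w : D.domain,
    ((w : Lp ℝ 2 m) : E → ℝ) =ᵐ[m] f ∧ Real.sqrt (D.form₁ (u - w) (u - w)) < ε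
  dense_continuous : ∀ g : C_c(E, ℝ), ∀ ε > 0, ∃ f ∈ C, ∀ x, |g x - f x| < ε

/-- `(𝓔, 𝓕)` is regular: `𝓕 ∩ C_c(E)` is dense in `𝓕` for the `𝓔₁`-norm and in `C_c(E)` for the
uniform norm. -/
def IsRegular [TopologicalSpace E] (D : DirichletForm m) : Prop :=
  D.IsCore {f : C_c(E, ℝ) | D.MemFun f}

end DirichletForm

/-! ## Markov processes -/

/-- The σ-algebra on `E_Δ = E ∪ {Δ}` (`Δ` is `none`): a set is measurable when its trace on `E` is.
It is generated by the measurable sets of `E` and by `{Δ}`. -/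
instance Option.instMeasurableSpaceCemetery {E : Type*} [MeasurableSpace E] :
    MeasurableSpace (Option E) :=
  MeasurableSpace.map some inferInstance

/-- The data of a Markov process on `E` with cemetery `Δ`: the paths `t ↦ path t ω` on a sample
space `Ω`, and a law `law x` on `Ω` for each starting point `x` of `E_Δ`. -/
structure ProcessFamily (Ω E : Type*) [MeasurableSpace Ω] where
  path : ℝ≥0 → Ω → Option E
  law : Option E → Measure Ω

namespace ProcessFamily

section

variable {Ω E : Type*} [MeasurableSpace Ω] [MeasurableSpace E]

/-- `(path, law)` is a (normal) Markov process on `E`. -/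
structure IsMarkov (X : ProcessFamily Ω E) : Prop where
  isProbabilityMeasure : ∀ x, IsProbabilityMeasure (X.law x)
  measurable_path : ∀ t, Measurable (X.path t)
  /-- `x ↦ P_x(X_t ∈ A)` is measurable -/
  measurable_law : ∀ t, ∀ A : Set (Option E), MeasurableSet A →
    Measurable fun x => X.law x (X.path t ⁻¹' A)
  /-- `P_x(X_0 = x) = 1` -/
  start : ∀ x, ∀ᵐ ω ∂X.law x, X.path 0 ω = x
  /-- `Δ` is a trap -/
  cemetery : ∀ t, ∀ᵐ ω ∂X.law none, X.path t ω = none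
  /-- there is a filtration to which the process is adapted and such that
  `P_x(X_{t+s} ∈ A | 𝓖_t) = P_{X_t}(X_s ∈ A)`, `P_x`-almost surely -/
  markov : ∃ 𝓖 : Filtration ℝ≥0 (inferInstance : MeasurableSpace Ω),
    (∀ t, Measurable[𝓖 t] (X.path t)) ∧
    ∀ x, ∀ s t : ℝ≥0, ∀ A : Set (Option E), MeasurableSet A → ∀ B : Set Ω, MeasurableSet[𝓖 t] B →
      X.law x (B ∩ X.path (t + s) ⁻¹' A) =
        ∫⁻ ω in B, X.law (X.path t ω) (X.path s ⁻¹' A) ∂X.law x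

/-- The transition function `p_t(x, A) = P_x(X_t ∈ A)`, `A ⊆ E`: a measure on `E` of mass at
most one. -/
noncomputable def trans (X : ProcessFamily Ω E) (t : ℝ≥0) (x : E) : Measure E :=
  ((X.law (some x)).map (X.path t)).comap some

/-- The process is `m`-symmetric: `∫ f (p_t g) dm = ∫ (p_t f) g dm` for all non-negative measurable
functions `f` and `g`. -/
def IsSymmetric (X : ProcessFamily Ω E) (m : Measure E) : Prop :=
  ∀ t, ∀ f g : E → ℝ≥0∞, Measurable f → Measurable g →
    ∫⁻ x, f x * (∫⁻ y, g y ∂X.trans t x) ∂m = ∫⁻ x, (∫⁻ y, f y ∂X.trans t x) * g x ∂m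

/-- The approximating form `(1/t) (f - p_t f, g)` of the transition semigroup,
`p_t f (x) = ∫ f(y) p_t(x, dy)`. -/
noncomputable def approxForm (X : ProcessFamily Ω E) (m : Measure E) (t : ℝ≥0) (f g : E → ℝ) : ℝ :=
  (t : ℝ)⁻¹ * ∫ x, (f x - ∫ y, f y ∂X.trans t x) * g x ∂m

/-- `(𝓔, 𝓕)` is the Dirichlet form on `L²(E, m)` of the `m`-symmetric process:
`𝓕 = {u ∈ L² : lim_{t ↓ 0} (1/t) (u - p_t u, u) exists and is finite}` and
`𝓔(u, v) = lim_{t ↓ 0} (1/t) (u - p_t u, v)` for `u, v ∈ 𝓕`. -/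
structure HasDirichletForm (X : ProcessFamily Ω E) {m : Measure E} (D : DirichletForm m) :
    Prop where
  mem_domain_iff : ∀ u : Lp ℝ 2 m,
    u ∈ D.domain ↔ ∃ c : ℝ, Tendsto (fun t : ℝ≥0 => X.approxForm m t u u) (𝓝[>] 0) (𝓝 c)
  tendsto_form : ∀ u v : D.domain,
    Tendsto (fun t : ℝ≥0 => X.approxForm m t (u : Lp ℝ 2 m) (v : Lp ℝ 2 m)) (𝓝[>] 0)
      (𝓝 (D.form u v))

end

section

variable {Ω₁ Ω₂ E₁ E₂ : Type*} [MeasurableSpace Ω₁] [MeasurableSpace Ω₂]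

/-- The pair of two points, which is `Δ` as soon as one of them is. -/
def pair : Option E₁ → Option E₂ → Option (E₁ × E₂)
  | some x, some y => some (x, y)
  | _, _ => none

/-- The independent coupling `Z = (X, Y)`: it starts at `(x, y)` under `P_x ⊗ P_y`, and it is killed
as soon as one of the two processes is. -/
noncomputable def coupling (X : ProcessFamily Ω₁ E₁) (Y : ProcessFamily Ω₂ E₂) :
    ProcessFamily (Ω₁ × Ω₂) (E₁ × E₂) where
  path t ω := pair (X.path t ω.1) (Y.path t ω.2)
  law
    | some (x, y) => (X.law (some x)).prod (Y.law (some y))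
    | none => (X.law none).prod (Y.law none)

end

end ProcessFamily

/-! ## Function spaces on a product -/

section

variable {E₁ E₂ : Type*} [MeasurableSpace E₁] [MeasurableSpace E₂]
  {m₁ : Measure E₁} {m₂ : Measure E₂}

/-- `L²(E₂, 𝓕₁)`, as a subset of `L²(E₁ × E₂, m₁ × m₂)`: the `u` with `u(·, y) ∈ 𝓕₁` for
`m₂`-a.e. `y` and `‖u(·, y)‖_{𝓔₁} ∈ L²(E₂, m₂)`. -/
def fiberDomainLeft (D₁ : DirichletForm m₁) (m₂ : Measure E₂) : Set (Lp ℝ 2 (m₁.prod m₂)) :=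
  {u | (∀ᵐ y ∂m₂, D₁.MemFun fun x => u (x, y)) ∧
    MemLp (fun y => D₁.norm₁Fun fun x => u (x, y)) 2 m₂}

/-- `L²(E₁, 𝓕₂)`, as a subset of `L²(E₁ × E₂, m₁ × m₂)`: the `u` with `u(x, ·) ∈ 𝓕₂` for
`m₁`-a.e. `x` and `‖u(x, ·)‖_{𝓔₁} ∈ L²(E₁, m₁)`. -/
def fiberDomainRight (m₁ : Measure E₁) (D₂ : DirichletForm m₂) : Set (Lp ℝ 2 (m₁.prod m₂)) :=
  {u | (∀ᵐ x ∂m₁, D₂.MemFun fun y => u (x, y)) ∧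
    MemLp (fun x => D₂.norm₁Fun fun y => u (x, y)) 2 m₁}

end

section

variable {E₁ E₂ : Type*} [TopologicalSpace E₁] [TopologicalSpace E₂] [R1Space E₁] [R1Space E₂]

/-- The function `(f ⊗ g)(x, y) = f(x) g(y)`. -/
def tensorFun (f : C_c(E₁, ℝ)) (g : C_c(E₂, ℝ)) : C_c(E₁ × E₂, ℝ) where
  toFun p := f p.1 * g p.2
  continuous_toFun := by fun_prop
  hasCompactSupport' := by
    refine HasCompactSupport.intro (f.hasCompactSupport.isCompact.prod
      g.hasCompactSupport.isCompact) fun p hp => ?_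
    rw [Set.mem_prod, not_and_or] at hp
    rcases hp with h | h
    · simp [image_eq_zero_of_notMem_tsupport h]
    · simp [image_eq_zero_of_notMem_tsupport h]

/-- The tensor product `C₁ ⊗ C₂`: the linear span of the functions `f ⊗ g`, `f ∈ C₁`, `g ∈ C₂`. -/
def tensorCore (C₁ : Set C_c(E₁, ℝ)) (C₂ : Set C_c(E₂, ℝ)) : Submodule ℝ C_c(E₁ × E₂, ℝ) :=
  Submodule.span ℝ {h | ∃ f ∈ C₁, ∃ g ∈ C₂, h = tensorFun f g}

end

/-!
The proof works with semigroups of operators. The transition kernels of a symmetric Markov process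
act on `L²` as symmetric contractions; since the form of the process has dense domain, they are
strongly continuous. For such a semigroup `T`, the function `t ↦ ⟪T_t u, u⟫` is convex
(`SymmSemigroup.convexOn_inner`, because `⟪T_{(a+b)/2} u, u⟫ = ⟪T_{a/2} u, T_{b/2} u⟫`), so the
approximating forms `(1/t) ⟪u - T_t u, u⟫` increase as `t ↓ 0`. Thus the domain of the form is the
set of `u` along which they are bounded, the form is closed by lower semicontinuity
(`SymmSemigroup.form_closed`), and `T_s u` belongs to the domain for every `u` when `s > 0`. For
sub-Markov kernels the form is Markovian (`IsSymmSubMarkov.inner_unitContraction_le`).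

On `L²(E₁ × E₂)` the semigroup of the coupling is `P_t Q_t`, where `P` acts on the first variable by
the semigroup of `X` and `Q` on the second one by that of `Y`, and `P` and `Q` commute. From
`(1/t) ⟪u - P_t Q_t u, u⟫ = (1/t) ⟪u - Q_t u, u⟫ + (1/t) ⟪w - P_t w, w⟫`, `w = Q_{t/2} u`, the
domain of the product is the intersection of the two domains and its form is the sum of the two
forms (`SymmSemigroup.mem_domain_prod`, `SymmSemigroup.energy_prod`). By Fubini's theorem the
approximating forms of `P` are the integrals over `y` of those of `u(·, y)`; monotone limits,
through Fatou's lemma and dominated convergence, identify the domain of `P` with `L²(E₂, 𝓕_X)` and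
its form with the integral of `𝓔_X(u(·, y), v(·, y))`, and similarly for `Q`
(`ProcessFamily.memLp_norm₁Fun_of_bdd`, `ProcessFamily.integrable_formFun`).

For the cores, `T_s w → u` in energy norm when `w → u` in `L²` and then `s ↓ 0`
(`SymmSemigroup.exists_op_near`). Taking for `w` linear combinations of `f ⊗ g`, which are dense in
`L²`, and using `T_s (f ⊗ g) = p_s f ⊗ q_s g`, only tensor products of elements of the domains have
to be approximated, and this follows from the submultiplicativity of the energy norm on them
(`ProcessFamily.energyOne_tensorLp_le`). Uniform density comes from a partition of unity
(`exists_tensorCore_univ_near`).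
-/

open scoped RealInnerProductSpace
open ProbabilityTheory

/-! ### Midpoint convexity -/

/-- A continuous midpoint convex function is convex: otherwise, at the leftmost maximum of the
difference with a chord, the midpoint inequality fails. -/
theorem convexOn_Ici_of_midpoint {g : ℝ → ℝ} (hc : Continuous g)
    (hmid : ∀ a b, 0 ≤ a → 0 ≤ b → g ((a + b) / 2) ≤ (g a + g b) / 2) :
    ConvexOn ℝ (Set.Ici 0) g := by
  refine ⟨convex_Ici 0, ?_⟩
  intro x hx y hy a b ha hb hab
  simp only [Set.mem_Ici, smul_eq_mul] at *
  -- the difference with the chord, parametrized by `[0, 1]`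
  set h : ℝ → ℝ := fun θ => g (x + θ * (y - x)) - (g x + θ * (g y - g x)) with hh
  have hcont : Continuous h := by fun_prop
  suffices H : ∀ θ ∈ Set.Icc (0 : ℝ) 1, h θ ≤ 0 by
    have := H b ⟨hb, by linarith⟩
    obtain rfl : a = 1 - b := by linarith
    simp only [hh] at this
    have e : x + b * (y - x) = (1 - b) * x + b * y := by ring
    rw [e] at this
    linarith
  by_contra! hne
  obtain ⟨θ₀, hθ₀, hpos⟩ := hne
  obtain ⟨c, hcI, hcmax⟩ := isCompact_Icc.exists_isMaxOn ⟨θ₀, hθ₀⟩ hcont.continuousOn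
  have hM : 0 < h c := hpos.trans_le (hcmax hθ₀)
  have hK : IsCompact (Set.Icc (0 : ℝ) 1 ∩ h ⁻¹' {h c}) :=
    isCompact_Icc.inter_right (isClosed_singleton.preimage hcont)
  obtain ⟨d, ⟨hdI, hd⟩, hdmin⟩ := hK.exists_isLeast ⟨c, hcI, rfl⟩
  simp only [Set.mem_preimage, Set.mem_singleton_iff] at hd
  have h0 : h 0 = 0 := by simp [hh]
  have h1 : h 1 = 0 := by simp [hh]
  have hd0 : 0 < d := lt_of_le_of_ne hdI.1 (by rintro rfl; linarith)
  have hd1 : d < 1 := lt_of_le_of_ne hdI.2 (by rintro rfl; linarith)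
  obtain ⟨δ, hδ, hδ0, hδ1⟩ : ∃ δ > 0, δ ≤ d ∧ δ ≤ 1 - d :=
    ⟨min d (1 - d), lt_min hd0 (by linarith), min_le_left _ _, min_le_right _ _⟩
  have hl : h (d - δ) < h c := by
    refine lt_of_le_of_ne (hcmax ⟨by linarith, by linarith⟩) fun heq => ?_
    have := hdmin ⟨⟨by linarith, by linarith⟩, heq⟩
    linarith
  have hr : h (d + δ) ≤ h c := hcmax ⟨by linarith, by linarith⟩
  have key : ∀ θ ∈ Set.Icc (0 : ℝ) 1, 0 ≤ x + θ * (y - x) := fun θ hθ => by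
    nlinarith [mul_nonneg hθ.1 hy, mul_nonneg (sub_nonneg.2 hθ.2) hx]
  have hm := hmid (x + (d - δ) * (y - x)) (x + (d + δ) * (y - x))
    (key _ ⟨by linarith, by linarith⟩) (key _ ⟨by linarith, by linarith⟩)
  have e : (x + (d - δ) * (y - x) + (x + (d + δ) * (y - x))) / 2 = x + d * (y - x) := by ring
  rw [e] at hm
  simp only [hh] at hd hl hr hm
  linarith

/-- A convex function on `[0, ∞)` which is bounded above is nonincreasing. -/
theorem ConvexOn.apply_le_apply_zero_of_bdd {g : ℝ → ℝ} (hg : ConvexOn ℝ (Set.Ici 0) g) {C : ℝ}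
    (hC : ∀ t, 0 ≤ t → g t ≤ C) {s : ℝ} (hs : 0 ≤ s) : g s ≤ g 0 := by
  by_contra! hlt
  have hs' : 0 < s := lt_of_le_of_ne hs (by rintro rfl; exact lt_irrefl _ hlt)
  obtain ⟨n, hn⟩ := exists_nat_gt ((C - g 0) / (g s - g 0))
  have hpos : 0 < g s - g 0 := by linarith
  rw [div_lt_iff₀ hpos] at hn
  have hN : (1 : ℝ) ≤ n + 1 := by linarith [n.cast_nonneg (α := ℝ)]
  have := hg.2 (show (0 : ℝ) ∈ Set.Ici 0 by simp)
    (show (n + 1) * s ∈ Set.Ici 0 by simp only [Set.mem_Ici]; positivity)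
    (show 0 ≤ 1 - (n + 1 : ℝ)⁻¹ by rw [sub_nonneg]; exact inv_le_one_of_one_le₀ hN)
    (show 0 ≤ (n + 1 : ℝ)⁻¹ by positivity) (by ring)
  simp only [smul_eq_mul, mul_zero, zero_add] at this
  rw [inv_mul_cancel_left₀ (by positivity)] at this
  have h2 := hC ((n + 1) * s) (by positivity)
  have h3 : (n + 1 : ℝ) * g s ≤ n * g 0 + g ((n + 1) * s) := by
    have h4 := mul_le_mul_of_nonneg_left this (by positivity : (0 : ℝ) ≤ n + 1)
    have h5 : (n + 1 : ℝ) * ((1 - (n + 1 : ℝ)⁻¹) * g 0 + (n + 1 : ℝ)⁻¹ * g ((n + 1) * s)) =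
      n * g 0 + g ((n + 1) * s) := by field_simp; ring
    linarith
  nlinarith

/-! ### Symmetric contraction semigroups and their forms -/

/-- A strongly continuous semigroup of symmetric contractions of a real inner product space. -/
structure SymmSemigroup (H : Type*) [NormedAddCommGroup H] [InnerProductSpace ℝ H] where
  op : ℝ≥0 → H →L[ℝ] H
  op_zero : ∀ u, op 0 u = u
  op_add : ∀ s t u, op (s + t) u = op s (op t u)
  symm : ∀ t u v, ⟪op t u, v⟫ = ⟪u, op t v⟫
  norm_op_le : ∀ t u, ‖op t u‖ ≤ ‖u‖
  tendsto_op : ∀ u, Tendsto (fun t => op t u) (𝓝[>] 0) (𝓝 u)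

namespace SymmSemigroup

variable {H : Type*} [NormedAddCommGroup H] [InnerProductSpace ℝ H] (T : SymmSemigroup H)

theorem op_comm (s t : ℝ≥0) (u : H) : T.op s (T.op t u) = T.op t (T.op s u) := by
  rw [← T.op_add, ← T.op_add, add_comm]

theorem tendsto_op_nhds_zero (u : H) : Tendsto (fun t => T.op t u) (𝓝 0) (𝓝 u) := by
  have h : (𝓝 (0 : ℝ≥0)) = 𝓝[>] 0 ⊔ pure 0 := by
    rw [← nhdsNE_sup_pure]
    congr 1
    have : ({0}ᶜ : Set ℝ≥0) = Set.Ioi 0 := by ext; simp [pos_iff_ne_zero]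
    rw [this]
  rw [h]
  refine (T.tendsto_op u).sup ?_
  rw [tendsto_pure_left]
  intro s hs
  rw [T.op_zero]
  exact mem_of_mem_nhds hs

theorem norm_op_sub_op_le (s t : ℝ≥0) (u : H) :
    ‖T.op s u - T.op t u‖ ≤ ‖T.op (max s t - min s t) u - u‖ := by
  wlog h : t ≤ s generalizing s t
  · rw [norm_sub_rev, max_comm, min_comm]
    exact this t s (le_of_not_ge h)
  rw [max_eq_left h, min_eq_right h]
  have : T.op s u - T.op t u = T.op t (T.op (s - t) u - u) := by
    rw [map_sub, ← T.op_add, add_tsub_cancel_of_le h]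
  rw [this]
  exact T.norm_op_le _ _

theorem continuous_op (u : H) : Continuous fun t => T.op t u := by
  rw [continuous_iff_continuousAt]
  intro t
  rw [ContinuousAt, tendsto_iff_norm_sub_tendsto_zero]
  refine squeeze_zero (fun _ => norm_nonneg _) (fun s => T.norm_op_sub_op_le s t u) ?_
  have h1 : Tendsto (fun s : ℝ≥0 => max s t - min s t) (𝓝 t) (𝓝 0) := by
    have : Continuous fun s : ℝ≥0 => max s t - min s t := by fun_prop
    simpa using this.tendsto t
  exact tendsto_iff_norm_sub_tendsto_zero.1 ((T.tendsto_op_nhds_zero u).comp h1)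

/-- `t ↦ ⟪A T_t u, u⟫` is convex when `A` is symmetric, non-negative and commutes with the
semigroup, because `⟪A T_{(a+b)/2} u, u⟫ = ⟪A T_{a/2} u, T_{b/2} u⟫`. -/
theorem convexOn_inner (A : H →L[ℝ] H) (hsymm : ∀ u v, ⟪A u, v⟫ = ⟪u, A v⟫)
    (hpos : ∀ u, 0 ≤ ⟪A u, u⟫) (hcomm : ∀ t u, A (T.op t u) = T.op t (A u)) (u : H) :
    ConvexOn ℝ (Set.Ici 0) fun t : ℝ => ⟪A (T.op t.toNNReal u), u⟫ := by
  refine convexOn_Ici_of_midpoint ?_ ?_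
  · have := T.continuous_op u
    fun_prop
  intro a b ha hb
  have split : ∀ c d : ℝ, 0 ≤ c → 0 ≤ d → ⟪A (T.op ((c + d) / 2).toNNReal u), u⟫ =
      ⟪A (T.op (c / 2).toNNReal u), T.op (d / 2).toNNReal u⟫ := by
    intro c d hc hd
    rw [add_div, Real.toNNReal_add (by positivity) (by positivity), add_comm, T.op_add, hcomm,
      T.symm]
  have h1 := split a b ha hb
  have h2 := split a a ha ha
  have h3 := split b b hb hb
  have e : ∀ c : ℝ, (c + c) / 2 = c := fun c => by ring
  rw [e] at h2 h3
  rw [h1, h2, h3]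
  set v := T.op (a / 2).toNNReal u
  set w := T.op (b / 2).toNNReal u
  have := hpos (v - w)
  rw [map_sub, inner_sub_left, inner_sub_right, inner_sub_right] at this
  have e2 : ⟪A w, v⟫ = ⟪A v, w⟫ := by rw [hsymm, real_inner_comm]
  linarith

/-- A bounded convex function on `[0, ∞)` is nonincreasing, so `⟪A T_s u, u⟫ ≤ ⟪A u, u⟫`. -/
theorem inner_comp_op_le (A : H →L[ℝ] H) (hsymm : ∀ u v, ⟪A u, v⟫ = ⟪u, A v⟫)
    (hpos : ∀ u, 0 ≤ ⟪A u, u⟫) (hcomm : ∀ t u, A (T.op t u) = T.op t (A u)) (s : ℝ≥0) (u : H) :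
    ⟪A (T.op s u), u⟫ ≤ ⟪A u, u⟫ := by
  have := (T.convexOn_inner A hsymm hpos hcomm u).apply_le_apply_zero_of_bdd (C := ‖A‖ * ‖u‖ * ‖u‖)
    (fun t _ => ?_) (NNReal.coe_nonneg s)
  · simpa [T.op_zero] using this
  · refine (real_inner_le_norm _ _).trans ?_
    gcongr
    refine (A.le_opNorm _).trans ?_
    gcongr
    exact T.norm_op_le _ _

/-- The approximating form `(1/t) ⟪u - T_t u, v⟫`. It is `0` for `t = 0`, so that bounds for all `t`
are bounds for all `t > 0`. -/
noncomputable def approx (t : ℝ≥0) (u v : H) : ℝ := (t : ℝ)⁻¹ * ⟪u - T.op t u, v⟫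

theorem inner_op_nonneg (t : ℝ≥0) (u : H) : 0 ≤ ⟪T.op t u, u⟫ := by
  rw [← add_halves t, T.op_add, T.symm]
  exact real_inner_self_nonneg

theorem inner_op_le (t : ℝ≥0) (u : H) : ⟪T.op t u, u⟫ ≤ ‖u‖ ^ 2 := by
  refine (real_inner_le_norm _ _).trans ?_
  rw [sq]
  gcongr
  exact T.norm_op_le _ _

theorem inner_sub_op_nonneg (t : ℝ≥0) (u : H) : 0 ≤ ⟪u - T.op t u, u⟫ := by
  rw [inner_sub_left, real_inner_self_eq_norm_sq, sub_nonneg]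
  exact T.inner_op_le t u

theorem inner_sub_op_symm (t : ℝ≥0) (u v : H) : ⟪u - T.op t u, v⟫ = ⟪u, v - T.op t v⟫ := by
  rw [inner_sub_left, inner_sub_right, T.symm]

theorem approx_nonneg (t : ℝ≥0) (u : H) : 0 ≤ T.approx t u u :=
  mul_nonneg (by positivity) (T.inner_sub_op_nonneg t u)

theorem approx_symm (t : ℝ≥0) (u v : H) : T.approx t u v = T.approx t v u := by
  rw [approx, approx, T.inner_sub_op_symm, real_inner_comm]

theorem approx_add_left (t : ℝ≥0) (u u' v : H) :
    T.approx t (u + u') v = T.approx t u v + T.approx t u' v := by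
  simp only [approx, map_add, inner_add_left, inner_sub_left]; ring

theorem approx_smul_left (t : ℝ≥0) (c : ℝ) (u v : H) :
    T.approx t (c • u) v = c * T.approx t u v := by
  simp only [approx, map_smul, inner_sub_left, real_inner_smul_left]; ring

theorem approx_add_self (t : ℝ≥0) (u v : H) :
    T.approx t (u + v) (u + v) = T.approx t u u + T.approx t v v + 2 * T.approx t u v := by
  rw [approx_add_left, T.approx_symm t u, T.approx_symm t v, approx_add_left, approx_add_left,
    T.approx_symm t v u]
  ring

theorem approx_smul_self (t : ℝ≥0) (c : ℝ) (u : H) :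
    T.approx t (c • u) (c • u) = c ^ 2 * T.approx t u u := by
  rw [approx_smul_left, T.approx_symm t u, approx_smul_left]; ring

theorem abs_approx_le (t : ℝ≥0) (u v : H) :
    |T.approx t u v| ≤ (T.approx t u u + T.approx t v v) / 2 := by
  have h1 := T.approx_nonneg t (u + v)
  have h2 := T.approx_nonneg t (u + (-1 : ℝ) • v)
  rw [approx_add_self] at h1 h2
  rw [approx_smul_self, T.approx_symm t u ((-1 : ℝ) • v), approx_smul_left,
    T.approx_symm t v u] at h2
  rw [abs_le]
  constructor <;> linarith

theorem approx_add_self_le (t : ℝ≥0) (u v : H) :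
    T.approx t (u + v) (u + v) ≤ 2 * T.approx t u u + 2 * T.approx t v v := by
  have := (abs_le.1 (T.abs_approx_le t u v)).2
  rw [approx_add_self]; linarith

theorem tendsto_approx_of_tendsto {α : Type*} {l : Filter α} {f : α → H} {u : H}
    (hf : Tendsto f l (𝓝 u)) (t : ℝ≥0) :
    Tendsto (fun a => T.approx t (f a) (f a)) l (𝓝 (T.approx t u u)) := by
  have : Continuous fun w => T.approx t w w := by unfold approx; fun_prop
  exact (this.tendsto u).comp hf

theorem convexOn_inner_op (u : H) :
    ConvexOn ℝ (Set.Ici 0) fun t : ℝ => ⟪T.op t.toNNReal u, u⟫ := by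
  simpa using T.convexOn_inner (ContinuousLinearMap.id ℝ H) (fun _ _ => rfl)
    (fun _ => real_inner_self_nonneg) (fun _ _ => rfl) u

/-- The approximating forms increase as `t` decreases to `0`. -/
theorem approx_anti {s t : ℝ≥0} (hs : 0 < s) (hst : s ≤ t) (u : H) :
    T.approx t u u ≤ T.approx s u u := by
  have hs' : (0 : ℝ) < s := hs
  have ht' : (0 : ℝ) < t := hs.trans_le hst
  have := (T.convexOn_inner_op u).secant_mono (a := 0) (x := s) (y := t) (by simp) (by simp)
    (by simp) hs'.ne' ht'.ne' (by exact_mod_cast hst)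
  simp only [Real.toNNReal_coe, Real.toNNReal_zero, T.op_zero, sub_zero] at this
  rw [approx, approx, inner_sub_left, inner_sub_left, inv_mul_eq_div, inv_mul_eq_div,
    ← neg_sub, neg_div, ← neg_sub (⟪T.op s u, u⟫), neg_div]
  linarith

theorem approx_op_op (s t : ℝ≥0) (u : H) :
    T.approx t (T.op s u) (T.op s u) = (t : ℝ)⁻¹ * ⟪T.op (s + s) u - T.op (s + s + t) u, u⟫ := by
  rw [approx, ← T.symm, map_sub, ← T.op_add, T.op_comm t s, ← T.op_add, ← T.op_add, add_assoc]

/-- If `S` commutes with `T`, the operators of `S` are contractions for the approximating forms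
of `T`. -/
theorem approx_op_le_of_commute (S : SymmSemigroup H)
    (hcomm : ∀ s t u, T.op t (S.op s u) = S.op s (T.op t u)) (s t : ℝ≥0) (u : H) :
    T.approx t (S.op s u) (S.op s u) ≤ T.approx t u u := by
  rw [approx, approx]
  refine mul_le_mul_of_nonneg_left ?_ (by positivity)
  have := S.inner_comp_op_le (ContinuousLinearMap.id ℝ H - T.op t)
    (fun u v => by simpa using T.inner_sub_op_symm t u v)
    (fun u => by simpa using T.inner_sub_op_nonneg t u)
    (fun r u => by simp [hcomm]) (s + s) u
  simp only [_root_.sub_apply, ContinuousLinearMap.id_apply, S.op_add] at this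
  refine le_trans (le_of_eq ?_) this
  rw [← S.symm, map_sub, ← hcomm]

theorem approx_op_le (s t : ℝ≥0) (u : H) : T.approx t (T.op s u) (T.op s u) ≤ T.approx t u u :=
  T.approx_op_le_of_commute T (fun s t u => T.op_comm t s u) s t u

/-- The semigroup is regularizing: a slope of `t ↦ ⟪T_t u, u⟫` to the right of `2 s` is at least
the slope between `0` and `2 s`. -/
theorem approx_op_le_norm {s : ℝ≥0} (hs : 0 < s) (t : ℝ≥0) (u : H) :
    T.approx t (T.op s u) (T.op s u) ≤ ((s + s : ℝ≥0) : ℝ)⁻¹ * ‖u‖ ^ 2 := by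
  rcases eq_or_lt_of_le (zero_le (a := t)) with rfl | ht
  · simp only [approx, NNReal.coe_zero, inv_zero, zero_mul]; positivity
  have hs' : (0 : ℝ) < s := hs
  have ht' : (0 : ℝ) < t := ht
  have := (T.convexOn_inner_op u).slope_mono_adjacent (x := 0) (y := (s + s : ℝ≥0))
    (z := (s + s + t : ℝ≥0)) (by simp) (by simp only [Set.mem_Ici]; positivity)
    (by push_cast; positivity) (by push_cast; linarith)
  simp only [Real.toNNReal_coe, Real.toNNReal_zero, T.op_zero, sub_zero] at this
  rw [approx_op_op, inner_sub_left, inv_mul_eq_div, inv_mul_eq_div]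
  have e : ((s + s + t : ℝ≥0) : ℝ) - (s + s : ℝ≥0) = t := by push_cast; ring
  rw [e, real_inner_self_eq_norm_sq] at this
  have h0 := T.inner_op_nonneg (s + s) u
  have h1 : -(‖u‖ ^ 2 / ((s + s : ℝ≥0) : ℝ)) ≤
      (⟪T.op (s + s) u, u⟫ - ‖u‖ ^ 2) / ((s + s : ℝ≥0) : ℝ) := by
    rw [← neg_div]; gcongr; linarith
  rw [← neg_sub, neg_div]
  linarith

/-- The domain of the form of the semigroup: the vectors along which the approximating forms are
bounded. -/
def domain : Submodule ℝ H where
  carrier := {u | ∃ C, ∀ t, T.approx t u u ≤ C}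
  zero_mem' := ⟨0, fun t => by simp [approx]⟩
  add_mem' := by
    rintro u v ⟨C, hC⟩ ⟨C', hC'⟩
    exact ⟨2 * C + 2 * C', fun t => (T.approx_add_self_le t u v).trans (by
      linarith [hC t, hC' t])⟩
  smul_mem' := by
    rintro c u ⟨C, hC⟩
    exact ⟨c ^ 2 * C, fun t => by
      rw [approx_smul_self]; exact mul_le_mul_of_nonneg_left (hC t) (sq_nonneg c)⟩

theorem mem_domain {u : H} : u ∈ T.domain ↔ ∃ C, ∀ t, T.approx t u u ≤ C := Iff.rfl

theorem approx_le_of_tendsto {u : H} {c : ℝ}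
    (h : Tendsto (fun t => T.approx t u u) (𝓝[>] 0) (𝓝 c)) (t : ℝ≥0) : T.approx t u u ≤ c := by
  rcases eq_or_lt_of_le (zero_le (a := t)) with rfl | ht
  · refine le_trans (le_of_eq ?_) (ge_of_tendsto' h fun t => T.approx_nonneg t u)
    simp [approx]
  refine ge_of_tendsto h ?_
  filter_upwards [Ioc_mem_nhdsGT ht] with s hs
  exact T.approx_anti hs.1 hs.2 u

theorem exists_tendsto_of_mem {u : H} (hu : u ∈ T.domain) :
    ∃ c, Tendsto (fun t => T.approx t u u) (𝓝[>] 0) (𝓝 c) := by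
  obtain ⟨C, hC⟩ := hu
  refine ⟨sSup ((fun t => T.approx t u u) '' Set.Ioi 0), ?_⟩
  have hb : BddAbove ((fun t => T.approx t u u) '' Set.Ioi 0) :=
    ⟨C, by rintro _ ⟨t, -, rfl⟩; exact hC t⟩
  rw [tendsto_order]
  constructor
  · intro a ha
    obtain ⟨_, ⟨s, hs, rfl⟩, has⟩ := exists_lt_of_lt_csSup (Set.Nonempty.image _ ⟨1, by simp⟩) ha
    filter_upwards [Ioc_mem_nhdsGT hs] with t ht
    exact has.trans_le (T.approx_anti ht.1 ht.2 u)
  · intro a ha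
    filter_upwards [self_mem_nhdsWithin] with t ht
    exact (le_csSup hb ⟨t, ht, rfl⟩).trans_lt ha

theorem mem_domain_iff_tendsto {u : H} :
    u ∈ T.domain ↔ ∃ c, Tendsto (fun t => T.approx t u u) (𝓝[>] 0) (𝓝 c) :=
  ⟨T.exists_tendsto_of_mem, fun ⟨c, hc⟩ => ⟨c, T.approx_le_of_tendsto hc⟩⟩

theorem approx_polarization (t : ℝ≥0) (u v : H) : T.approx t u v =
    (T.approx t (u + v) (u + v) - T.approx t u u - T.approx t v v) / 2 := by
  rw [approx_add_self]; ring

theorem exists_tendsto_approx {u v : H} (hu : u ∈ T.domain) (hv : v ∈ T.domain) :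
    ∃ c, Tendsto (fun t => T.approx t u v) (𝓝[>] 0) (𝓝 c) := by
  obtain ⟨a, ha⟩ := T.exists_tendsto_of_mem hu
  obtain ⟨b, hb⟩ := T.exists_tendsto_of_mem hv
  obtain ⟨c, hc⟩ := T.exists_tendsto_of_mem (T.domain.add_mem hu hv)
  refine ⟨(c - a - b) / 2, ?_⟩
  simp_rw [T.approx_polarization _ u v]
  exact ((hc.sub ha).sub hb).div_const 2

/-- The form of the semigroup, the limit of the approximating forms. The limit exists when `u` and
`v` belong to the domain; otherwise the value has no meaning. -/
noncomputable def energy (u v : H) : ℝ := limUnder (𝓝[>] 0) fun t => T.approx t u v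

theorem tendsto_energy {u v : H} (hu : u ∈ T.domain) (hv : v ∈ T.domain) :
    Tendsto (fun t => T.approx t u v) (𝓝[>] 0) (𝓝 (T.energy u v)) :=
  tendsto_nhds_limUnder (T.exists_tendsto_approx hu hv)

theorem energy_eq {u v : H} {c : ℝ} (h : Tendsto (fun t => T.approx t u v) (𝓝[>] 0) (𝓝 c)) :
    T.energy u v = c := h.limUnder_eq

theorem approx_le_energy {u : H} (hu : u ∈ T.domain) (t : ℝ≥0) :
    T.approx t u u ≤ T.energy u u :=
  T.approx_le_of_tendsto (T.tendsto_energy hu hu) t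

theorem energy_le {u : H} (hu : u ∈ T.domain) {C : ℝ} (h : ∀ t, T.approx t u u ≤ C) :
    T.energy u u ≤ C :=
  le_of_tendsto' (T.tendsto_energy hu hu) h

theorem energy_nonneg {u : H} (hu : u ∈ T.domain) : 0 ≤ T.energy u u :=
  ge_of_tendsto' (T.tendsto_energy hu hu) fun t => T.approx_nonneg t u

theorem energy_symm (u v : H) : T.energy u v = T.energy v u := by
  simp only [energy, T.approx_symm _ u v]

/-- The form of the semigroup as a bilinear form on its domain. -/
noncomputable def form : LinearMap.BilinForm ℝ T.domain :=
  LinearMap.mk₂ ℝ (fun u v => T.energy (u : H) (v : H))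
    (fun u u' v => T.energy_eq <| by
      simpa [approx_add_left] using
        (T.tendsto_energy u.2 v.2).add (T.tendsto_energy u'.2 v.2))
    (fun c u v => T.energy_eq <| by
      simpa [approx_smul_left] using (T.tendsto_energy u.2 v.2).const_mul c)
    (fun u v v' => by
      rw [T.energy_symm, T.energy_symm (u : H) v, T.energy_symm (u : H) v']
      exact T.energy_eq <| by
        simpa [approx_add_left] using
          (T.tendsto_energy v.2 u.2).add (T.tendsto_energy v'.2 u.2))
    (fun c u v => by
      rw [T.energy_symm, T.energy_symm (u : H) v]
      exact T.energy_eq <| by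
        simpa [approx_smul_left] using (T.tendsto_energy v.2 u.2).const_mul c)

@[simp] theorem form_apply (u v : T.domain) : T.form u v = T.energy (u : H) (v : H) := rfl

theorem op_mem_domain {s : ℝ≥0} (hs : 0 < s) (u : H) : T.op s u ∈ T.domain :=
  ⟨_, fun t => T.approx_op_le_norm hs t u⟩

theorem dense_domain : Dense (T.domain : Set H) := by
  intro u
  refine mem_closure_of_tendsto (T.tendsto_op u) ?_
  filter_upwards [self_mem_nhdsWithin] with s hs
  exact T.op_mem_domain hs u

/-- Bounds of the approximating forms pass to limits in `H`. -/
theorem approx_le_of_tendsto_seq {f : ℕ → H} {u : H} (hf : Tendsto f atTop (𝓝 u)) {C : ℝ}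
    (h : ∀ᶠ n in atTop, ∀ t, T.approx t (f n) (f n) ≤ C) : ∀ t, T.approx t u u ≤ C := fun t =>
  le_of_tendsto (T.tendsto_approx_of_tendsto hf t) (h.mono fun _ hn => hn t)

/-- The form of a symmetric contraction semigroup is closed, by lower semicontinuity. -/
theorem form_closed [CompleteSpace H] (u : ℕ → T.domain)
    (hu : ∀ ε > 0, ∃ N, ∀ i ≥ N, ∀ j ≥ N,
      T.form (u i - u j) (u i - u j) + ⟪u i - u j, u i - u j⟫ < ε) :
    ∃ v : T.domain,
      Tendsto (fun n => T.form (u n - v) (u n - v) + ⟪u n - v, u n - v⟫) atTop (𝓝 0) := by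
  have hE : ∀ w : T.domain, 0 ≤ T.form w w := fun w => T.energy_nonneg w.2
  have hC : CauchySeq fun n => (u n : H) := by
    rw [Metric.cauchySeq_iff]
    intro ε hε
    obtain ⟨N, hN⟩ := hu (ε ^ 2) (by positivity)
    refine ⟨N, fun i hi j hj => ?_⟩
    have h1 := hN i hi j hj
    have h2 := hE (u i - u j)
    rw [real_inner_self_eq_norm_sq] at h1
    rw [dist_eq_norm]
    have : ‖u i - u j‖ ^ 2 < ε ^ 2 := by linarith
    exact lt_of_pow_lt_pow_left₀ 2 hε.le this
  obtain ⟨v, hv⟩ := cauchySeq_tendsto_of_complete hC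
  have key : ∀ ε > 0, ∃ N, ∀ i ≥ N, ∀ t, T.approx t ((u i : H) - v) ((u i : H) - v) ≤ ε := by
    intro ε hε
    obtain ⟨N, hN⟩ := hu ε hε
    refine ⟨N, fun i hi => ?_⟩
    refine T.approx_le_of_tendsto_seq (f := fun j => (u i : H) - u j) (hv.const_sub _) ?_
    filter_upwards [eventually_ge_atTop N] with j hj t
    have h1 := hN i hi j hj
    have h2 := T.approx_le_energy (u i - u j).2 t
    simp only [form_apply] at h1
    have h3 : 0 ≤ ⟪u i - u j, u i - u j⟫ := real_inner_self_nonneg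
    push_cast at h1 h2
    linarith
  obtain ⟨N, hN⟩ := key 1 one_pos
  have hvmem : v ∈ T.domain := by
    have h1 : (u N : H) - v ∈ T.domain := ⟨1, hN N le_rfl⟩
    simpa using T.domain.sub_mem (u N).2 h1
  refine ⟨⟨v, hvmem⟩, ?_⟩
  rw [← add_zero (0 : ℝ)]
  refine Tendsto.add ?_ ?_
  · rw [Metric.tendsto_atTop]
    intro ε hε
    obtain ⟨N, hN⟩ := key (ε / 2) (by positivity)
    refine ⟨N, fun n hn => ?_⟩
    rw [Real.dist_0_eq_abs, abs_of_nonneg (hE _)]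
    have := T.energy_le (u n - ⟨v, hvmem⟩ : T.domain).2 (hN n hn)
    simp only [form_apply]
    linarith
  · have h1 := tendsto_iff_norm_sub_tendsto_zero.1 hv
    have h2 := h1.pow 2
    simp only [real_inner_self_eq_norm_sq]
    simpa using h2

/-! ### Density for the energy norm -/

theorem energy_add_self_le {u v : H} (hu : u ∈ T.domain) (hv : v ∈ T.domain) :
    T.energy (u + v) (u + v) ≤ 2 * T.energy u u + 2 * T.energy v v :=
  T.energy_le (T.domain.add_mem hu hv) fun t => (T.approx_add_self_le t u v).trans (by
    linarith [T.approx_le_energy hu t, T.approx_le_energy hv t])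

theorem energy_op_le {u : H} (hu : u ∈ T.domain) (s : ℝ≥0) :
    T.op s u ∈ T.domain ∧ T.energy (T.op s u) (T.op s u) ≤ T.energy u u := by
  have h : ∀ t, T.approx t (T.op s u) (T.op s u) ≤ T.energy u u := fun t =>
    (T.approx_op_le s t u).trans (T.approx_le_energy hu t)
  exact ⟨⟨_, h⟩, T.energy_le ⟨_, h⟩ h⟩

/-- For `u` in the domain, `T_s u → u` in energy. -/
theorem tendsto_energy_op_sub {u : H} (hu : u ∈ T.domain) :
    Tendsto (fun s => T.energy (T.op s u - u) (T.op s u - u)) (𝓝[>] 0) (𝓝 0) := by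
  have expand : ∀ s, T.energy (T.op s u - u) (T.op s u - u) =
      T.energy (T.op s u) (T.op s u) + T.energy u u
        - 2 * T.energy (T.op (s / 2) u) (T.op (s / 2) u) := by
    intro s
    have h1 := (T.energy_op_le hu s).1
    have h2 := (T.energy_op_le hu (s / 2)).1
    refine T.energy_eq ?_
    have := ((T.tendsto_energy h1 h1).add (T.tendsto_energy hu hu)).sub
      ((T.tendsto_energy h2 h2).const_mul 2)
    refine this.congr fun t => ?_
    rw [T.approx_op_op (s / 2), add_halves]
    simp only [approx, map_sub, inner_sub_left, inner_sub_right, ← T.op_add]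
    have e : ⟪u, T.op s u⟫ = ⟪T.op s u, u⟫ := (T.symm s u u).symm
    have e2 : ⟪T.op t u, T.op s u⟫ = ⟪T.op (s + t) u, u⟫ := by rw [T.op_add, ← T.symm]
    rw [e, e2]
    ring_nf
  have lim : Tendsto (fun s => T.energy (T.op s u) (T.op s u)) (𝓝[>] 0)
      (𝓝 (T.energy u u)) := by
    rw [tendsto_order]
    constructor
    · intro a ha
      obtain ⟨t, ht⟩ := ((tendsto_order.1 (T.tendsto_energy hu hu)).1 a ha).exists
      filter_upwards [(tendsto_order.1
        (T.tendsto_approx_of_tendsto (T.tendsto_op u) t)).1 a ht] with s hs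
      exact hs.trans_le (T.approx_le_energy (T.energy_op_le hu s).1 t)
    · intro a ha
      exact Eventually.of_forall fun s => (T.energy_op_le hu s).2.trans_lt ha
  have half : Tendsto (fun s : ℝ≥0 => s / 2) (𝓝[>] 0) (𝓝[>] 0) := by
    refine tendsto_nhdsWithin_iff.2 ⟨?_, ?_⟩
    · have : Continuous fun s : ℝ≥0 => s / 2 := by fun_prop
      exact (this.tendsto' 0 0 (by simp)).mono_left nhdsWithin_le_nhds
    · filter_upwards [self_mem_nhdsWithin] with s hs
      exact half_pos (Set.mem_Ioi.1 hs)
  simp_rw [expand]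
  have := (lim.add_const (T.energy u u)).sub ((lim.comp half).const_mul 2)
  rwa [show T.energy u u + T.energy u u - 2 * T.energy u u = 0 by ring] at this

/-- If `D` is dense in `H`, the vectors `T_s w` with `s > 0` and `w ∈ D` are dense in the domain
for the energy norm. -/
theorem exists_op_near {D : Set H} (hD : Dense D) {u : H} (hu : u ∈ T.domain) {ε : ℝ}
    (hε : 0 < ε) : ∃ s > 0, ∃ w ∈ D,
      T.energy (u - T.op s w) (u - T.op s w) + ‖u - T.op s w‖ ^ 2 < ε := by
  have h1 : Tendsto (fun s => T.energy (T.op s u - u) (T.op s u - u) + ‖T.op s u - u‖ ^ 2)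
      (𝓝[>] 0) (𝓝 0) := by
    have := (tendsto_iff_norm_sub_tendsto_zero.1 (T.tendsto_op u)).pow 2
    simpa using (T.tendsto_energy_op_sub hu).add this
  obtain ⟨s, hs, hs0⟩ := (((tendsto_order.1 h1).2 (ε / 4) (by positivity)).and
    self_mem_nhdsWithin).exists
  have hs0 : 0 < s := hs0
  set K : ℝ := ((s + s : ℝ≥0) : ℝ)⁻¹ + 1 with hK
  have hKpos : 0 < K := by positivity
  obtain ⟨w, hwD, hw⟩ := hD.exists_dist_lt u (ε := Real.sqrt (ε / (4 * K))) (by positivity)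
  refine ⟨s, hs0, w, hwD, ?_⟩
  rw [dist_eq_norm] at hw
  have hw2 : ‖u - w‖ ^ 2 < ε / (4 * K) := by
    have := pow_lt_pow_left₀ hw (norm_nonneg _) two_ne_zero
    rwa [Real.sq_sqrt (by positivity)] at this
  have hmem := (T.energy_op_le hu s).1
  have e : u - T.op s w = (-1 : ℝ) • (T.op s u - u) + T.op s (u - w) := by
    rw [map_sub]; module
  have m1 : (-1 : ℝ) • (T.op s u - u) ∈ T.domain :=
    T.domain.smul_mem _ (T.domain.sub_mem hmem hu)
  have m2 := T.op_mem_domain hs0 (u - w)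
  have b1 : T.energy ((-1 : ℝ) • (T.op s u - u)) ((-1 : ℝ) • (T.op s u - u)) ≤
      T.energy (T.op s u - u) (T.op s u - u) := T.energy_le m1 fun t => by
    rw [approx_smul_self]
    linarith [T.approx_le_energy (T.domain.sub_mem hmem hu) t]
  have b2 := T.energy_le m2 fun t => T.approx_op_le_norm hs0 t (u - w)
  have b3 := T.energy_add_self_le m1 m2
  have b4 := parallelogram_law_with_norm ℝ ((-1 : ℝ) • (T.op s u - u)) (T.op s (u - w))
  have b5 : ‖T.op s (u - w)‖ ^ 2 ≤ ‖u - w‖ ^ 2 := by gcongr; exact T.norm_op_le _ _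
  have b6 : ‖(-1 : ℝ) • (T.op s u - u)‖ = ‖T.op s u - u‖ := by rw [neg_one_smul, norm_neg]
  rw [← e] at b3 b4
  rw [b6] at b4
  have b7 : K * ‖u - w‖ ^ 2 < ε / 4 := by
    rw [lt_div_iff₀ (by positivity)] at hw2
    linarith
  rw [hK] at b7
  nlinarith [sq_nonneg ‖(-1 : ℝ) • (T.op s u - u) - T.op s (u - w)‖]

/-! ### The product of two commuting semigroups -/

/-- The product `t ↦ T_t S_t` of two commuting semigroups. -/
@[simps]
def prod (S : SymmSemigroup H) (hcomm : ∀ s t u, T.op t (S.op s u) = S.op s (T.op t u)) :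
    SymmSemigroup H where
  op t := (T.op t).comp (S.op t)
  op_zero u := by simp [T.op_zero, S.op_zero]
  op_add s t u := by simp [T.op_add, S.op_add, hcomm]
  symm t u v := by simp [T.symm, S.symm, hcomm]
  norm_op_le t u := (T.norm_op_le _ _).trans (S.norm_op_le _ _)
  tendsto_op u := by
    rw [tendsto_iff_norm_sub_tendsto_zero]
    have h1 := tendsto_iff_norm_sub_tendsto_zero.1 (T.tendsto_op u)
    have h2 := tendsto_iff_norm_sub_tendsto_zero.1 (S.tendsto_op u)
    refine squeeze_zero (fun _ => norm_nonneg _) (fun t => ?_) (by simpa using h2.add h1)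
    have e : (T.op t).comp (S.op t) u - u = T.op t (S.op t u - u) + (T.op t u - u) := by
      simp [map_sub]
    rw [e]
    exact (norm_add_le _ _).trans (by gcongr; exact T.norm_op_le _ _)

variable {T} {S : SymmSemigroup H} {hcomm : ∀ s t u, T.op t (S.op s u) = S.op s (T.op t u)}

theorem approx_prod (t : ℝ≥0) (u : H) :
    (T.prod S hcomm).approx t u u =
      S.approx t u u + T.approx t (S.op (t / 2) u) (S.op (t / 2) u) := by
  have e : ⟪S.op (t / 2) u - T.op t (S.op (t / 2) u), S.op (t / 2) u⟫ =
      ⟪S.op t u - T.op t (S.op t u), u⟫ := by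
    have h2 : ∀ w, S.op t w = S.op (t / 2) (S.op (t / 2) w) := fun w => by
      rw [← S.op_add, add_halves]
    rw [h2 u, ← S.symm, map_sub, hcomm, hcomm, hcomm]
  simp only [approx, e, prod_op, ContinuousLinearMap.comp_apply, inner_sub_left]
  ring

theorem approx_right_le_prod (t : ℝ≥0) (u : H) :
    S.approx t u u ≤ (T.prod S hcomm).approx t u u := by
  rw [approx_prod]; linarith [T.approx_nonneg t (S.op (t / 2) u)]

theorem prod_swap_approx (t : ℝ≥0) (u v : H) :
    (S.prod T fun s t u => (hcomm t s u).symm).approx t u v = (T.prod S hcomm).approx t u v := by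
  simp [approx, hcomm]

theorem approx_left_le_prod (t : ℝ≥0) (u : H) :
    T.approx t u u ≤ (T.prod S hcomm).approx t u u := by
  rw [← prod_swap_approx]
  exact approx_right_le_prod t u

theorem approx_prod_le (t : ℝ≥0) (u : H) :
    (T.prod S hcomm).approx t u u ≤ S.approx t u u + T.approx t u u := by
  rw [approx_prod]
  gcongr
  exact T.approx_op_le_of_commute S hcomm _ _ _

theorem mem_domain_prod {u : H} :
    u ∈ (T.prod S hcomm).domain ↔ u ∈ T.domain ∧ u ∈ S.domain := by
  constructor
  · rintro ⟨C, hC⟩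
    exact ⟨⟨C, fun t => (approx_left_le_prod t u).trans (hC t)⟩,
      ⟨C, fun t => (approx_right_le_prod t u).trans (hC t)⟩⟩
  · rintro ⟨⟨C, hC⟩, ⟨C', hC'⟩⟩
    exact ⟨C' + C, fun t => (approx_prod_le t u).trans (add_le_add (hC' t) (hC t))⟩

/-- The form of the product semigroup is the sum of the forms. The cross term is handled by
`(1/t) ⟪u - T_t S_t u, u⟫ = (1/t) ⟪u - S_t u, u⟫ + (1/t) ⟪w - T_t w, w⟫` with
`w = S_{t/2} u`, the last summand being squeezed by monotonicity. -/
theorem energy_prod_self {u : H} (hT : u ∈ T.domain) (hS : u ∈ S.domain) :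
    (T.prod S hcomm).energy u u = T.energy u u + S.energy u u := by
  have hP : u ∈ (T.prod S hcomm).domain := mem_domain_prod.2 ⟨hT, hS⟩
  refine le_antisymm ?_ ?_
  · refine energy_le _ hP fun t => (approx_prod_le t u).trans ?_
    linarith [S.approx_le_energy hS t, T.approx_le_energy hT t]
  · have lower : ∀ s > 0, T.approx s u u + S.energy u u ≤ (T.prod S hcomm).energy u u := by
      intro s hs
      have hhalf : Tendsto (fun t : ℝ≥0 => t / 2) (𝓝[>] 0) (𝓝 0) := by
        have : Continuous fun s : ℝ≥0 => s / 2 := by fun_prop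
        exact (this.tendsto' 0 0 (by simp)).mono_left nhdsWithin_le_nhds
      have h1 := T.tendsto_approx_of_tendsto ((S.tendsto_op_nhds_zero u).comp hhalf) s
      refine le_of_tendsto_of_tendsto (h1.add (S.tendsto_energy hS hS))
        ((T.prod S hcomm).tendsto_energy hP hP) ?_
      filter_upwards [Ioc_mem_nhdsGT hs] with t ht
      rw [approx_prod]
      have := T.approx_anti ht.1 ht.2 (S.op (t / 2) u)
      simp only [Function.comp_apply]
      linarith
    have := (T.tendsto_energy hT hT).add_const (S.energy u u)
    refine le_of_tendsto this ?_
    filter_upwards [self_mem_nhdsWithin] with s hs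
    exact lower s hs

theorem energy_polarization (T : SymmSemigroup H) {u v : H} (hu : u ∈ T.domain)
    (hv : v ∈ T.domain) :
    T.energy u v = (T.energy (u + v) (u + v) - T.energy u u - T.energy v v) / 2 := by
  have huv := T.domain.add_mem hu hv
  refine T.energy_eq ?_
  simp_rw [T.approx_polarization _ u v]
  exact (((T.tendsto_energy huv huv).sub (T.tendsto_energy hu hu)).sub
    (T.tendsto_energy hv hv)).div_const 2

theorem energy_prod {u v : H} (hu : u ∈ (T.prod S hcomm).domain)
    (hv : v ∈ (T.prod S hcomm).domain) :
    (T.prod S hcomm).energy u v = T.energy u v + S.energy u v := by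
  have huv := mem_domain_prod.1 ((T.prod S hcomm).domain.add_mem hu hv)
  rw [energy_polarization _ hu hv]
  rw [mem_domain_prod] at hu hv
  rw [energy_prod_self huv.1 huv.2, energy_prod_self hu.1 hu.2, energy_prod_self hv.1 hv.2,
    energy_polarization T hu.1 hv.1, energy_polarization S hu.2 hv.2]
  ring

end SymmSemigroup

/-! ### Symmetric sub-Markov kernels as operators on `L²` -/

/-- A kernel with total masses at most one which is symmetric with respect to `μ`. -/
structure IsSymmSubMarkov {S : Type*} [MeasurableSpace S] (κ : Kernel S S) (μ : Measure S) :
    Prop where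
  le_one : ∀ x, κ x Set.univ ≤ 1
  lintegral_symm : ∀ f g : S → ℝ≥0∞, Measurable f → Measurable g →
    ∫⁻ x, f x * (∫⁻ y, g y ∂κ x) ∂μ = ∫⁻ x, (∫⁻ y, f y ∂κ x) * g x ∂μ

namespace IsSymmSubMarkov

variable {S : Type*} [MeasurableSpace S] {μ : Measure S} {κ η : Kernel S S}

theorem isFiniteKernel (h : IsSymmSubMarkov κ μ) : IsFiniteKernel κ :=
  ⟨1, ENNReal.one_lt_top, h.le_one⟩

theorem lintegral_lintegral_le (h : IsSymmSubMarkov κ μ) {f : S → ℝ≥0∞} (hf : Measurable f) :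
    ∫⁻ x, ∫⁻ y, f y ∂κ x ∂μ ≤ ∫⁻ x, f x ∂μ := by
  have := h.lintegral_symm (fun _ => 1) f measurable_const hf
  simp only [one_mul, lintegral_one] at this
  rw [this]
  exact lintegral_mono fun x => (mul_le_mul_left (h.le_one x) _).trans (one_mul _).le

theorem ae_ae (h : IsSymmSubMarkov κ μ) {p : S → Prop} (hp : ∀ᵐ y ∂μ, p y) :
    ∀ᵐ x ∂μ, ∀ᵐ y ∂κ x, p y := by
  obtain ⟨N, hN, hNm, hN0⟩ := exists_measurable_superset_of_null hp
  have h1 := h.lintegral_lintegral_le (measurable_one.indicator hNm)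
  simp only [lintegral_indicator_one hNm] at h1
  rw [hN0, nonpos_iff_eq_zero, lintegral_eq_zero_iff (κ.measurable_coe hNm)] at h1
  filter_upwards [h1] with x hx
  exact measure_mono_null hN hx

theorem enorm_integral_sq_le (h : IsSymmSubMarkov κ μ) {f : S → ℝ} (x : S)
    (hf : AEStronglyMeasurable f (κ x)) :
    ‖∫ y, f y ∂κ x‖ₑ ^ 2 ≤ ∫⁻ y, ‖f y‖ₑ ^ 2 ∂κ x := by
  have h1 : ‖∫ y, f y ∂κ x‖ₑ ≤ eLpNorm f 2 (κ x) := by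
    calc ‖∫ y, f y ∂κ x‖ₑ ≤ ∫⁻ y, ‖f y‖ₑ ∂κ x := enorm_integral_le_lintegral_enorm _
      _ = eLpNorm f 1 (κ x) := eLpNorm_one_eq_lintegral_enorm.symm
      _ ≤ eLpNorm f 2 (κ x) * κ x Set.univ ^ (1 / (1 : ℝ≥0∞).toReal - 1 / (2 : ℝ≥0∞).toReal) :=
        eLpNorm_le_eLpNorm_mul_rpow_measure_univ (by norm_num) hf
      _ ≤ eLpNorm f 2 (κ x) * 1 := by
        gcongr
        exact ENNReal.rpow_le_one (h.le_one x) (by norm_num)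
      _ = _ := mul_one _
  refine (pow_le_pow_left₀ (zero_le) h1 2).trans (le_of_eq ?_)
  have := eLpNorm_nnreal_pow_eq_lintegral (f := f) (μ := κ x) (p := 2) (by norm_num)
  simpa using this

theorem memLp_ae (h : IsSymmSubMarkov κ μ) {f : S → ℝ} (hf : MemLp f 2 μ) :
    ∀ᵐ x ∂μ, MemLp f 2 (κ x) := by
  have hm := hf.1.ae_eq_mk
  set g := hf.1.mk f with hg
  have hgm : StronglyMeasurable g := hf.1.stronglyMeasurable_mk
  have hg2 : MemLp g 2 μ := hf.ae_eq hm
  have hfin : ∫⁻ x, ∫⁻ y, ‖g y‖ₑ ^ 2 ∂κ x ∂μ < ∞ := by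
    refine (h.lintegral_lintegral_le (hgm.measurable.enorm.pow_const 2)).trans_lt ?_
    have := eLpNorm_nnreal_pow_eq_lintegral (f := g) (μ := μ) (p := 2) (by norm_num)
    have h2 : eLpNorm g 2 μ ^ 2 < ∞ := ENNReal.pow_lt_top hg2.2
    simp only [NNReal.coe_ofNat, ENNReal.coe_ofNat, ENNReal.rpow_ofNat] at this
    rwa [← this]
  have hfin2 := ae_lt_top (hgm.measurable.enorm.pow_const 2).lintegral_kernel hfin.ne
  filter_upwards [hfin2, h.ae_ae hm] with x hx hx2
  refine MemLp.ae_eq (EventuallyEq.symm hx2) ⟨hgm.aestronglyMeasurable, ?_⟩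
  have := eLpNorm_nnreal_pow_eq_lintegral (f := g) (μ := κ x) (p := 2) (by norm_num)
  simp only [NNReal.coe_ofNat, ENNReal.coe_ofNat, ENNReal.rpow_ofNat] at this
  rw [← this] at hx
  exact (ENNReal.pow_lt_top_iff.1 hx).resolve_right two_ne_zero

theorem integrable_ae (h : IsSymmSubMarkov κ μ) {f : S → ℝ} (hf : MemLp f 2 μ) :
    ∀ᵐ x ∂μ, Integrable f (κ x) := by
  have := h.isFiniteKernel
  filter_upwards [h.memLp_ae hf] with x hx
  exact hx.integrable (by norm_num)

theorem integral_congr_ae (h : IsSymmSubMarkov κ μ) {f g : S → ℝ} (hfg : f =ᵐ[μ] g) :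
    (fun x => ∫ y, f y ∂κ x) =ᵐ[μ] fun x => ∫ y, g y ∂κ x := by
  filter_upwards [h.ae_ae hfg] with x hx
  exact MeasureTheory.integral_congr_ae hx

theorem aestronglyMeasurable_integral (h : IsSymmSubMarkov κ μ) {f : S → ℝ}
    (hf : AEStronglyMeasurable f μ) :
    AEStronglyMeasurable (fun x => ∫ y, f y ∂κ x) μ := by
  have := h.isFiniteKernel
  refine AEStronglyMeasurable.congr ?_ (h.integral_congr_ae hf.ae_eq_mk).symm
  exact hf.stronglyMeasurable_mk.integral_kernel.aestronglyMeasurable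

theorem eLpNorm_integral_le (h : IsSymmSubMarkov κ μ) {f : S → ℝ}
    (hf : AEStronglyMeasurable f μ) :
    eLpNorm (fun x => ∫ y, f y ∂κ x) 2 μ ≤ eLpNorm f 2 μ := by
  rw [eLpNorm_congr_ae (h.integral_congr_ae hf.ae_eq_mk), eLpNorm_congr_ae hf.ae_eq_mk]
  have hgm := hf.stronglyMeasurable_mk
  have e := fun g : S → ℝ => eLpNorm_nnreal_pow_eq_lintegral (f := g) (μ := μ) (p := 2)
    (by norm_num)
  simp only [NNReal.coe_ofNat, ENNReal.coe_ofNat, ENNReal.rpow_ofNat] at e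
  rw [← ENNReal.pow_le_pow_left_iff two_ne_zero, e, e]
  refine le_trans (lintegral_mono fun x => ?_)
    (h.lintegral_lintegral_le (hgm.measurable.enorm.pow_const 2))
  exact h.enorm_integral_sq_le x hgm.aestronglyMeasurable

theorem memLp_integral (h : IsSymmSubMarkov κ μ) {f : S → ℝ} (hf : MemLp f 2 μ) :
    MemLp (fun x => ∫ y, f y ∂κ x) 2 μ :=
  ⟨h.aestronglyMeasurable_integral hf.1, (h.eLpNorm_integral_le hf.1).trans_lt hf.2⟩

/-- The operator `u ↦ ∫ u(y) κ(·, dy)` on `L²(μ)`. It is well defined on classes because the kernel,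
being symmetric, does not charge `μ`-null sets when started from `μ`-almost every point. -/
noncomputable def lpOp (h : IsSymmSubMarkov κ μ) : Lp ℝ 2 μ →L[ℝ] Lp ℝ 2 μ :=
  LinearMap.mkContinuous
    { toFun := fun u => (h.memLp_integral (Lp.memLp u)).toLp _
      map_add' := fun u v => by
        rw [← MemLp.toLp_add, MemLp.toLp_eq_toLp_iff]
        filter_upwards [h.integral_congr_ae (Lp.coeFn_add u v), h.integrable_ae (Lp.memLp u),
          h.integrable_ae (Lp.memLp v)] with x hx hu hv
        rw [hx]
        exact integral_add hu hv
      map_smul' := fun c u => by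
        rw [RingHom.id_apply, ← MemLp.toLp_const_smul, MemLp.toLp_eq_toLp_iff]
        filter_upwards [h.integral_congr_ae (Lp.coeFn_smul c u)] with x hx
        rw [hx]
        exact integral_const_mul c _ }
    1 fun u => by
      rw [one_mul]
      simp only [LinearMap.coe_mk, AddHom.coe_mk]
      rw [Lp.norm_toLp, Lp.norm_def]
      exact ENNReal.toReal_mono (Lp.eLpNorm_ne_top u) (h.eLpNorm_integral_le (Lp.memLp u).1)

theorem coeFn_lpOp (h : IsSymmSubMarkov κ μ) (u : Lp ℝ 2 μ) :
    h.lpOp u =ᵐ[μ] fun x => ∫ y, u y ∂κ x :=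
  (h.memLp_integral (Lp.memLp u)).coeFn_toLp

theorem lpOp_toLp (h : IsSymmSubMarkov κ μ) {f : S → ℝ} (hf : MemLp f 2 μ) :
    h.lpOp (hf.toLp f) = (h.memLp_integral hf).toLp _ := by
  refine Lp.ext ((h.coeFn_lpOp _).trans ?_)
  exact (h.integral_congr_ae hf.coeFn_toLp).trans (MemLp.coeFn_toLp _).symm

theorem norm_lpOp_le (h : IsSymmSubMarkov κ μ) (u : Lp ℝ 2 μ) : ‖h.lpOp u‖ ≤ ‖u‖ := by
  have := (h.lpOp).le_of_opNorm_le (LinearMap.mkContinuous_norm_le _ zero_le_one _) u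
  rwa [one_mul] at this

theorem lpOp_nonneg (h : IsSymmSubMarkov κ μ) {u : Lp ℝ 2 μ} (hu : 0 ≤ u) : 0 ≤ h.lpOp u := by
  rw [← Lp.coeFn_nonneg] at hu ⊢
  filter_upwards [h.coeFn_lpOp u, h.ae_ae hu] with x hx hx2
  rw [hx]
  exact integral_nonneg_of_ae hx2

theorem inner_lpOp_eq_lintegral (h : IsSymmSubMarkov κ μ) {u v : Lp ℝ 2 μ} (hu : 0 ≤ u)
    (hv : 0 ≤ v) : ⟪u, h.lpOp v⟫ =
      (∫⁻ x, ENNReal.ofReal (u x) * ∫⁻ y, ENNReal.ofReal (v y) ∂κ x ∂μ).toReal := by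
  have hTv := h.lpOp_nonneg hv
  rw [L2.inner_def]
  simp only [RCLike.inner_apply, conj_trivial]
  rw [integral_eq_lintegral_of_nonneg_ae]
  · congr 1
    rw [← Lp.coeFn_nonneg] at hu hv
    refine lintegral_congr_ae ?_
    filter_upwards [hu, h.coeFn_lpOp v, h.ae_ae hv, h.integrable_ae (Lp.memLp v)]
      with x hx1 hx2 hx3 hx4
    rw [mul_comm, ENNReal.ofReal_mul hx1, hx2, ofReal_integral_eq_lintegral_ofReal hx4 hx3]
  · rw [← Lp.coeFn_nonneg] at hu hTv
    filter_upwards [hu, hTv] with x h1 h2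
    exact mul_nonneg h2 h1
  · exact ((Lp.aestronglyMeasurable _).mul (Lp.aestronglyMeasurable _))

theorem inner_lpOp (h : IsSymmSubMarkov κ μ) (u v : Lp ℝ 2 μ) :
    ⟪h.lpOp u, v⟫ = ⟪u, h.lpOp v⟫ := by
  have key : ∀ u v : Lp ℝ 2 μ, 0 ≤ u → 0 ≤ v → ⟪h.lpOp u, v⟫ = ⟪u, h.lpOp v⟫ := by
    intro u v hu hv
    rw [real_inner_comm, h.inner_lpOp_eq_lintegral hu hv, h.inner_lpOp_eq_lintegral hv hu]
    have := h.lintegral_symm (fun x => ENNReal.ofReal (u x)) (fun x => ENNReal.ofReal (v x))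
      (Lp.stronglyMeasurable u).measurable.ennreal_ofReal
      (Lp.stronglyMeasurable v).measurable.ennreal_ofReal
    rw [this]
    simp only [mul_comm]
  rw [← posPart_sub_negPart u, ← posPart_sub_negPart v]
  simp only [map_sub, inner_sub_left, inner_sub_right]
  rw [key _ _ (posPart_nonneg u) (posPart_nonneg v), key _ _ (posPart_nonneg u) (negPart_nonneg v),
    key _ _ (negPart_nonneg u) (posPart_nonneg v), key _ _ (negPart_nonneg u) (negPart_nonneg v)]

theorem lpOp_comp {θ : Kernel S S} (h : IsSymmSubMarkov κ μ) (h' : IsSymmSubMarkov η μ)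
    (hθ : IsSymmSubMarkov θ μ) (hcomp : θ = η ∘ₖ κ) (u : Lp ℝ 2 μ) :
    hθ.lpOp u = h.lpOp (h'.lpOp u) := by
  refine Lp.ext ?_
  filter_upwards [hθ.coeFn_lpOp u, h.coeFn_lpOp (h'.lpOp u),
    h.integral_congr_ae (h'.coeFn_lpOp u), hθ.integrable_ae (Lp.memLp u)] with x h1 h2 h3 h4
  rw [h1, h2, h3]
  rw [hcomp] at h4 ⊢
  rw [Kernel.integral_comp h4]

end IsSymmSubMarkov

/-! ### The Dirichlet form of a sub-Markovian semigroup -/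

/-- The unit contraction does not increase `⟪u - κ u, u⟫`: with `v = (0 ∨ u) ∧ 1` and `w = u - v`,
the cross term `⟪v - κ v, w⟫` is non-negative pointwise, because `v = 1 ≥ κ v` where `w > 0` and
`v = 0 ≤ κ v` where `w < 0`. -/
theorem IsSymmSubMarkov.inner_unitContraction_le {S : Type*} [MeasurableSpace S] {μ : Measure S}
    {κ : Kernel S S} (h : IsSymmSubMarkov κ μ) {u v : Lp ℝ 2 μ}
    (hv : v =ᵐ[μ] fun x => min (max 0 (u x)) 1) :
    ⟪v - h.lpOp v, v⟫ ≤ ⟪u - h.lpOp u, u⟫ := by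
  have hnn : ∀ w : Lp ℝ 2 μ, 0 ≤ ⟪w - h.lpOp w, w⟫ := fun w => by
    rw [inner_sub_left, sub_nonneg]
    refine (real_inner_le_norm _ _).trans ?_
    rw [real_inner_self_eq_norm_mul_norm]
    gcongr
    exact h.norm_lpOp_le w
  have cross : 0 ≤ ⟪v - h.lpOp v, u - v⟫ := by
    rw [L2.inner_def]
    refine integral_nonneg_of_ae ?_
    have := h.isFiniteKernel
    filter_upwards [hv, h.ae_ae hv, h.coeFn_lpOp v, Lp.coeFn_sub u v, Lp.coeFn_sub v (h.lpOp v),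
      h.integrable_ae (Lp.memLp v)] with x h1 h2 h3 h4 h5 h6
    simp only [RCLike.inner_apply, conj_trivial, Pi.zero_apply]
    rw [h4, h5, Pi.sub_apply, Pi.sub_apply, h3]
    have b0 : 0 ≤ ∫ y, v y ∂κ x := integral_nonneg_of_ae <| by
      filter_upwards [h2] with y hy
      rw [hy]
      exact le_min (le_max_left _ _) zero_le_one
    have b1 : ∫ y, v y ∂κ x ≤ 1 := by
      calc ∫ y, v y ∂κ x ≤ ∫ y, (1 : ℝ) ∂κ x := by
            refine integral_mono_ae h6 (integrable_const _) ?_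
            filter_upwards [h2] with y hy
            rw [hy]
            exact min_le_right _ _
        _ = (κ x).real Set.univ := by simp
        _ ≤ 1 := ENNReal.toReal_le_of_le_ofReal zero_le_one (by simpa using h.le_one x)
    rw [h1]
    rcases le_total (u x) 0 with hu | hu
    · rw [max_eq_left hu, min_eq_left zero_le_one]
      nlinarith
    · rw [max_eq_right hu]
      rcases le_total (u x) 1 with hu1 | hu1
      · rw [min_eq_left hu1, sub_self, zero_mul]
      · rw [min_eq_right hu1]
        exact mul_nonneg (by linarith) (by linarith)
  have e : ⟪u - h.lpOp u, u⟫ = ⟪v - h.lpOp v, v⟫ + 2 * ⟪v - h.lpOp v, u - v⟫ +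
      ⟪(u - v) - h.lpOp (u - v), u - v⟫ := by
    have s1 : ⟪h.lpOp v, u⟫ = ⟪h.lpOp u, v⟫ := by rw [h.inner_lpOp, real_inner_comm]
    simp only [map_sub, inner_sub_left, inner_sub_right, s1, real_inner_comm u v]
    ring
  rw [e]
  linarith [hnn (u - v)]

/-- The Dirichlet form of a symmetric contraction semigroup given by sub-Markov kernels. -/
noncomputable def SymmSemigroup.dirichletForm {S : Type*} [MeasurableSpace S] {μ : Measure S}
    (T : SymmSemigroup (Lp ℝ 2 μ)) (κ : ℝ≥0 → Kernel S S) (hκ : ∀ t, IsSymmSubMarkov (κ t) μ)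
    (hT : ∀ t, T.op t = (hκ t).lpOp) : DirichletForm μ where
  domain := T.domain
  form := T.form
  symm u v := T.energy_symm _ _
  nonneg u := T.energy_nonneg u.2
  dense := T.dense_domain
  closed := T.form_closed
  markov u := by
    have hm : MemLp (fun x => min (max 0 ((u : Lp ℝ 2 μ) x)) 1) 2 μ := by
      refine (Lp.memLp (u : Lp ℝ 2 μ)).mono ?_ (ae_of_all _ fun x => ?_)
      · exact (measurable_const.max (Lp.stronglyMeasurable (u : Lp ℝ 2 μ)).measurable).min
          measurable_const |>.aestronglyMeasurable
      · rw [Real.norm_eq_abs, abs_of_nonneg (le_min (le_max_left _ _) zero_le_one)]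
        refine (min_le_left _ _).trans (max_le (norm_nonneg _) (Real.le_norm_self _))
    have hle : ∀ t, T.approx t (hm.toLp _) (hm.toLp _) ≤ T.approx t u u := fun t => by
      rw [approx, approx, hT]
      exact mul_le_mul_of_nonneg_left ((hκ t).inner_unitContraction_le hm.coeFn_toLp)
        (by positivity)
    have hle' : ∀ t, T.approx t (hm.toLp _) (hm.toLp _) ≤ T.energy u u := fun t =>
      (hle t).trans (T.approx_le_energy u.2 t)
    exact ⟨⟨hm.toLp _, _, hle'⟩, hm.coeFn_toLp, T.energy_le ⟨_, hle'⟩ hle'⟩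

/-! ### Products of kernels -/

namespace IsSymmSubMarkov

variable {S₁ S₂ : Type*} [MeasurableSpace S₁] [MeasurableSpace S₂] {μ₁ : Measure S₁}
  {μ₂ : Measure S₂} {κ : Kernel S₁ S₁} {η : Kernel S₂ S₂}

theorem id {S : Type*} [MeasurableSpace S] (μ : Measure S) :
    IsSymmSubMarkov (Kernel.id : Kernel S S) μ where
  le_one x := prob_le_one
  lintegral_symm f g hf hg := by
    simp only [Kernel.id_apply, lintegral_dirac' _ hf, lintegral_dirac' _ hg]

theorem parallelComp [SFinite μ₁] [SFinite μ₂] [IsFiniteKernel κ] [IsFiniteKernel η]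
    (h₁ : IsSymmSubMarkov κ μ₁) (h₂ : IsSymmSubMarkov η μ₂) :
    IsSymmSubMarkov (κ ∥ₖ η) (μ₁.prod μ₂) where
  le_one x := by
    rw [Kernel.parallelComp_apply_univ]
    exact mul_le_one' (h₁.le_one _) (h₂.le_one _)
  lintegral_symm f g hf hg := by
    have hG : Measurable fun z : S₁ × S₂ => ∫⁻ y, g (z.1, y) ∂η z.2 :=
      Measurable.lintegral_kernel_prod_right (κ := Kernel.prodMkLeft S₁ η)
        (f := fun z y => g (z.1, y)) (by unfold Function.uncurry; fun_prop)
    have hF : Measurable fun z : S₁ × S₂ => ∫⁻ x, f (x, z.2) ∂κ z.1 :=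
      Measurable.lintegral_kernel_prod_right (κ := Kernel.prodMkRight S₂ κ)
        (f := fun z x => f (x, z.2)) (by unfold Function.uncurry; fun_prop)
    calc ∫⁻ z, f z * (∫⁻ w, g w ∂(κ ∥ₖ η) z) ∂(μ₁.prod μ₂)
        = ∫⁻ y, ∫⁻ x, f (x, y) * (∫⁻ x', (∫⁻ y', g (x', y') ∂η y) ∂κ x) ∂μ₁ ∂μ₂ := by
          have hm : Measurable fun z => f z * (∫⁻ w, g w ∂(κ ∥ₖ η) z) := hf.mul hg.lintegral_kernel
          rw [lintegral_prod_symm _ hm.aemeasurable]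
          refine lintegral_congr fun y => lintegral_congr fun x => ?_
          rw [Kernel.parallelComp_apply, lintegral_prod _ hg.aemeasurable]
      _ = ∫⁻ y, ∫⁻ x, (∫⁻ x', f (x', y) ∂κ x) * (∫⁻ y', g (x, y') ∂η y) ∂μ₁ ∂μ₂ := by
          refine lintegral_congr fun y => ?_
          exact h₁.lintegral_symm (fun x => f (x, y)) (fun x => ∫⁻ y', g (x, y') ∂η y)
            (by fun_prop) (hG.comp (measurable_id.prodMk measurable_const))
      _ = ∫⁻ x, ∫⁻ y, (∫⁻ x', f (x', y) ∂κ x) * (∫⁻ y', g (x, y') ∂η y) ∂μ₂ ∂μ₁ :=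
          lintegral_lintegral_swap ((hF.mul hG).comp measurable_swap).aemeasurable
      _ = ∫⁻ x, ∫⁻ y, (∫⁻ y', (∫⁻ x', f (x', y') ∂κ x) ∂η y) * g (x, y) ∂μ₂ ∂μ₁ := by
          refine lintegral_congr fun x => ?_
          exact h₂.lintegral_symm (fun y => ∫⁻ x', f (x', y) ∂κ x) (fun y => g (x, y))
            (hF.comp (measurable_const.prodMk measurable_id)) (by fun_prop)
      _ = ∫⁻ z, (∫⁻ w, f w ∂(κ ∥ₖ η) z) * g z ∂(μ₁.prod μ₂) := by
          have hm : Measurable fun z => (∫⁻ w, f w ∂(κ ∥ₖ η) z) * g z := hf.lintegral_kernel.mul hg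
          rw [lintegral_prod _ hm.aemeasurable]
          refine lintegral_congr fun x => lintegral_congr fun y => ?_
          rw [Kernel.parallelComp_apply, lintegral_prod_symm _ hf.aemeasurable]

end IsSymmSubMarkov

/-- Two kernels started independently. -/
theorem parallelComp_comp_measure_prod {α β γ δ : Type*} [MeasurableSpace α] [MeasurableSpace β]
    [MeasurableSpace γ] [MeasurableSpace δ] (μ : Measure α) (ν : Measure β) [SFinite μ] [SFinite ν]
    (κ : Kernel α γ) (η : Kernel β δ) [IsSFiniteKernel κ] [IsSFiniteKernel η] :
    (κ ∥ₖ η) ∘ₘ (μ.prod ν) = (κ ∘ₘ μ).prod (η ∘ₘ ν) := by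
  rw [Measure.prod_comp_left, Measure.prod_comp_right, Measure.comp_assoc,
    Kernel.parallelComp_comp_parallelComp, Kernel.comp_id, Kernel.id_comp]

/-! ### Transition kernels of Markov processes -/

namespace ProcessFamily

variable {E₁ E₂ : Type*}

@[simp] theorem pair_none_left (b : Option E₂) : pair (none : Option E₁) b = none := rfl

@[simp] theorem pair_none_right (a : Option E₁) : pair a (none : Option E₂) = none := by
  cases a <;> rfl

@[simp] theorem pair_some (x : E₁) (y : E₂) : pair (some x) (some y) = some (x, y) := rfl

end ProcessFamily

section Cemetery

variable {E E₁ E₂ F : Type*} [MeasurableSpace E] [MeasurableSpace E₁] [MeasurableSpace E₂]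
  [MeasurableSpace F]

theorem measurableSet_cemetery {A : Set (Option E)} :
    MeasurableSet A ↔ MeasurableSet (some ⁻¹' A) := Iff.rfl

theorem measurable_cemetery_iff {f : Option E → F} : Measurable f ↔ Measurable (f ∘ some) :=
  Iff.rfl

theorem measurableEmbedding_some : MeasurableEmbedding (some : E → Option E) where
  injective := Option.some_injective E
  measurable := measurable_cemetery_iff.1 measurable_id
  measurableSet_image' s hs := by
    rwa [measurableSet_cemetery, Set.preimage_image_eq _ (Option.some_injective E)]

theorem measurableSet_none : MeasurableSet ({none} : Set (Option E)) := by
  rw [measurableSet_cemetery]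
  convert MeasurableSet.empty (α := E)
  ext; simp

theorem measurable_pair :
    Measurable fun p : Option E₁ × Option E₂ => ProcessFamily.pair p.1 p.2 := by
  rcases isEmpty_or_nonempty E₁ with h₁ | ⟨⟨x₀⟩⟩
  · convert measurable_const (a := none) with p
    rcases p with ⟨_ | x, b⟩
    · rfl
    · exact h₁.elim x
  rcases isEmpty_or_nonempty E₂ with h₂ | ⟨⟨y₀⟩⟩
  · convert measurable_const (a := none) with p
    rcases p with ⟨a, _ | y⟩
    · simp
    · exact h₂.elim y
  classical
  have h1 : Measurable fun a : Option E₁ => a.getD x₀ := measurable_cemetery_iff.2 measurable_id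
  have h2 : Measurable fun b : Option E₂ => b.getD y₀ := measurable_cemetery_iff.2 measurable_id
  have e : (fun p : Option E₁ × Option E₂ => ProcessFamily.pair p.1 p.2) = fun p =>
      if p ∈ {p : Option E₁ × Option E₂ | p.1 ∈ ({none} : Set _) ∨ p.2 ∈ ({none} : Set _)}
        then none else some (p.1.getD x₀, p.2.getD y₀) := by
    ext1 ⟨a, b⟩
    cases a <;> cases b <;> simp
  rw [e]
  refine Measurable.ite ?_ measurable_const (measurableEmbedding_some.measurable.comp
    ((h1.comp measurable_fst).prodMk (h2.comp measurable_snd)))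
  exact (measurable_fst measurableSet_none).union (measurable_snd measurableSet_none)

theorem measurable_pair_comp {Ω₁ Ω₂ E₁ E₂ : Type*} [MeasurableSpace Ω₁] [MeasurableSpace Ω₂]
    [MeasurableSpace E₁] [MeasurableSpace E₂] {f : Ω₁ → Option E₁} {g : Ω₂ → Option E₂}
    (hf : Measurable f) (hg : Measurable g) :
    Measurable fun ω : Ω₁ × Ω₂ => ProcessFamily.pair (f ω.1) (g ω.2) :=
  measurable_pair.comp ((hf.comp measurable_fst).prodMk (hg.comp measurable_snd))

end Cemetery

namespace ProcessFamily

section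

variable {Ω E : Type*} [MeasurableSpace Ω] [MeasurableSpace E] {X : ProcessFamily Ω E}

/-- The transition kernel of the process on `E ∪ {Δ}`. -/
noncomputable def cemeteryKernel (hX : X.IsMarkov) (t : ℝ≥0) : Kernel (Option E) (Option E) where
  toFun x := (X.law x).map (X.path t)
  measurable' := by
    refine Measure.measurable_of_measurable_coe _ fun A hA => ?_
    simp_rw [Measure.map_apply (hX.measurable_path t) hA]
    exact hX.measurable_law t A hA

theorem cemeteryKernel_apply (hX : X.IsMarkov) (t : ℝ≥0) (x : Option E) :
    cemeteryKernel hX t x = (X.law x).map (X.path t) := rfl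

theorem isMarkovKernel_cemeteryKernel (hX : X.IsMarkov) (t : ℝ≥0) :
    IsMarkovKernel (cemeteryKernel hX t) :=
  ⟨fun x => by
    have := hX.isProbabilityMeasure x
    exact Measure.isProbabilityMeasure_map (hX.measurable_path t).aemeasurable⟩

theorem cemeteryKernel_none_ae (hX : X.IsMarkov) (t : ℝ≥0) :
    ∀ᵐ a ∂cemeteryKernel hX t none, a = none := by
  rw [cemeteryKernel_apply, ae_map_iff (p := fun a => a = none)
    (hX.measurable_path t).aemeasurable measurableSet_none]
  exact hX.cemetery t

/-- The Markov property as an identity of measures. -/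
theorem map_restrict_eq_comp (hX : X.IsMarkov) (x : Option E)
    (s t : ℝ≥0) {B : Set Ω}
    (h : ∀ A : Set (Option E), MeasurableSet A → X.law x (B ∩ X.path (t + s) ⁻¹' A) =
        ∫⁻ ω in B, X.law (X.path t ω) (X.path s ⁻¹' A) ∂X.law x) :
    ((X.law x).restrict B).map (X.path (t + s)) =
      cemeteryKernel hX s ∘ₘ (((X.law x).restrict B).map (X.path t)) := by
  ext A hA
  rw [Measure.map_apply (hX.measurable_path _) hA,
    Measure.restrict_apply (hX.measurable_path _ hA), Set.inter_comm, h A hA,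
    Measure.bind_apply hA (Kernel.aemeasurable _),
    lintegral_map ((cemeteryKernel hX s).measurable_coe hA) (hX.measurable_path t)]
  simp_rw [cemeteryKernel_apply, Measure.map_apply (hX.measurable_path s) hA]

theorem trans_eq_comap (hX : X.IsMarkov) (t : ℝ≥0) (x : E) :
    X.trans t x = (cemeteryKernel hX t (some x)).comap some := rfl

theorem trans_apply (hX : X.IsMarkov) (t : ℝ≥0) (x : E) (A : Set E) :
    X.trans t x A = cemeteryKernel hX t (some x) (some '' A) := by
  rw [trans_eq_comap hX, measurableEmbedding_some.comap_apply]

/-- The transition kernel of the process on `E`. -/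
noncomputable def transKernel (hX : X.IsMarkov) (t : ℝ≥0) : Kernel E E where
  toFun x := X.trans t x
  measurable' := by
    refine Measure.measurable_of_measurable_coe _ fun A hA => ?_
    simp_rw [trans_apply hX]
    exact ((cemeteryKernel hX t).measurable_coe
      (measurableEmbedding_some.measurableSet_image.2 hA)).comp
      measurableEmbedding_some.measurable

theorem transKernel_apply (hX : X.IsMarkov) (t : ℝ≥0) (x : E) :
    transKernel hX t x = X.trans t x := rfl

theorem trans_univ_le_one (hX : X.IsMarkov) (t : ℝ≥0) (x : E) : X.trans t x Set.univ ≤ 1 := by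
  have := isMarkovKernel_cemeteryKernel hX t
  rw [trans_apply hX]
  exact prob_le_one

instance (hX : X.IsMarkov) (t : ℝ≥0) : IsFiniteKernel (transKernel hX t) :=
  ⟨1, ENNReal.one_lt_top, trans_univ_le_one hX t⟩

theorem isSymmSubMarkov_transKernel (hX : X.IsMarkov) {m : Measure E} (hs : X.IsSymmetric m)
    (t : ℝ≥0) : IsSymmSubMarkov (transKernel hX t) m :=
  ⟨trans_univ_le_one hX t, hs t⟩

theorem transKernel_zero (hX : X.IsMarkov) : transKernel hX 0 = Kernel.id := by
  ext x A hA
  have := hX.isProbabilityMeasure (some x)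
  rw [transKernel_apply, trans_apply hX, cemeteryKernel_apply, Kernel.id_apply,
    Measure.dirac_apply' _ hA, Measure.map_congr (hX.start (some x)), Measure.map_const,
    measure_univ, one_smul,
    Measure.dirac_apply' _ (measurableEmbedding_some.measurableSet_image.2 hA)]
  by_cases hx : x ∈ A <;> simp [hx]

theorem transKernel_add (hX : X.IsMarkov) (s t : ℝ≥0) :
    transKernel hX (t + s) = transKernel hX s ∘ₖ transKernel hX t := by
  obtain ⟨𝓖, -, hG⟩ := hX.markov
  ext x A hA
  have hA' := measurableEmbedding_some.measurableSet_image.2 hA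
  have h1 := map_restrict_eq_comp hX (some x) s t
    fun A hA => hG (some x) s t A hA _ MeasurableSet.univ
  rw [Measure.restrict_univ] at h1
  rw [Kernel.comp_apply' _ _ _ hA, transKernel_apply, trans_apply hX, cemeteryKernel_apply, h1,
    Measure.bind_apply hA' (Kernel.aemeasurable _), transKernel_apply, trans_eq_comap hX,
    ← cemeteryKernel_apply hX]
  have e : ∀ b, transKernel hX s b A = (fun a => cemeteryKernel hX s a (some '' A)) (some b) :=
    fun b => trans_apply hX s b A
  simp_rw [e]
  rw [← measurableEmbedding_some.lintegral_map (g := some)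
    (f := fun a => cemeteryKernel hX s a (some '' A)), measurableEmbedding_some.map_comap,
    ← lintegral_indicator measurableEmbedding_some.measurableSet_range]
  refine lintegral_congr fun a => ?_
  cases a with
  | none =>
    have h0 : cemeteryKernel hX s none (some '' A) = 0 := by
      refine measure_mono_null ?_ (cemeteryKernel_none_ae hX s)
      rintro _ ⟨b, -, rfl⟩
      simp
    simp [h0]
  | some b => simp

end

section

variable {Ω₁ Ω₂ E₁ E₂ : Type*} [MeasurableSpace Ω₁] [MeasurableSpace Ω₂] [MeasurableSpace E₁]
  [MeasurableSpace E₂] {X : ProcessFamily Ω₁ E₁} {Y : ProcessFamily Ω₂ E₂}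

theorem measurable_coupling_path (hX : X.IsMarkov) (hY : Y.IsMarkov) (t : ℝ≥0) :
    Measurable ((X.coupling Y).path t) :=
  measurable_pair_comp (hX.measurable_path t) (hY.measurable_path t)

theorem isProbabilityMeasure_coupling_law (hX : X.IsMarkov) (hY : Y.IsMarkov)
    (z : Option (E₁ × E₂)) : IsProbabilityMeasure ((X.coupling Y).law z) := by
  have := hX.isProbabilityMeasure
  have := hY.isProbabilityMeasure
  rcases z with _ | ⟨x, y⟩ <;> (simp only [coupling]; infer_instance)

/-- The law of the coupling at time `t`, started from the pair of any two points of `E₁ ∪ {Δ}` and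
`E₂ ∪ {Δ}`: the two components move independently, and `Δ` is a trap for each of them. -/
theorem map_coupling_law_pair (hX : X.IsMarkov) (hY : Y.IsMarkov) (t : ℝ≥0) (a : Option E₁)
    (b : Option E₂) : ((X.coupling Y).law (pair a b)).map ((X.coupling Y).path t) =
      ((cemeteryKernel hX t ∥ₖ cemeteryKernel hY t) (a, b)).map fun p => pair p.1 p.2 := by
  have := hX.isProbabilityMeasure
  have := hY.isProbabilityMeasure
  have := isMarkovKernel_cemeteryKernel hX t
  have := isMarkovKernel_cemeteryKernel hY t
  have key : ∀ a b, ((X.law a).prod (Y.law b)).map ((X.coupling Y).path t) =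
      ((cemeteryKernel hX t ∥ₖ cemeteryKernel hY t) (a, b)).map fun p => pair p.1 p.2 := by
    intro a b
    rw [Kernel.parallelComp_apply, cemeteryKernel_apply, cemeteryKernel_apply,
      Measure.map_prod_map _ _ (hX.measurable_path t) (hY.measurable_path t),
      Measure.map_map measurable_pair ((hX.measurable_path t).prodMap (hY.measurable_path t))]
    rfl
  have dead : ∀ a b, a = none ∨ b = none →
      ((cemeteryKernel hX t ∥ₖ cemeteryKernel hY t) (a, b)).map (fun p => pair p.1 p.2) =
        Measure.dirac none := by
    intro a b hab
    have : (fun p : Option E₁ × Option E₂ => pair p.1 p.2)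
        =ᵐ[(cemeteryKernel hX t ∥ₖ cemeteryKernel hY t) (a, b)] fun _ => none := by
      rw [Kernel.parallelComp_apply]
      rcases hab with rfl | rfl
      · filter_upwards [Measure.quasiMeasurePreserving_fst.ae (cemeteryKernel_none_ae hX t)]
          with p hp
        simp [hp]
      · filter_upwards [Measure.quasiMeasurePreserving_snd.ae (cemeteryKernel_none_ae hY t)]
          with p hp
        simp [hp]
    rw [Measure.map_congr this, Measure.map_const, measure_univ, one_smul]
  have hnone : (X.coupling Y).law none = (X.law none).prod (Y.law none) := rfl
  rcases a with _ | x
  · rw [pair_none_left, hnone, key, dead _ _ (Or.inl rfl), dead _ _ (Or.inl rfl)]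
  rcases b with _ | y
  · rw [pair_none_right, hnone, key, dead _ _ (Or.inl rfl), dead _ _ (Or.inr rfl)]
  · exact key _ _

theorem trans_coupling (hX : X.IsMarkov) (hY : Y.IsMarkov) (t : ℝ≥0) (x : E₁) (y : E₂) :
    (X.coupling Y).trans t (x, y) = (X.trans t x).prod (Y.trans t y) := by
  have h1 := isMarkovKernel_cemeteryKernel hX t
  have h2 := isMarkovKernel_cemeteryKernel hY t
  have : IsFiniteMeasure (X.trans t x) := ⟨(trans_univ_le_one hX t x).trans_lt (by simp)⟩
  have : IsFiniteMeasure (Y.trans t y) := ⟨(trans_univ_le_one hY t y).trans_lt (by simp)⟩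
  refine (Measure.prod_eq fun A B hA hB => ?_).symm
  have hAB := measurableEmbedding_some.measurableSet_image.2 (hA.prod hB)
  rw [trans, ← pair_some x y, map_coupling_law_pair hX hY, measurableEmbedding_some.comap_apply,
    Measure.map_apply measurable_pair hAB, trans_apply hX, trans_apply hY,
    ← Measure.prod_prod,
    Kernel.parallelComp_apply]
  congr 1
  ext ⟨a, b⟩
  cases a <;> cases b <;> simp

/-- The Markov property of the coupling. For a product event `B₁ × B₂` it follows from the Markov
properties of `X` and `Y` as identities of measures on `E₁ ∪ {Δ}` and `E₂ ∪ {Δ}`, and product events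
are a π-system generating the product of the two filtrations. -/
theorem measure_inter_coupling (hX : X.IsMarkov) (hY : Y.IsMarkov)
    {𝓖 : Filtration ℝ≥0 (inferInstance : MeasurableSpace Ω₁)}
    (h𝓖 : ∀ x, ∀ s t : ℝ≥0, ∀ A : Set (Option E₁), MeasurableSet A →
      ∀ B : Set Ω₁, MeasurableSet[𝓖 t] B → X.law x (B ∩ X.path (t + s) ⁻¹' A) =
        ∫⁻ ω in B, X.law (X.path t ω) (X.path s ⁻¹' A) ∂X.law x)
    {𝓗 : Filtration ℝ≥0 (inferInstance : MeasurableSpace Ω₂)}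
    (h𝓗 : ∀ x, ∀ s t : ℝ≥0, ∀ A : Set (Option E₂), MeasurableSet A →
      ∀ B : Set Ω₂, MeasurableSet[𝓗 t] B → Y.law x (B ∩ Y.path (t + s) ⁻¹' A) =
        ∫⁻ ω in B, Y.law (Y.path t ω) (Y.path s ⁻¹' A) ∂Y.law x)
    (a : Option E₁) (b : Option E₂) (s t : ℝ≥0) {A : Set (Option (E₁ × E₂))}
    (hA : MeasurableSet A) {B : Set (Ω₁ × Ω₂)}
    (hB : MeasurableSet[(𝓖 t).prod (𝓗 t)] B) :
    ((X.law a).prod (Y.law b)) (B ∩ (X.coupling Y).path (t + s) ⁻¹' A) =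
      ∫⁻ ω in B, (X.coupling Y).law ((X.coupling Y).path t ω) ((X.coupling Y).path s ⁻¹' A)
        ∂((X.law a).prod (Y.law b)) := by
  have := hX.isProbabilityMeasure
  have := hY.isProbabilityMeasure
  have := isMarkovKernel_cemeteryKernel hX s
  have := isMarkovKernel_cemeteryKernel hY s
  have hA' := measurable_pair (E₁ := E₁) (E₂ := E₂) hA
  have hle : (𝓖 t).prod (𝓗 t) ≤ (inferInstance : MeasurableSpace (Ω₁ × Ω₂)) :=
    sup_le_sup (MeasurableSpace.comap_mono (𝓖.le t)) (MeasurableSpace.comap_mono (𝓗.le t))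
  have hC := measurable_coupling_path hX hY (t + s) hA
  set q : Ω₁ × Ω₂ → ℝ≥0∞ := fun ω => (cemeteryKernel hX s ∥ₖ cemeteryKernel hY s)
    (X.path t ω.1, Y.path t ω.2) ((fun p => pair p.1 p.2) ⁻¹' A) with hq
  have hpath : Measurable fun ω : Ω₁ × Ω₂ => (X.path t ω.1, Y.path t ω.2) :=
    ((hX.measurable_path t).comp measurable_fst).prodMk
      ((hY.measurable_path t).comp measurable_snd)
  have hqm : Measurable q := (Kernel.measurable_coe _ hA').comp hpath
  have hlaw : ∀ ω, (X.coupling Y).law ((X.coupling Y).path t ω)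
      ((X.coupling Y).path s ⁻¹' A) = q ω := by
    intro ω
    rw [← Measure.map_apply (measurable_coupling_path hX hY s) hA]
    change ((X.coupling Y).law (pair (X.path t ω.1) (Y.path t ω.2))).map _ A = _
    rw [map_coupling_law_pair hX hY, Measure.map_apply measurable_pair hA]
  simp_rw [hlaw]
  have rect : ∀ B₁ B₂, MeasurableSet[𝓖 t] B₁ → MeasurableSet[𝓗 t] B₂ →
      ((X.law a).prod (Y.law b)).restrict ((X.coupling Y).path (t + s) ⁻¹' A) (B₁ ×ˢ B₂) =
        ((X.law a).prod (Y.law b)).withDensity q (B₁ ×ˢ B₂) := by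
    intro B₁ B₂ hB₁ hB₂
    have m₁ := 𝓖.le t _ hB₁
    have m₂ := 𝓗.le t _ hB₂
    have e₁ := map_restrict_eq_comp hX a s t fun A hA => h𝓖 a s t A hA B₁ hB₁
    have e₂ := map_restrict_eq_comp hY b s t fun A hA => h𝓗 b s t A hA B₂ hB₂
    have e := parallelComp_comp_measure_prod (((X.law a).restrict B₁).map (X.path t))
      (((Y.law b).restrict B₂).map (Y.path t)) (cemeteryKernel hX s) (cemeteryKernel hY s)
    rw [← e₁, ← e₂,
      Measure.map_prod_map _ _ (hX.measurable_path _) (hY.measurable_path _),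
      Measure.map_prod_map _ _ (hX.measurable_path _) (hY.measurable_path _),
      Measure.prod_restrict] at e
    have e' := congrArg (fun μ => μ ((fun p => pair p.1 p.2) ⁻¹' A)) e
    rw [Measure.bind_apply hA' (Kernel.aemeasurable _),
      lintegral_map (Kernel.measurable_coe _ hA')
        ((hX.measurable_path t).prodMap (hY.measurable_path t)),
      Measure.map_apply ((hX.measurable_path _).prodMap (hY.measurable_path _)) hA'] at e'
    rw [withDensity_apply _ (m₁.prod m₂), Measure.restrict_apply (m₁.prod m₂), Set.inter_comm,
      ← Measure.restrict_apply hC]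
    exact e'.symm
  have hmain : ((X.law a).prod (Y.law b)).restrict ((X.coupling Y).path (t + s) ⁻¹' A) B =
      ((X.law a).prod (Y.law b)).withDensity q B := by
    refine ext_on_measurableSpace_of_generate_finite _ _ ?_ hle
      (@generateFrom_prod Ω₁ Ω₂ (𝓖 t) (𝓗 t)).symm (@isPiSystem_prod Ω₁ Ω₂ (𝓖 t) (𝓗 t)) ?_ hB
    · rintro _ ⟨B₁, hB₁, B₂, hB₂, rfl⟩
      exact rect B₁ B₂ hB₁ hB₂
    · rw [← Set.univ_prod_univ]
      exact rect _ _ MeasurableSet.univ MeasurableSet.univ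
  rw [withDensity_apply _ (hle _ hB), Measure.restrict_apply (hle _ hB)] at hmain
  exact hmain

theorem isMarkov_coupling (hX : X.IsMarkov) (hY : Y.IsMarkov) : (X.coupling Y).IsMarkov where
  isProbabilityMeasure := isProbabilityMeasure_coupling_law hX hY
  measurable_path := measurable_coupling_path hX hY
  measurable_law t A hA := by
    have := isMarkovKernel_cemeteryKernel hX t
    have := isMarkovKernel_cemeteryKernel hY t
    rw [measurable_cemetery_iff]
    have e : (fun z => (X.coupling Y).law z ((X.coupling Y).path t ⁻¹' A)) ∘ some =
        fun z : E₁ × E₂ => (cemeteryKernel hX t ∥ₖ cemeteryKernel hY t)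
          (some z.1, some z.2) ((fun p => pair p.1 p.2) ⁻¹' A) := by
      ext1 z
      rw [Function.comp_apply, ← Measure.map_apply (measurable_coupling_path hX hY t) hA,
        ← Prod.mk.eta (p := z), ← pair_some, map_coupling_law_pair hX hY,
        Measure.map_apply measurable_pair hA]
    rw [e]
    exact (Kernel.measurable_coe _ (measurable_pair hA)).comp
      ((measurableEmbedding_some.measurable.comp measurable_fst).prodMk
        (measurableEmbedding_some.measurable.comp measurable_snd))
  start z := by
    have := hX.isProbabilityMeasure
    have := hY.isProbabilityMeasure
    rcases z with _ | ⟨x, y⟩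
    · simp only [coupling]
      filter_upwards [Measure.quasiMeasurePreserving_fst.ae (hX.start none)] with ω h
      simp [h]
    · simp only [coupling]
      filter_upwards [Measure.quasiMeasurePreserving_fst.ae (hX.start (some x)),
        Measure.quasiMeasurePreserving_snd.ae (hY.start (some y))] with ω h h'
      simp [h, h']
  cemetery t := by
    have := hX.isProbabilityMeasure
    have := hY.isProbabilityMeasure
    simp only [coupling]
    filter_upwards [Measure.quasiMeasurePreserving_fst.ae (hX.cemetery t)] with ω h
    simp [h]
  markov := by
    obtain ⟨𝓖, h𝓖, h𝓖'⟩ := hX.markov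
    obtain ⟨𝓗, h𝓗, h𝓗'⟩ := hY.markov
    refine ⟨⟨fun t => (𝓖 t).prod (𝓗 t), fun s t hst => ?_, fun t => ?_⟩, fun t => ?_, ?_⟩
    · exact sup_le_sup (MeasurableSpace.comap_mono (𝓖.mono hst))
        (MeasurableSpace.comap_mono (𝓗.mono hst))
    · exact sup_le_sup (MeasurableSpace.comap_mono (𝓖.le t))
        (MeasurableSpace.comap_mono (𝓗.le t))
    · exact @measurable_pair_comp Ω₁ Ω₂ E₁ E₂ (𝓖 t) (𝓗 t) _ _ _ _ (h𝓖 t) (h𝓗 t)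
    · rintro (_ | ⟨x, y⟩) s t A hA B hB
      · exact measure_inter_coupling hX hY h𝓖' h𝓗' none none s t hA hB
      · exact measure_inter_coupling hX hY h𝓖' h𝓗' (some x) (some y) s t hA hB

theorem transKernel_coupling (hX : X.IsMarkov) (hY : Y.IsMarkov) (t : ℝ≥0) :
    transKernel (isMarkov_coupling hX hY) t = transKernel hX t ∥ₖ transKernel hY t := by
  ext1 z
  rw [Kernel.parallelComp_apply]
  exact trans_coupling hX hY t z.1 z.2

theorem isSymmetric_coupling (hX : X.IsMarkov) (hY : Y.IsMarkov) {m₁ : Measure E₁}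
    {m₂ : Measure E₂} [SFinite m₁] [SFinite m₂] (h₁ : X.IsSymmetric m₁) (h₂ : Y.IsSymmetric m₂) :
    (X.coupling Y).IsSymmetric (m₁.prod m₂) := by
  intro t f g hf hg
  have := ((isSymmSubMarkov_transKernel hX h₁ t).parallelComp
    (isSymmSubMarkov_transKernel hY h₂ t)).lintegral_symm f g hf hg
  rwa [← transKernel_coupling hX hY] at this

end

end ProcessFamily

/-! ### The semigroup of a process with a Dirichlet form -/

/-- `∫ (f - κ f) g dμ` for functions `f` and `g`, which is `⟪f - κ f, g⟫` for their classes in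
`L²`. -/
noncomputable def kernelForm {S : Type*} [MeasurableSpace S] (κ : Kernel S S) (μ : Measure S)
    (f g : S → ℝ) : ℝ := ∫ x, (f x - ∫ y, f y ∂κ x) * g x ∂μ

section KernelSemigroup

variable {S : Type*} [MeasurableSpace S] {μ : Measure S}

namespace IsSymmSubMarkov

variable {κ : Kernel S S}

theorem inner_sub_lpOp_ae_eq (h : IsSymmSubMarkov κ μ) {f g : S → ℝ} (hf : MemLp f 2 μ)
    (hg : MemLp g 2 μ) :
    (fun x => ⟪(hf.toLp f - h.lpOp (hf.toLp f)) x, hg.toLp g x⟫)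
      =ᵐ[μ] fun x => (f x - ∫ y, f y ∂κ x) * g x := by
  rw [h.lpOp_toLp hf]
  filter_upwards [hf.coeFn_toLp, hg.coeFn_toLp, (h.memLp_integral hf).coeFn_toLp,
    Lp.coeFn_sub (hf.toLp f) ((h.memLp_integral hf).toLp _)] with x h1 h2 h3 h4
  rw [h4, Pi.sub_apply, h1, h2, h3]
  simp [mul_comm]

theorem inner_sub_lpOp_toLp (h : IsSymmSubMarkov κ μ) {f g : S → ℝ} (hf : MemLp f 2 μ)
    (hg : MemLp g 2 μ) :
    ⟪hf.toLp f - h.lpOp (hf.toLp f), hg.toLp g⟫ = kernelForm κ μ f g := by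
  rw [L2.inner_def]
  exact MeasureTheory.integral_congr_ae (h.inner_sub_lpOp_ae_eq hf hg)

theorem inner_sub_lpOp (h : IsSymmSubMarkov κ μ) (u v : Lp ℝ 2 μ) :
    ⟪u - h.lpOp u, v⟫ = kernelForm κ μ u v := by
  have := h.inner_sub_lpOp_toLp (Lp.memLp u) (Lp.memLp v)
  rwa [Lp.toLp_coeFn, Lp.toLp_coeFn] at this

theorem integrable_sub_integral_mul (h : IsSymmSubMarkov κ μ) (u v : Lp ℝ 2 μ) :
    Integrable (fun x => (u x - ∫ y, u y ∂κ x) * v x) μ := by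
  have := h.inner_sub_lpOp_ae_eq (Lp.memLp u) (Lp.memLp v)
  rw [Lp.toLp_coeFn, Lp.toLp_coeFn] at this
  exact (L2.integrable_inner _ _).congr this

theorem norm_sub_lpOp_sq_le (h : IsSymmSubMarkov κ μ) (u : Lp ℝ 2 μ) :
    ‖u - h.lpOp u‖ ^ 2 ≤ 2 * ⟪u - h.lpOp u, u⟫ := by
  have h2 : ‖h.lpOp u‖ ^ 2 ≤ ‖u‖ ^ 2 := by gcongr; exact h.norm_lpOp_le u
  rw [norm_sub_sq_real, inner_sub_left, real_inner_self_eq_norm_sq, real_inner_comm u]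
  linarith

end IsSymmSubMarkov

variable {κ : ℝ≥0 → Kernel S S}

theorem tendsto_lpOp_of_inner (hκ : ∀ t, IsSymmSubMarkov (κ t) μ) {u : Lp ℝ 2 μ}
    (h : Tendsto (fun t => ⟪u - (hκ t).lpOp u, u⟫) (𝓝[>] 0) (𝓝 0)) :
    Tendsto (fun t => (hκ t).lpOp u) (𝓝[>] 0) (𝓝 u) := by
  rw [tendsto_iff_norm_sub_tendsto_zero]
  have h1 : Tendsto (fun t => Real.sqrt (2 * ⟪u - (hκ t).lpOp u, u⟫)) (𝓝[>] 0) (𝓝 0) := by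
    simpa using (h.const_mul 2).sqrt
  refine squeeze_zero (fun _ => norm_nonneg _) (fun t => ?_) h1
  rw [norm_sub_rev]
  exact Real.le_sqrt_of_sq_le ((hκ t).norm_sub_lpOp_sq_le u)

/-- The semigroup on `L²(μ)` of a semigroup of symmetric sub-Markov kernels. -/
noncomputable def kernelSemigroup (hκ : ∀ t, IsSymmSubMarkov (κ t) μ) (h0 : κ 0 = Kernel.id)
    (hadd : ∀ s t, κ (t + s) = κ s ∘ₖ κ t)
    (hc : ∀ u, Tendsto (fun t => (hκ t).lpOp u) (𝓝[>] 0) (𝓝 u)) :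
    SymmSemigroup (Lp ℝ 2 μ) where
  op t := (hκ t).lpOp
  op_zero u := by
    refine Lp.ext ?_
    filter_upwards [(hκ 0).coeFn_lpOp u] with x hx
    rw [hx, h0, Kernel.id_apply, integral_dirac' _ _ (Lp.stronglyMeasurable u)]
  op_add s t u := (hκ s).lpOp_comp (hκ t) (hκ (s + t)) (hadd t s) u
  symm t u v := (hκ t).inner_lpOp u v
  norm_op_le t u := (hκ t).norm_lpOp_le u
  tendsto_op := hc

end KernelSemigroup

namespace ProcessFamily

variable {Ω E : Type*} [MeasurableSpace Ω] [MeasurableSpace E] {X : ProcessFamily Ω E}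
  {m : Measure E} {D : DirichletForm m}

theorem approxForm_eq_kernelForm (hX : X.IsMarkov) (t : ℝ≥0) (f g : E → ℝ) :
    X.approxForm m t f g = (t : ℝ)⁻¹ * kernelForm (transKernel hX t) m f g := rfl

/-- The transition semigroup is strongly continuous, because the form has dense domain: on the
domain, `⟪u - p_t u, u⟫ = t · (1/t) ⟪u - p_t u, u⟫` tends to `0`. -/
theorem tendsto_lpOp_transKernel (hX : X.IsMarkov) (hs : X.IsSymmetric m)
    (hD : X.HasDirichletForm D) (u : Lp ℝ 2 m) :
    Tendsto (fun t => (isSymmSubMarkov_transKernel hX hs t).lpOp u) (𝓝[>] 0) (𝓝 u) := by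
  have dom : ∀ w ∈ D.domain,
      Tendsto (fun t => (isSymmSubMarkov_transKernel hX hs t).lpOp w) (𝓝[>] 0) (𝓝 w) := by
    intro w hw
    obtain ⟨c, hc⟩ := (hD.mem_domain_iff w).1 hw
    refine tendsto_lpOp_of_inner _ ?_
    have h0 : Tendsto (fun t : ℝ≥0 => (t : ℝ)) (𝓝[>] 0) (𝓝 0) :=
      (NNReal.continuous_coe.tendsto' 0 0 rfl).mono_left nhdsWithin_le_nhds
    have := h0.mul hc
    rw [zero_mul] at this
    refine this.congr' ?_
    filter_upwards [self_mem_nhdsWithin] with t ht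
    have ht' : (t : ℝ) ≠ 0 := by
      have : 0 < t := ht
      positivity
    rw [approxForm_eq_kernelForm hX, mul_inv_cancel_left₀ ht',
      (isSymmSubMarkov_transKernel hX hs t).inner_sub_lpOp]
  rw [Metric.tendsto_nhds]
  intro ε hε
  obtain ⟨w, hw, hwu⟩ := D.dense.exists_dist_lt u (ε := ε / 3) (by positivity)
  filter_upwards [Metric.tendsto_nhds.1 (dom w hw) (ε / 3) (by positivity)] with t ht
  have h1 := dist_triangle4 ((isSymmSubMarkov_transKernel hX hs t).lpOp u)
    ((isSymmSubMarkov_transKernel hX hs t).lpOp w) w u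
  have h2 : dist ((isSymmSubMarkov_transKernel hX hs t).lpOp u)
      ((isSymmSubMarkov_transKernel hX hs t).lpOp w) ≤ dist u w := by
    rw [dist_eq_norm, dist_eq_norm, ← map_sub]
    exact (isSymmSubMarkov_transKernel hX hs t).norm_lpOp_le _
  rw [dist_comm w u] at h1
  linarith

/-- The transition semigroup on `L²(m)` of a symmetric process with a Dirichlet form. -/
noncomputable def semigroup (hX : X.IsMarkov) (hs : X.IsSymmetric m)
    (hD : X.HasDirichletForm D) : SymmSemigroup (Lp ℝ 2 m) :=
  kernelSemigroup (isSymmSubMarkov_transKernel hX hs) (transKernel_zero hX) (transKernel_add hX)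
    (tendsto_lpOp_transKernel hX hs hD)

variable (hX : X.IsMarkov) (hs : X.IsSymmetric m) (hD : X.HasDirichletForm D)

theorem semigroup_op (t : ℝ≥0) :
    (semigroup hX hs hD).op t = (isSymmSubMarkov_transKernel hX hs t).lpOp := rfl

theorem approx_toLp {f g : E → ℝ} (hf : MemLp f 2 m) (hg : MemLp g 2 m) (t : ℝ≥0) :
    (semigroup hX hs hD).approx t (hf.toLp f) (hg.toLp g) = X.approxForm m t f g := by
  rw [SymmSemigroup.approx, semigroup_op, IsSymmSubMarkov.inner_sub_lpOp_toLp,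
    approxForm_eq_kernelForm hX]

theorem approx_coe (u v : Lp ℝ 2 m) (t : ℝ≥0) :
    (semigroup hX hs hD).approx t u v = X.approxForm m t u v := by
  rw [← approx_toLp hX hs hD (Lp.memLp u) (Lp.memLp v), Lp.toLp_coeFn, Lp.toLp_coeFn]

theorem domain_semigroup : (semigroup hX hs hD).domain = D.domain := by
  ext u
  rw [SymmSemigroup.mem_domain_iff_tendsto, hD.mem_domain_iff]
  simp_rw [approx_coe]

theorem energy_semigroup (u v : D.domain) :
    (semigroup hX hs hD).energy (u : Lp ℝ 2 m) (v : Lp ℝ 2 m) = D.form u v := by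
  refine SymmSemigroup.energy_eq _ ?_
  simp_rw [approx_coe]
  exact hD.tendsto_form u v

include hX hs hD

theorem memFun_iff {f : E → ℝ} (hf : MemLp f 2 m) :
    D.MemFun f ↔ ∃ C, ∀ t, X.approxForm m t f f ≤ C := by
  have h : D.MemFun f ↔ hf.toLp f ∈ D.domain := ⟨fun h => h.choose_spec, fun h => ⟨hf, h⟩⟩
  rw [h, ← domain_semigroup hX hs hD, SymmSemigroup.mem_domain]
  simp_rw [approx_toLp]

theorem tendsto_formFun {f g : E → ℝ} (hf : D.MemFun f) (hg : D.MemFun g) :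
    Tendsto (fun t => X.approxForm m t f g) (𝓝[>] 0) (𝓝 (D.formFun f g)) := by
  rw [DirichletForm.formFun, dif_pos ⟨hf, hg⟩, ← energy_semigroup hX hs hD]
  simp_rw [← approx_toLp hX hs hD hf.choose hg.choose]
  refine SymmSemigroup.tendsto_energy _ ?_ ?_
  · rw [domain_semigroup hX hs hD]; exact hf.choose_spec
  · rw [domain_semigroup hX hs hD]; exact hg.choose_spec

theorem approxForm_nonneg {f : E → ℝ} (hf : MemLp f 2 m) (t : ℝ≥0) :
    0 ≤ X.approxForm m t f f := by
  rw [← approx_toLp hX hs hD hf hf]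
  exact SymmSemigroup.approx_nonneg _ _ _

theorem approxForm_le_formFun {f : E → ℝ} (hf : D.MemFun f) (t : ℝ≥0) :
    X.approxForm m t f f ≤ D.formFun f f := by
  obtain ⟨hf', -⟩ := id hf
  rw [← approx_toLp hX hs hD hf' hf']
  refine SymmSemigroup.approx_le_of_tendsto _ ?_ t
  simp_rw [approx_toLp]
  exact tendsto_formFun hX hs hD hf hf

theorem formFun_self_nonneg {f : E → ℝ} (hf : D.MemFun f) : 0 ≤ D.formFun f f := by
  obtain ⟨hf', -⟩ := id hf
  exact (approxForm_nonneg hX hs hD hf' 0).trans (approxForm_le_formFun hX hs hD hf 0)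

theorem abs_approxForm_le {f g : E → ℝ} (hf : MemLp f 2 m) (hg : MemLp g 2 m) (t : ℝ≥0) :
    |X.approxForm m t f g| ≤ (X.approxForm m t f f + X.approxForm m t g g) / 2 := by
  rw [← approx_toLp hX hs hD hf hf, ← approx_toLp hX hs hD hf hg, ← approx_toLp hX hs hD hg hg]
  exact SymmSemigroup.abs_approx_le _ _ _ _

/-- A bound along a sequence `t_n ↓ 0` is a bound for all `t`, by monotonicity. -/
theorem approxForm_le_of_frequently {f : E → ℝ} (hf : MemLp f 2 m) {a : ℕ → ℝ≥0}
    (ha : Tendsto a atTop (𝓝[>] 0)) {C : ℝ} (h : ∃ᶠ n in atTop, X.approxForm m (a n) f f ≤ C)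
    (t : ℝ≥0) : X.approxForm m t f f ≤ C := by
  simp_rw [← approx_toLp hX hs hD hf hf] at h ⊢
  rcases eq_or_lt_of_le (zero_le (a := t)) with rfl | ht
  · obtain ⟨n, hn⟩ := h.exists
    refine le_trans (le_of_eq ?_) ((SymmSemigroup.approx_nonneg _ _ _).trans hn)
    simp [SymmSemigroup.approx]
  · obtain ⟨n, hn, hn'⟩ := (h.and_eventually (ha.eventually (Ioc_mem_nhdsGT ht))).exists
    exact (SymmSemigroup.approx_anti _ hn'.1 hn'.2 _).trans hn

/-! ### Families of functions indexed by a parameter -/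

variable {J : Type*} [MeasurableSpace J] {ν : Measure J} {u v : J → E → ℝ}

/-- If the integrals of the approximating forms of the `u j` are bounded, almost every `u j` belongs
to the domain, and the `𝓔₁`-norm of `u j` is square integrable: this is Fatou's lemma. -/
theorem memLp_norm₁Fun_of_bdd (hu : ∀ᵐ j ∂ν, MemLp (u j) 2 m)
    (hint : ∀ t, Integrable (fun j => X.approxForm m t (u j) (u j)) ν)
    (hL2 : Integrable (fun j => ∫ x, u j x ^ 2 ∂m) ν) {C : ℝ}
    (hC : ∀ t, ∫ j, X.approxForm m t (u j) (u j) ∂ν ≤ C) :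
    (∀ᵐ j ∂ν, D.MemFun (u j)) ∧ MemLp (fun j => D.norm₁Fun (u j)) 2 ν := by
  obtain ⟨a, -, ha0, ha⟩ := exists_seq_strictAnti_tendsto (0 : ℝ≥0)
  have ha' : Tendsto a atTop (𝓝[>] 0) :=
    tendsto_nhdsWithin_iff.2 ⟨ha, Eventually.of_forall fun n => ha0 n⟩
  have hfatou : ∫⁻ j, liminf (fun n => ENNReal.ofReal (X.approxForm m (a n) (u j) (u j))) atTop ∂ν
      ≤ ENNReal.ofReal C := by
    refine (lintegral_liminf_le' fun n => (hint (a n)).1.aemeasurable.ennreal_ofReal).trans ?_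
    refine liminf_le_of_le (by isBoundedDefault) fun b hb => ?_
    obtain ⟨n, hn⟩ := hb.exists
    refine hn.trans ?_
    rw [← ofReal_integral_eq_lintegral_ofReal (hint (a n))
      (hu.mono fun j hj => approxForm_nonneg hX hs hD hj _)]
    exact ENNReal.ofReal_le_ofReal (hC _)
  have hmeas : AEMeasurable
      (fun j => liminf (fun n => ENNReal.ofReal (X.approxForm m (a n) (u j) (u j))) atTop) ν := by
    refine ⟨fun j => liminf (fun n => ENNReal.ofReal ((hint (a n)).1.mk _ j)) atTop,
      Measurable.liminf fun n => (hint (a n)).1.stronglyMeasurable_mk.measurable.ennreal_ofReal, ?_⟩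
    filter_upwards [ae_all_iff.2 fun n => (hint (a n)).1.ae_eq_mk] with j hj
    congr 1
    ext n
    rw [hj n]
  have hmem : ∀ᵐ j ∂ν, D.MemFun (u j) := by
    filter_upwards [ae_lt_top' hmeas (hfatou.trans_lt ENNReal.ofReal_lt_top).ne, hu] with j hj huj
    obtain ⟨b, hb1, hb2⟩ := exists_between hj
    rw [memFun_iff hX hs hD huj]
    refine ⟨b.toReal, approxForm_le_of_frequently hX hs hD huj ha' ?_⟩
    refine (frequently_lt_of_liminf_lt (by isBoundedDefault) hb1).mono fun n hn => ?_
    exact (ENNReal.ofReal_le_iff_le_toReal hb2.ne).1 hn.le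
  refine ⟨hmem, ?_⟩
  have hlim : ∀ᵐ j ∂ν, Tendsto (fun n => X.approxForm m (a n) (u j) (u j)) atTop
      (𝓝 (D.formFun (u j) (u j))) := by
    filter_upwards [hmem] with j hj
    exact (tendsto_formFun hX hs hD hj hj).comp ha'
  have hform : Integrable (fun j => D.formFun (u j) (u j)) ν := by
    refine ⟨aestronglyMeasurable_of_tendsto_ae atTop (fun n => (hint (a n)).1) hlim, ?_⟩
    rw [hasFiniteIntegral_iff_ofReal (hmem.mono fun j hj => formFun_self_nonneg hX hs hD hj)]
    refine (le_of_eq (lintegral_congr_ae ?_)).trans_lt (hfatou.trans_lt ENNReal.ofReal_lt_top)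
    filter_upwards [hlim] with j hj
    exact ((ENNReal.continuous_ofReal.tendsto _).comp hj).liminf_eq.symm
  have hsum := hform.add hL2
  have hm : AEStronglyMeasurable (fun j => D.norm₁Fun (u j)) ν :=
    Real.continuous_sqrt.comp_aestronglyMeasurable hsum.1
  rw [memLp_two_iff_integrable_sq hm]
  refine hsum.congr ?_
  filter_upwards [hmem] with j hj
  rw [DirichletForm.norm₁Fun, Real.sq_sqrt]
  · rfl
  · exact add_nonneg (formFun_self_nonneg hX hs hD hj) (integral_nonneg fun x => sq_nonneg _)

theorem integrable_formFun_self (hL2 : Integrable (fun j => ∫ x, u j x ^ 2 ∂m) ν)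
    (hmem : ∀ᵐ j ∂ν, D.MemFun (u j)) (hn : MemLp (fun j => D.norm₁Fun (u j)) 2 ν) :
    Integrable (fun j => D.formFun (u j) (u j)) ν := by
  refine (hn.integrable_sq.sub hL2).congr ?_
  filter_upwards [hmem] with j hj
  rw [Pi.sub_apply, DirichletForm.norm₁Fun, Real.sq_sqrt, add_sub_cancel_right]
  exact add_nonneg (formFun_self_nonneg hX hs hD hj) (integral_nonneg fun x => sq_nonneg _)

theorem integral_approxForm_le (hint : ∀ t, Integrable (fun j => X.approxForm m t (u j) (u j)) ν)
    (hL2 : Integrable (fun j => ∫ x, u j x ^ 2 ∂m) ν) (hmem : ∀ᵐ j ∂ν, D.MemFun (u j))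
    (hn : MemLp (fun j => D.norm₁Fun (u j)) 2 ν) (t : ℝ≥0) :
    ∫ j, X.approxForm m t (u j) (u j) ∂ν ≤ ∫ j, D.formFun (u j) (u j) ∂ν := by
  refine integral_mono_ae (hint t) (integrable_formFun_self hX hs hD hL2 hmem hn) ?_
  filter_upwards [hmem] with j hj
  exact approxForm_le_formFun hX hs hD hj t

theorem integrable_formFun (hint : ∀ t, Integrable (fun j => X.approxForm m t (u j) (v j)) ν)
    (hu : ∀ᵐ j ∂ν, D.MemFun (u j)) (hv : ∀ᵐ j ∂ν, D.MemFun (v j))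
    (hu' : Integrable (fun j => D.formFun (u j) (u j)) ν)
    (hv' : Integrable (fun j => D.formFun (v j) (v j)) ν) :
    Integrable (fun j => D.formFun (u j) (v j)) ν ∧
      Tendsto (fun t => ∫ j, X.approxForm m t (u j) (v j) ∂ν) (𝓝[>] 0)
        (𝓝 (∫ j, D.formFun (u j) (v j) ∂ν)) := by
  have hlim : ∀ᵐ j ∂ν, Tendsto (fun t => X.approxForm m t (u j) (v j)) (𝓝[>] 0)
      (𝓝 (D.formFun (u j) (v j))) := by
    filter_upwards [hu, hv] with j hj hj'
    exact tendsto_formFun hX hs hD hj hj'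
  have hbound : ∀ᵐ j ∂ν, ∀ t, ‖X.approxForm m t (u j) (v j)‖ ≤
      (D.formFun (u j) (u j) + D.formFun (v j) (v j)) / 2 := by
    filter_upwards [hu, hv] with j hj hj' t
    have h1 := approxForm_le_formFun hX hs hD hj t
    have h2 := approxForm_le_formFun hX hs hD hj' t
    obtain ⟨hf, -⟩ := hj
    obtain ⟨hg, -⟩ := hj'
    have h3 := abs_approxForm_le hX hs hD hf hg t
    rw [Real.norm_eq_abs]
    linarith
  have hb := (hu'.add hv').div_const 2
  refine ⟨?_, ?_⟩
  · refine hb.mono (aestronglyMeasurable_of_tendsto_ae _ (fun t => (hint t).1) hlim) ?_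
    filter_upwards [hlim, hbound] with j hj hj'
    exact (le_of_tendsto' hj.norm hj').trans (Real.le_norm_self _)
  · exact tendsto_integral_filter_of_dominated_convergence _
      (Eventually.of_forall fun t => (hint t).1)
      (Eventually.of_forall fun t => hbound.mono fun j hj => hj t) hb hlim

/-- Strong continuity of the semigroup acting on the fibers, by dominated convergence. -/
theorem tendsto_integral_kernelForm (hu : ∀ᵐ j ∂ν, MemLp (u j) 2 m)
    (hint : ∀ t, Integrable (fun j => kernelForm (transKernel hX t) m (u j) (u j)) ν)
    (hL2 : Integrable (fun j => ∫ x, u j x ^ 2 ∂m) ν) :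
    Tendsto (fun t => ∫ j, kernelForm (transKernel hX t) m (u j) (u j) ∂ν) (𝓝[>] 0) (𝓝 0) := by
  have h0 : ∫ _, (0 : ℝ) ∂ν = 0 := by simp
  rw [← h0]
  refine tendsto_integral_filter_of_dominated_convergence _
    (Eventually.of_forall fun t => (hint t).1) (Eventually.of_forall fun t => ?_) hL2 ?_
  · filter_upwards [hu] with j hj
    have e := (isSymmSubMarkov_transKernel hX hs t).inner_sub_lpOp_toLp hj hj
    have h1 := (semigroup hX hs hD).inner_sub_op_nonneg t (hj.toLp _)
    rw [semigroup_op, e] at h1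
    rw [Real.norm_eq_abs, abs_of_nonneg h1, ← e, inner_sub_left]
    have h2 := (semigroup hX hs hD).inner_op_nonneg t (hj.toLp _)
    rw [semigroup_op] at h2
    have h3 : ⟪hj.toLp (u j), hj.toLp (u j)⟫ = ∫ x, u j x ^ 2 ∂m := by
      rw [L2.inner_def]
      refine integral_congr_ae ?_
      filter_upwards [hj.coeFn_toLp] with x hx
      rw [hx]; simp [sq]
    linarith
  · filter_upwards [hu] with j hj
    have e := fun t => (isSymmSubMarkov_transKernel hX hs t).inner_sub_lpOp_toLp hj hj
    simp_rw [← e]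
    have h1 := ((semigroup hX hs hD).tendsto_op (hj.toLp _)).const_sub (hj.toLp (u j))
    rw [sub_self] at h1
    have h2 := h1.inner (𝕜 := ℝ) (tendsto_const_nhds (x := hj.toLp (u j)))
    rw [inner_zero_left] at h2
    exact h2

end ProcessFamily

/-! ### Semigroups acting on one variable of a product -/

section Fibers

variable {E₁ E₂ : Type*} [MeasurableSpace E₁] [MeasurableSpace E₂] {μ₁ : Measure E₁}
  {μ₂ : Measure E₂} [SFinite μ₂]

theorem integrable_integral_sq_right (u : Lp ℝ 2 (μ₁.prod μ₂)) :
    Integrable (fun x => ∫ y, u (x, y) ^ 2 ∂μ₂) μ₁ :=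
  (Lp.memLp u).integrable_sq.integral_prod_left

variable [SFinite μ₁]

theorem memLp_fiber_left (u : Lp ℝ 2 (μ₁.prod μ₂)) :
    ∀ᵐ y ∂μ₂, MemLp (fun x => u (x, y)) 2 μ₁ := by
  filter_upwards [(Lp.memLp u).integrable_sq.prod_left_ae] with y hy
  rw [memLp_two_iff_integrable_sq]
  · exact hy
  · exact ((Lp.stronglyMeasurable u).comp_measurable
      (measurable_id.prodMk measurable_const)).aestronglyMeasurable

theorem memLp_fiber_right (u : Lp ℝ 2 (μ₁.prod μ₂)) :
    ∀ᵐ x ∂μ₁, MemLp (fun y => u (x, y)) 2 μ₂ := by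
  filter_upwards [(Lp.memLp u).integrable_sq.prod_right_ae] with x hx
  rw [memLp_two_iff_integrable_sq]
  · exact hx
  · exact ((Lp.stronglyMeasurable u).comp_measurable
      (measurable_const.prodMk measurable_id)).aestronglyMeasurable

theorem integrable_integral_sq_left (u : Lp ℝ 2 (μ₁.prod μ₂)) :
    Integrable (fun y => ∫ x, u (x, y) ^ 2 ∂μ₁) μ₂ :=
  (Lp.memLp u).integrable_sq.integral_prod_right

theorem kernelForm_left {κ : Kernel E₁ E₁} [IsFiniteKernel κ] (h : IsSymmSubMarkov κ μ₁)
    (u v : Lp ℝ 2 (μ₁.prod μ₂)) :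
    Integrable (fun y => kernelForm κ μ₁ (fun x => u (x, y)) (fun x => v (x, y))) μ₂ ∧
      kernelForm (κ ∥ₖ Kernel.id) (μ₁.prod μ₂) u v =
        ∫ y, kernelForm κ μ₁ (fun x => u (x, y)) (fun x => v (x, y)) ∂μ₂ := by
  have hint := (h.parallelComp (IsSymmSubMarkov.id μ₂)).integrable_sub_integral_mul u v
  have e : ∀ x y, ∫ z, u z ∂(κ ∥ₖ (Kernel.id : Kernel E₂ E₂)) (x, y) = ∫ x', u (x', y) ∂κ x := by
    intro x y
    rw [Kernel.parallelComp_apply, Kernel.id_apply, Measure.prod_dirac,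
      integral_map (by fun_prop) (Lp.stronglyMeasurable u).aestronglyMeasurable]
  have h1 := hint.integral_prod_right
  have h2 := integral_prod_symm _ hint
  simp only [e] at h1
  refine ⟨h1, h2.trans ?_⟩
  simp only [e]
  rfl

theorem kernelForm_right {κ : Kernel E₂ E₂} [IsFiniteKernel κ] (h : IsSymmSubMarkov κ μ₂)
    (u v : Lp ℝ 2 (μ₁.prod μ₂)) :
    Integrable (fun x => kernelForm κ μ₂ (fun y => u (x, y)) (fun y => v (x, y))) μ₁ ∧
      kernelForm (Kernel.id ∥ₖ κ) (μ₁.prod μ₂) u v =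
        ∫ x, kernelForm κ μ₂ (fun y => u (x, y)) (fun y => v (x, y)) ∂μ₁ := by
  have hint := ((IsSymmSubMarkov.id μ₁).parallelComp h).integrable_sub_integral_mul u v
  have e : ∀ x y, ∫ z, u z ∂((Kernel.id : Kernel E₁ E₁) ∥ₖ κ) (x, y) = ∫ y', u (x, y') ∂κ y := by
    intro x y
    rw [Kernel.parallelComp_apply, Kernel.id_apply, Measure.dirac_prod,
      integral_map (by fun_prop) (Lp.stronglyMeasurable u).aestronglyMeasurable]
  have h1 := hint.integral_prod_left
  have h2 := integral_prod _ hint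
  simp only [e] at h1
  refine ⟨h1, h2.trans ?_⟩
  simp only [e]
  rfl

end Fibers

namespace ProcessFamily

variable {Ω₁ Ω₂ E₁ E₂ : Type*} [MeasurableSpace Ω₁] [MeasurableSpace Ω₂] [MeasurableSpace E₁]
  [MeasurableSpace E₂] {X : ProcessFamily Ω₁ E₁} {Y : ProcessFamily Ω₂ E₂}
  {μ₁ : Measure E₁} {μ₂ : Measure E₂} [SFinite μ₁] [SFinite μ₂]
  {D₁ : DirichletForm μ₁} {D₂ : DirichletForm μ₂}

/-- The semigroup of `X` acting on the first variable. -/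
noncomputable def leftSemigroup (hX : X.IsMarkov) (hs : X.IsSymmetric μ₁)
    (hD : X.HasDirichletForm D₁) (μ₂ : Measure E₂) [SFinite μ₂] :
    SymmSemigroup (Lp ℝ 2 (μ₁.prod μ₂)) :=
  kernelSemigroup (κ := fun t => transKernel hX t ∥ₖ Kernel.id)
    (fun t => (isSymmSubMarkov_transKernel hX hs t).parallelComp (IsSymmSubMarkov.id μ₂))
    (by rw [transKernel_zero, Kernel.id_parallelComp_id])
    (fun s t => by
      rw [transKernel_add, Kernel.parallelComp_comp_parallelComp, Kernel.id_comp])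
    (fun u => tendsto_lpOp_of_inner _ <| by
      have h := fun t => kernelForm_left (isSymmSubMarkov_transKernel hX hs t) u u
      simp_rw [IsSymmSubMarkov.inner_sub_lpOp, (h _).2]
      exact tendsto_integral_kernelForm hX hs hD (memLp_fiber_left u) (fun t => (h t).1)
        (integrable_integral_sq_left u))

/-- The semigroup of `Y` acting on the second variable. -/
noncomputable def rightSemigroup (hY : Y.IsMarkov) (hs : Y.IsSymmetric μ₂)
    (hD : Y.HasDirichletForm D₂) (μ₁ : Measure E₁) [SFinite μ₁] :
    SymmSemigroup (Lp ℝ 2 (μ₁.prod μ₂)) :=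
  kernelSemigroup (κ := fun t => Kernel.id ∥ₖ transKernel hY t)
    (fun t => (IsSymmSubMarkov.id μ₁).parallelComp (isSymmSubMarkov_transKernel hY hs t))
    (by rw [transKernel_zero, Kernel.id_parallelComp_id])
    (fun s t => by
      rw [transKernel_add, Kernel.parallelComp_comp_parallelComp, Kernel.id_comp])
    (fun u => tendsto_lpOp_of_inner _ <| by
      have h := fun t => kernelForm_right (isSymmSubMarkov_transKernel hY hs t) u u
      simp_rw [IsSymmSubMarkov.inner_sub_lpOp, (h _).2]
      exact tendsto_integral_kernelForm hY hs hD (memLp_fiber_right u) (fun t => (h t).1)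
        (integrable_integral_sq_right u))

theorem leftSemigroup_op (hX : X.IsMarkov) (hs : X.IsSymmetric μ₁) (hD : X.HasDirichletForm D₁)
    (t : ℝ≥0) : (leftSemigroup hX hs hD μ₂).op t =
      ((isSymmSubMarkov_transKernel hX hs t).parallelComp (IsSymmSubMarkov.id μ₂)).lpOp := rfl

theorem rightSemigroup_op (hY : Y.IsMarkov) (hs : Y.IsSymmetric μ₂) (hD : Y.HasDirichletForm D₂)
    (t : ℝ≥0) : (rightSemigroup hY hs hD μ₁).op t =
      ((IsSymmSubMarkov.id μ₁).parallelComp (isSymmSubMarkov_transKernel hY hs t)).lpOp := rfl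

section Left

variable (hX : X.IsMarkov) (hs : X.IsSymmetric μ₁) (hD : X.HasDirichletForm D₁)

include hX hs in
theorem integrable_approxForm_left (u v : Lp ℝ 2 (μ₁.prod μ₂)) (t : ℝ≥0) :
    Integrable (fun y => X.approxForm μ₁ t (fun x => u (x, y)) (fun x => v (x, y))) μ₂ :=
  (kernelForm_left (isSymmSubMarkov_transKernel hX hs t) u v).1.const_mul _

theorem approx_leftSemigroup (u v : Lp ℝ 2 (μ₁.prod μ₂)) (t : ℝ≥0) :
    (leftSemigroup hX hs hD μ₂).approx t u v =
      ∫ y, X.approxForm μ₁ t (fun x => u (x, y)) (fun x => v (x, y)) ∂μ₂ := by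
  have h := kernelForm_left (isSymmSubMarkov_transKernel hX hs t) u v
  simp_rw [approxForm_eq_kernelForm hX]
  rw [integral_const_mul, ← h.2, SymmSemigroup.approx, leftSemigroup_op,
    IsSymmSubMarkov.inner_sub_lpOp]

theorem mem_domain_leftSemigroup (u : Lp ℝ 2 (μ₁.prod μ₂)) :
    u ∈ (leftSemigroup hX hs hD μ₂).domain ↔ u ∈ fiberDomainLeft D₁ μ₂ := by
  rw [SymmSemigroup.mem_domain]
  simp_rw [approx_leftSemigroup]
  constructor
  · rintro ⟨C, hC⟩
    exact memLp_norm₁Fun_of_bdd hX hs hD (memLp_fiber_left u)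
      (integrable_approxForm_left hX hs u u) (integrable_integral_sq_left u) hC
  · rintro ⟨h1, h2⟩
    exact ⟨_, integral_approxForm_le hX hs hD (integrable_approxForm_left hX hs u u)
      (integrable_integral_sq_left u) h1 h2⟩

theorem energy_leftSemigroup {u v : Lp ℝ 2 (μ₁.prod μ₂)} (hu : u ∈ fiberDomainLeft D₁ μ₂)
    (hv : v ∈ fiberDomainLeft D₁ μ₂) :
    Integrable (fun y => D₁.formFun (fun x => u (x, y)) (fun x => v (x, y))) μ₂ ∧
      (leftSemigroup hX hs hD μ₂).energy u v =
        ∫ y, D₁.formFun (fun x => u (x, y)) (fun x => v (x, y)) ∂μ₂ := by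
  obtain ⟨h1, h2⟩ := integrable_formFun hX hs hD (integrable_approxForm_left hX hs u v) hu.1 hv.1
    (integrable_formFun_self hX hs hD (integrable_integral_sq_left u) hu.1 hu.2)
    (integrable_formFun_self hX hs hD (integrable_integral_sq_left v) hv.1 hv.2)
  refine ⟨h1, SymmSemigroup.energy_eq _ ?_⟩
  simp_rw [approx_leftSemigroup]
  exact h2

end Left

section Right

variable (hY : Y.IsMarkov) (hs : Y.IsSymmetric μ₂) (hD : Y.HasDirichletForm D₂)

include hY hs in
theorem integrable_approxForm_right (u v : Lp ℝ 2 (μ₁.prod μ₂)) (t : ℝ≥0) :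
    Integrable (fun x => Y.approxForm μ₂ t (fun y => u (x, y)) (fun y => v (x, y))) μ₁ :=
  (kernelForm_right (isSymmSubMarkov_transKernel hY hs t) u v).1.const_mul _

theorem approx_rightSemigroup (u v : Lp ℝ 2 (μ₁.prod μ₂)) (t : ℝ≥0) :
    (rightSemigroup hY hs hD μ₁).approx t u v =
      ∫ x, Y.approxForm μ₂ t (fun y => u (x, y)) (fun y => v (x, y)) ∂μ₁ := by
  have h := kernelForm_right (isSymmSubMarkov_transKernel hY hs t) u v
  simp_rw [approxForm_eq_kernelForm hY]
  rw [integral_const_mul, ← h.2, SymmSemigroup.approx, rightSemigroup_op,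
    IsSymmSubMarkov.inner_sub_lpOp]

theorem mem_domain_rightSemigroup (u : Lp ℝ 2 (μ₁.prod μ₂)) :
    u ∈ (rightSemigroup hY hs hD μ₁).domain ↔ u ∈ fiberDomainRight μ₁ D₂ := by
  rw [SymmSemigroup.mem_domain]
  simp_rw [approx_rightSemigroup]
  constructor
  · rintro ⟨C, hC⟩
    exact memLp_norm₁Fun_of_bdd hY hs hD (memLp_fiber_right u)
      (integrable_approxForm_right hY hs u u) (integrable_integral_sq_right u) hC
  · rintro ⟨h1, h2⟩
    exact ⟨_, integral_approxForm_le hY hs hD (integrable_approxForm_right hY hs u u)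
      (integrable_integral_sq_right u) h1 h2⟩

theorem energy_rightSemigroup {u v : Lp ℝ 2 (μ₁.prod μ₂)} (hu : u ∈ fiberDomainRight μ₁ D₂)
    (hv : v ∈ fiberDomainRight μ₁ D₂) :
    Integrable (fun x => D₂.formFun (fun y => u (x, y)) (fun y => v (x, y))) μ₁ ∧
      (rightSemigroup hY hs hD μ₁).energy u v =
        ∫ x, D₂.formFun (fun y => u (x, y)) (fun y => v (x, y)) ∂μ₁ := by
  obtain ⟨h1, h2⟩ := integrable_formFun hY hs hD (integrable_approxForm_right hY hs u v) hu.1 hv.1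
    (integrable_formFun_self hY hs hD (integrable_integral_sq_right u) hu.1 hu.2)
    (integrable_formFun_self hY hs hD (integrable_integral_sq_right v) hv.1 hv.2)
  refine ⟨h1, SymmSemigroup.energy_eq _ ?_⟩
  simp_rw [approx_rightSemigroup]
  exact h2

end Right

/-! ### The Dirichlet form of the coupling -/

section Coupling

variable (hX : X.IsMarkov) (hXs : X.IsSymmetric μ₁) (hXD : X.HasDirichletForm D₁)
  (hY : Y.IsMarkov) (hYs : Y.IsSymmetric μ₂) (hYD : Y.HasDirichletForm D₂)

theorem leftSemigroup_rightSemigroup (s t : ℝ≥0) (u : Lp ℝ 2 (μ₁.prod μ₂)) :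
    (leftSemigroup hX hXs hXD μ₂).op t ((rightSemigroup hY hYs hYD μ₁).op s u) =
      ((isSymmSubMarkov_transKernel hX hXs t).parallelComp
        (isSymmSubMarkov_transKernel hY hYs s)).lpOp u := by
  rw [leftSemigroup_op, rightSemigroup_op]
  refine (IsSymmSubMarkov.lpOp_comp _ _ _ ?_ u).symm
  rw [Kernel.parallelComp_comp_parallelComp, Kernel.id_comp, Kernel.comp_id]

theorem leftSemigroup_comm_rightSemigroup (s t : ℝ≥0) (u : Lp ℝ 2 (μ₁.prod μ₂)) :
    (leftSemigroup hX hXs hXD μ₂).op t ((rightSemigroup hY hYs hYD μ₁).op s u) =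
      (rightSemigroup hY hYs hYD μ₁).op s ((leftSemigroup hX hXs hXD μ₂).op t u) := by
  rw [leftSemigroup_rightSemigroup, leftSemigroup_op, rightSemigroup_op]
  refine IsSymmSubMarkov.lpOp_comp _ _ _ ?_ u
  rw [Kernel.parallelComp_comp_parallelComp, Kernel.id_comp, Kernel.comp_id]

/-- The semigroup of the coupling on `L²(μ₁ × μ₂)`, as the product of the semigroups acting on one
variable. -/
noncomputable def couplingSemigroup : SymmSemigroup (Lp ℝ 2 (μ₁.prod μ₂)) :=
  (leftSemigroup hX hXs hXD μ₂).prod (rightSemigroup hY hYs hYD μ₁)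
    (leftSemigroup_comm_rightSemigroup hX hXs hXD hY hYs hYD)

theorem couplingSemigroup_op (t : ℝ≥0) :
    (couplingSemigroup hX hXs hXD hY hYs hYD).op t =
      ((isSymmSubMarkov_transKernel hX hXs t).parallelComp
        (isSymmSubMarkov_transKernel hY hYs t)).lpOp :=
  ContinuousLinearMap.ext fun u => leftSemigroup_rightSemigroup hX hXs hXD hY hYs hYD t t u

/-- The Dirichlet form of the coupling. -/
noncomputable def couplingForm : DirichletForm (μ₁.prod μ₂) :=
  (couplingSemigroup hX hXs hXD hY hYs hYD).dirichletForm
    (fun t => transKernel hX t ∥ₖ transKernel hY t)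
    (fun t => (isSymmSubMarkov_transKernel hX hXs t).parallelComp
      (isSymmSubMarkov_transKernel hY hYs t))
    (couplingSemigroup_op hX hXs hXD hY hYs hYD)

theorem couplingForm_domain : (couplingForm hX hXs hXD hY hYs hYD).domain =
    (couplingSemigroup hX hXs hXD hY hYs hYD).domain := rfl

theorem couplingForm_form (u v : (couplingForm hX hXs hXD hY hYs hYD).domain) :
    (couplingForm hX hXs hXD hY hYs hYD).form u v =
      (couplingSemigroup hX hXs hXD hY hYs hYD).energy
        (u : Lp ℝ 2 (μ₁.prod μ₂)) (v : Lp ℝ 2 (μ₁.prod μ₂)) := rfl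

theorem mem_couplingForm_domain (u : Lp ℝ 2 (μ₁.prod μ₂)) :
    u ∈ (couplingForm hX hXs hXD hY hYs hYD).domain ↔
      u ∈ fiberDomainLeft D₁ μ₂ ∧ u ∈ fiberDomainRight μ₁ D₂ := by
  rw [couplingForm_domain, couplingSemigroup, SymmSemigroup.mem_domain_prod,
    mem_domain_leftSemigroup, mem_domain_rightSemigroup]

theorem couplingForm_form_eq (u v : (couplingForm hX hXs hXD hY hYs hYD).domain) :
    (couplingForm hX hXs hXD hY hYs hYD).form u v =
      (∫ y, D₁.formFun (fun x => (u : Lp ℝ 2 (μ₁.prod μ₂)) (x, y))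
        (fun x => (v : Lp ℝ 2 (μ₁.prod μ₂)) (x, y)) ∂μ₂) +
      ∫ x, D₂.formFun (fun y => (u : Lp ℝ 2 (μ₁.prod μ₂)) (x, y))
        (fun y => (v : Lp ℝ 2 (μ₁.prod μ₂)) (x, y)) ∂μ₁ := by
  have hu := (mem_couplingForm_domain hX hXs hXD hY hYs hYD _).1 u.2
  have hv := (mem_couplingForm_domain hX hXs hXD hY hYs hYD _).1 v.2
  rw [couplingForm_form, ← (energy_leftSemigroup hX hXs hXD hu.1 hv.1).2,
    ← (energy_rightSemigroup hY hYs hYD hu.2 hv.2).2]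
  exact SymmSemigroup.energy_prod u.2 v.2

theorem approx_couplingSemigroup (u v : Lp ℝ 2 (μ₁.prod μ₂)) (t : ℝ≥0) :
    (couplingSemigroup hX hXs hXD hY hYs hYD).approx t u v =
      (X.coupling Y).approxForm (μ₁.prod μ₂) t u v := by
  rw [SymmSemigroup.approx, couplingSemigroup_op, IsSymmSubMarkov.inner_sub_lpOp,
    approxForm_eq_kernelForm (isMarkov_coupling hX hY), transKernel_coupling]

theorem hasDirichletForm_coupling :
    (X.coupling Y).HasDirichletForm (couplingForm hX hXs hXD hY hYs hYD) where
  mem_domain_iff u := by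
    rw [couplingForm_domain, SymmSemigroup.mem_domain_iff_tendsto]
    simp_rw [approx_couplingSemigroup]
  tendsto_form u v := by
    simp_rw [← approx_couplingSemigroup hX hXs hXD hY hYs hYD]
    exact SymmSemigroup.tendsto_energy _ u.2 v.2

end Coupling

end ProcessFamily

/-! ### Tensor products of square integrable functions -/

section Tensor

variable {E₁ E₂ : Type*} [MeasurableSpace E₁] [MeasurableSpace E₂] {μ₁ : Measure E₁}
  {μ₂ : Measure E₂}

theorem memLp_tensor {f : E₁ → ℝ} {g : E₂ → ℝ} (hf : MemLp f 2 μ₁) (hg : MemLp g 2 μ₂) :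
    MemLp (fun z : E₁ × E₂ => f z.1 * g z.2) 2 (μ₁.prod μ₂) := by
  have hm : AEStronglyMeasurable (fun z : E₁ × E₂ => f z.1 * g z.2) (μ₁.prod μ₂) :=
    hf.1.comp_fst.mul hg.1.comp_snd
  rw [memLp_two_iff_integrable_sq hm]
  simp_rw [mul_pow]
  exact hf.integrable_sq.mul_prod hg.integrable_sq

/-- The tensor product `(x, y) ↦ f(x) g(y)` of two elements of `L²`. -/
noncomputable def tensorLp (f : Lp ℝ 2 μ₁) (g : Lp ℝ 2 μ₂) : Lp ℝ 2 (μ₁.prod μ₂) :=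
  (memLp_tensor (Lp.memLp f) (Lp.memLp g)).toLp _

theorem coeFn_tensorLp (f : Lp ℝ 2 μ₁) (g : Lp ℝ 2 μ₂) :
    tensorLp f g =ᵐ[μ₁.prod μ₂] fun z => f z.1 * g z.2 :=
  (memLp_tensor (Lp.memLp f) (Lp.memLp g)).coeFn_toLp

theorem coeFn_tensorLp_of_ae_eq {f : Lp ℝ 2 μ₁} {g : Lp ℝ 2 μ₂} {f' : E₁ → ℝ} {g' : E₂ → ℝ}
    (hf : f =ᵐ[μ₁] f') (hg : g =ᵐ[μ₂] g') :
    tensorLp f g =ᵐ[μ₁.prod μ₂] fun z => f' z.1 * g' z.2 := by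
  filter_upwards [coeFn_tensorLp f g, Measure.quasiMeasurePreserving_fst.ae hf,
    Measure.quasiMeasurePreserving_snd.ae hg] with z h1 h2 h3
  rw [h1, h2, h3]

theorem tensorLp_sub_tensorLp (f f' : Lp ℝ 2 μ₁) (g g' : Lp ℝ 2 μ₂) :
    tensorLp f g - tensorLp f' g' = tensorLp (f - f') g + tensorLp f' (g - g') := by
  refine Lp.ext ?_
  filter_upwards [Lp.coeFn_sub (tensorLp f g) (tensorLp f' g'),
    Lp.coeFn_add (tensorLp (f - f') g) (tensorLp f' (g - g')), coeFn_tensorLp f g,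
    coeFn_tensorLp f' g', coeFn_tensorLp (f - f') g, coeFn_tensorLp f' (g - g'),
    Measure.quasiMeasurePreserving_fst.ae (Lp.coeFn_sub f f'),
    Measure.quasiMeasurePreserving_snd.ae (Lp.coeFn_sub g g')] with z h1 h2 h3 h4 h5 h6 h7 h8
  rw [h1, h2, Pi.sub_apply, Pi.add_apply, h3, h4, h5, h6, h7, h8, Pi.sub_apply, Pi.sub_apply]
  ring

variable [SFinite μ₁] [SFinite μ₂]

theorem inner_tensorLp (f f' : Lp ℝ 2 μ₁) (g g' : Lp ℝ 2 μ₂) :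
    ⟪tensorLp f g, tensorLp f' g'⟫ = ⟪f, f'⟫ * ⟪g, g'⟫ := by
  simp only [L2.inner_def]
  rw [← integral_prod_mul]
  refine integral_congr_ae ?_
  filter_upwards [coeFn_tensorLp f g, coeFn_tensorLp f' g'] with z h1 h2
  rw [h1, h2]
  simp only [RCLike.inner_apply, conj_trivial]
  ring

theorem norm_tensorLp_sq (f : Lp ℝ 2 μ₁) (g : Lp ℝ 2 μ₂) :
    ‖tensorLp f g‖ ^ 2 = ‖f‖ ^ 2 * ‖g‖ ^ 2 := by
  simp only [← real_inner_self_eq_norm_sq, inner_tensorLp]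

theorem IsSymmSubMarkov.lpOp_tensorLp {κ : Kernel E₁ E₁} {η : Kernel E₂ E₂} [IsFiniteKernel κ]
    [IsFiniteKernel η] (h₁ : IsSymmSubMarkov κ μ₁) (h₂ : IsSymmSubMarkov η μ₂)
    (f : Lp ℝ 2 μ₁) (g : Lp ℝ 2 μ₂) :
    (h₁.parallelComp h₂).lpOp (tensorLp f g) = tensorLp (h₁.lpOp f) (h₂.lpOp g) := by
  refine Lp.ext ?_
  filter_upwards [(h₁.parallelComp h₂).coeFn_lpOp (tensorLp f g),
    (h₁.parallelComp h₂).integral_congr_ae (coeFn_tensorLp f g),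
    coeFn_tensorLp_of_ae_eq (h₁.coeFn_lpOp f) (h₂.coeFn_lpOp g)] with z h1 h2 h3
  rw [h1, h2, h3, Kernel.parallelComp_apply, integral_prod_mul]

/-- Tensor products of square integrable functions span a dense subspace: a function orthogonal to
the indicators of rectangles of finite measure has zero integral over every measurable set, by
Dynkin's π-λ theorem. -/
theorem dense_span_tensorLp {μ₁ : Measure E₁} {μ₂ : Measure E₂} [SigmaFinite μ₁] [SigmaFinite μ₂] :
    Dense (Submodule.span ℝ {w : Lp ℝ 2 (μ₁.prod μ₂) | ∃ f g, w = tensorLp f g} :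
      Set (Lp ℝ 2 (μ₁.prod μ₂))) := by
  rw [Submodule.dense_iff_topologicalClosure_eq_top, Submodule.topologicalClosure_eq_top_iff,
    Submodule.eq_bot_iff]
  intro w hw
  rw [Submodule.mem_orthogonal] at hw
  have rect : ∀ A B, MeasurableSet A → MeasurableSet B → μ₁ A ≠ ∞ → μ₂ B ≠ ∞ →
      ∫ z in A ×ˢ B, w z ∂(μ₁.prod μ₂) = 0 := by
    intro A B hA hB hA' hB'
    have h := hw _ (Submodule.subset_span
      ⟨indicatorConstLp 2 hA hA' (1 : ℝ), indicatorConstLp 2 hB hB' (1 : ℝ), rfl⟩)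
    rw [L2.inner_def] at h
    rw [← h, ← integral_indicator (hA.prod hB)]
    refine integral_congr_ae ?_
    filter_upwards [coeFn_tensorLp_of_ae_eq (indicatorConstLp_coeFn (p := 2) (hs := hA)
      (hμs := hA') (c := (1 : ℝ))) (indicatorConstLp_coeFn (p := 2) (hs := hB)
      (hμs := hB') (c := (1 : ℝ)))] with z hz
    rw [hz]
    by_cases h1 : z.1 ∈ A <;> by_cases h2 : z.2 ∈ B <;> simp [Set.indicator, h1, h2]
  set S := spanningSets μ₁
  set T := spanningSets μ₂
  have key : ∀ n k, w =ᵐ[(μ₁.prod μ₂).restrict (S n ×ˢ T k)] 0 := by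
    intro n k
    have hS := measurableSet_spanningSets μ₁ n
    have hT := measurableSet_spanningSets μ₂ k
    have hSf := (measure_spanningSets_lt_top μ₁ n).ne
    have hTf := (measure_spanningSets_lt_top μ₂ k).ne
    set ρ := (μ₁.prod μ₂).restrict (S n ×ˢ T k) with hρ
    have : IsFiniteMeasure ρ := ⟨by
      rw [hρ, Measure.restrict_apply_univ, Measure.prod_prod]
      exact ENNReal.mul_lt_top hSf.lt_top hTf.lt_top⟩
    have hint : Integrable w ρ := ((Lp.memLp w).restrict _).integrable (by norm_num)
    refine hint.ae_eq_zero_of_forall_setIntegral_eq_zero fun s hs _ => ?_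
    have huniv : ∫ z, w z ∂ρ = 0 := rect _ _ hS hT hSf hTf
    induction s, hs using MeasurableSpace.induction_on_inter generateFrom_prod.symm
      isPiSystem_prod with
    | empty => simp
    | basic s hs =>
      obtain ⟨A, hA, B, hB, rfl⟩ := hs
      have hA : MeasurableSet A := hA
      have hB : MeasurableSet B := hB
      rw [hρ, Measure.restrict_restrict (hA.prod hB), Set.prod_inter_prod]
      exact rect _ _ (hA.inter hS) (hB.inter hT)
        (measure_ne_top_of_subset Set.inter_subset_right hSf)
        (measure_ne_top_of_subset Set.inter_subset_right hTf)
    | compl s hs ih =>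
      have := integral_add_compl hs hint
      rw [ih (measure_lt_top _ _), huniv, zero_add] at this
      exact this
    | iUnion f hd hf ih =>
      have := hasSum_integral_iUnion hf hd hint.integrableOn
      simp_rw [fun i => ih i (measure_lt_top _ _)] at this
      exact this.unique hasSum_zero
  refine Lp.ext (EventuallyEq.trans ?_ (Lp.coeFn_zero _ _ _).symm)
  have hcover : (⋃ p : ℕ × ℕ, S p.1 ×ˢ T p.2) = Set.univ := by
    rw [Set.iUnion_prod' (f := fun p : ℕ × ℕ => S p.1 ×ˢ T p.2)]
    simp_rw [← Set.prod_iUnion, ← Set.iUnion_prod_const]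
    rw [iUnion_spanningSets, iUnion_spanningSets, Set.univ_prod_univ]
  have h := (ae_restrict_iUnion_iff (fun p : ℕ × ℕ => S p.1 ×ˢ T p.2) (fun z => w z = 0)).2
    fun p => key p.1 p.2
  rwa [hcover, Measure.restrict_univ] at h

end Tensor

/-! ### Closures for the energy norm -/

namespace SymmSemigroup

variable {H : Type*} [NormedAddCommGroup H] [InnerProductSpace ℝ H] (T : SymmSemigroup H)

theorem energy_smul_self {u : H} (hu : u ∈ T.domain) (c : ℝ) :
    T.energy (c • u) (c • u) = c ^ 2 * T.energy u u :=
  T.energy_eq <| by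
    simp_rw [approx_smul_self]
    exact (T.tendsto_energy hu hu).const_mul _

/-- The square `𝓔(u, u) + ‖u‖²` of the energy norm of an element `u` of the domain. -/
noncomputable def energyOne (u : H) : ℝ := T.energy u u + ‖u‖ ^ 2

theorem energyOne_nonneg {u : H} (hu : u ∈ T.domain) : 0 ≤ T.energyOne u :=
  add_nonneg (T.energy_nonneg hu) (sq_nonneg _)

theorem energyOne_smul {u : H} (hu : u ∈ T.domain) (c : ℝ) :
    T.energyOne (c • u) = c ^ 2 * T.energyOne u := by
  rw [energyOne, energyOne, T.energy_smul_self hu, norm_smul, mul_pow, Real.norm_eq_abs, sq_abs]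
  ring

theorem energyOne_add_le {u v : H} (hu : u ∈ T.domain) (hv : v ∈ T.domain) :
    T.energyOne (u + v) ≤ 2 * T.energyOne u + 2 * T.energyOne v := by
  have h1 := T.energy_add_self_le hu hv
  have h2 := parallelogram_law_with_norm ℝ u v
  have h3 := sq_nonneg ‖u - v‖
  simp only [energyOne]
  nlinarith

/-- The closure of a subspace of the domain for the energy norm. -/
def energyClosure (W : Submodule ℝ H) (hW : W ≤ T.domain) : Submodule ℝ H where
  carrier := {u | u ∈ T.domain ∧ ∀ ε > 0, ∃ w ∈ W, T.energyOne (u - w) < ε}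
  zero_mem' := ⟨T.domain.zero_mem, fun ε hε => ⟨0, W.zero_mem, by
    have h := T.energyOne_smul T.domain.zero_mem 0
    rw [zero_smul] at h
    rw [sub_zero, h]
    simpa using hε⟩⟩
  add_mem' := by
    rintro u v ⟨hu, hu'⟩ ⟨hv, hv'⟩
    refine ⟨T.domain.add_mem hu hv, fun ε hε => ?_⟩
    obtain ⟨w, hw, h1⟩ := hu' (ε / 4) (by positivity)
    obtain ⟨w', hw', h2⟩ := hv' (ε / 4) (by positivity)
    refine ⟨w + w', W.add_mem hw hw', ?_⟩
    rw [add_sub_add_comm]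
    have := T.energyOne_add_le (T.domain.sub_mem hu (hW hw)) (T.domain.sub_mem hv (hW hw'))
    linarith
  smul_mem' := by
    rintro c u ⟨hu, hu'⟩
    refine ⟨T.domain.smul_mem c hu, fun ε hε => ?_⟩
    obtain ⟨w, hw, h1⟩ := hu' (ε / (c ^ 2 + 1)) (by positivity)
    refine ⟨c • w, W.smul_mem c hw, ?_⟩
    rw [← smul_sub, T.energyOne_smul (T.domain.sub_mem hu (hW hw))]
    rw [lt_div_iff₀ (by positivity)] at h1
    have := T.energyOne_nonneg (T.domain.sub_mem hu (hW hw))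
    linarith

variable {T}

theorem mem_energyClosure_of_near {W : Submodule ℝ H} {hW : W ≤ T.domain} {u : H}
    (hu : u ∈ T.domain) (h : ∀ ε > 0, ∃ w ∈ T.energyClosure W hW, T.energyOne (u - w) < ε) :
    u ∈ T.energyClosure W hW := by
  refine ⟨hu, fun ε hε => ?_⟩
  obtain ⟨k, ⟨hk, hk'⟩, h1⟩ := h (ε / 4) (by positivity)
  obtain ⟨w, hw, h2⟩ := hk' (ε / 4) (by positivity)
  refine ⟨w, hw, ?_⟩
  have := T.energyOne_add_le (T.domain.sub_mem hu hk) (T.domain.sub_mem hk (hW hw))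
  rw [sub_add_sub_cancel] at this
  linarith

end SymmSemigroup

namespace ProcessFamily

variable {Ω₁ Ω₂ E₁ E₂ : Type*} [MeasurableSpace Ω₁] [MeasurableSpace Ω₂] [MeasurableSpace E₁]
  [MeasurableSpace E₂] {X : ProcessFamily Ω₁ E₁} {Y : ProcessFamily Ω₂ E₂}
  {μ₁ : Measure E₁} {μ₂ : Measure E₂}
  {D₁ : DirichletForm μ₁} {D₂ : DirichletForm μ₂}

section

variable [SFinite μ₁] [SFinite μ₂]
  (hX : X.IsMarkov) (hXs : X.IsSymmetric μ₁) (hXD : X.HasDirichletForm D₁)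
  (hY : Y.IsMarkov) (hYs : Y.IsSymmetric μ₂) (hYD : Y.HasDirichletForm D₂)

theorem couplingSemigroup_tensorLp (t : ℝ≥0) (f : Lp ℝ 2 μ₁) (g : Lp ℝ 2 μ₂) :
    (couplingSemigroup hX hXs hXD hY hYs hYD).op t (tensorLp f g) =
      tensorLp ((semigroup hX hXs hXD).op t f) ((semigroup hY hYs hYD).op t g) := by
  rw [couplingSemigroup_op, IsSymmSubMarkov.lpOp_tensorLp, semigroup_op, semigroup_op]

theorem approx_tensorLp_le (t : ℝ≥0) (f : Lp ℝ 2 μ₁) (g : Lp ℝ 2 μ₂) :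
    (couplingSemigroup hX hXs hXD hY hYs hYD).approx t (tensorLp f g) (tensorLp f g) ≤
      (semigroup hX hXs hXD).approx t f f * ‖g‖ ^ 2 +
        ‖f‖ ^ 2 * (semigroup hY hYs hYD).approx t g g := by
  have e : (couplingSemigroup hX hXs hXD hY hYs hYD).approx t (tensorLp f g) (tensorLp f g) =
      (semigroup hX hXs hXD).approx t f f * ‖g‖ ^ 2 +
        ⟪(semigroup hX hXs hXD).op t f, f⟫ * (semigroup hY hYs hYD).approx t g g := by
    simp only [SymmSemigroup.approx, inner_sub_left, couplingSemigroup_tensorLp, inner_tensorLp,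
      real_inner_self_eq_norm_sq, norm_tensorLp_sq]
    ring
  rw [e]
  gcongr
  · exact SymmSemigroup.approx_nonneg _ _ _
  · exact SymmSemigroup.inner_op_le _ _ _

/-- The energy norm is submultiplicative on tensor products. -/
theorem energyOne_tensorLp_le {f : Lp ℝ 2 μ₁} {g : Lp ℝ 2 μ₂}
    (hf : f ∈ (semigroup hX hXs hXD).domain) (hg : g ∈ (semigroup hY hYs hYD).domain) :
    tensorLp f g ∈ (couplingSemigroup hX hXs hXD hY hYs hYD).domain ∧
      (couplingSemigroup hX hXs hXD hY hYs hYD).energyOne (tensorLp f g) ≤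
        (semigroup hX hXs hXD).energyOne f * (semigroup hY hYs hYD).energyOne g := by
  have h : ∀ t, (couplingSemigroup hX hXs hXD hY hYs hYD).approx t (tensorLp f g) (tensorLp f g) ≤
      (semigroup hX hXs hXD).energy f f * ‖g‖ ^ 2 +
        ‖f‖ ^ 2 * (semigroup hY hYs hYD).energy g g := fun t => by
    refine (approx_tensorLp_le hX hXs hXD hY hYs hYD t f g).trans ?_
    gcongr
    · exact SymmSemigroup.approx_le_energy _ hf t
    · exact SymmSemigroup.approx_le_energy _ hg t
  refine ⟨⟨_, h⟩, ?_⟩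
  have h1 := SymmSemigroup.energy_le _ ⟨_, h⟩ h
  have h2 := mul_nonneg (SymmSemigroup.energy_nonneg _ hf) (SymmSemigroup.energy_nonneg _ hg)
  simp only [SymmSemigroup.energyOne, norm_tensorLp_sq]
  nlinarith

end

/-- If every element of the domains of `X` and `Y` is approximated in energy by the sets `A₁` and
`A₂`, the tensor products of elements of `A₁` and `A₂` span an energy dense subspace of the domain
of the coupling. By density of `L² ⊗ L²` in `L²` and regularization by the semigroup, it suffices to
approximate `T_s (f ⊗ g) = p_s f ⊗ q_s g`. -/
theorem mem_energyClosure_span [SigmaFinite μ₁] [SigmaFinite μ₂]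
    (hX : X.IsMarkov) (hXs : X.IsSymmetric μ₁) (hXD : X.HasDirichletForm D₁)
    (hY : Y.IsMarkov) (hYs : Y.IsSymmetric μ₂) (hYD : Y.HasDirichletForm D₂)
    {A₁ : Set (Lp ℝ 2 μ₁)} {A₂ : Set (Lp ℝ 2 μ₂)}
    (hA₁ : A₁ ⊆ (semigroup hX hXs hXD).domain) (hA₂ : A₂ ⊆ (semigroup hY hYs hYD).domain)
    (hd₁ : ∀ f ∈ (semigroup hX hXs hXD).domain, ∀ ε > 0, ∃ w ∈ A₁,
      (semigroup hX hXs hXD).energyOne (f - w) < ε)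
    (hd₂ : ∀ g ∈ (semigroup hY hYs hYD).domain, ∀ ε > 0, ∃ w ∈ A₂,
      (semigroup hY hYs hYD).energyOne (g - w) < ε)
    {W : Submodule ℝ (Lp ℝ 2 (μ₁.prod μ₂))}
    (hW : W ≤ (couplingSemigroup hX hXs hXD hY hYs hYD).domain)
    (hAW : ∀ f ∈ A₁, ∀ g ∈ A₂, tensorLp f g ∈ W) {u : Lp ℝ 2 (μ₁.prod μ₂)}
    (hu : u ∈ (couplingSemigroup hX hXs hXD hY hYs hYD).domain) :
    u ∈ (couplingSemigroup hX hXs hXD hY hYs hYD).energyClosure W hW := by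
  set R := couplingSemigroup hX hXs hXD hY hYs hYD with hR
  set T₁ := semigroup hX hXs hXD with hT₁
  set T₂ := semigroup hY hYs hYD with hT₂
  have tensor : ∀ f ∈ T₁.domain, ∀ g ∈ T₂.domain, tensorLp f g ∈ R.energyClosure W hW := by
    intro f hf g hg
    have hfg := energyOne_tensorLp_le hX hXs hXD hY hYs hYD hf hg
    refine ⟨hfg.1, fun ε hε => ?_⟩
    have n₂ := T₂.energyOne_nonneg hg
    obtain ⟨f', hf', h1⟩ := hd₁ f hf (ε / (4 * (T₂.energyOne g + 1))) (by positivity)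
    have n₁ := T₁.energyOne_nonneg (hA₁ hf')
    obtain ⟨g', hg', h2⟩ := hd₂ g hg (ε / (4 * (T₁.energyOne f' + 1))) (by positivity)
    refine ⟨tensorLp f' g', hAW f' hf' g' hg', ?_⟩
    have hff' := T₁.domain.sub_mem hf (hA₁ hf')
    have hgg' := T₂.domain.sub_mem hg (hA₂ hg')
    have b1 := energyOne_tensorLp_le hX hXs hXD hY hYs hYD hff' hg
    have b2 := energyOne_tensorLp_le hX hXs hXD hY hYs hYD (hA₁ hf') hgg'
    rw [tensorLp_sub_tensorLp]
    have b3 := R.energyOne_add_le b1.1 b2.1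
    rw [lt_div_iff₀ (by positivity)] at h1 h2
    have n₃ := T₁.energyOne_nonneg hff'
    have n₄ := T₂.energyOne_nonneg hgg'
    have b4 := b1.2
    have b5 := b2.2
    simp only [← hR, ← hT₁, ← hT₂] at b4 b5
    nlinarith
  refine SymmSemigroup.mem_energyClosure_of_near hu fun ε hε => ?_
  obtain ⟨s, hs, w, hw, h⟩ := R.exists_op_near dense_span_tensorLp hu hε
  refine ⟨R.op s w, ?_, h⟩
  refine Submodule.span_induction (p := fun w _ => R.op s w ∈ R.energyClosure W hW)
    ?_ ?_ ?_ ?_ hw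
  · rintro _ ⟨f, g, rfl⟩
    have e : R.op s (tensorLp f g) = tensorLp (T₁.op s f) (T₂.op s g) :=
      couplingSemigroup_tensorLp hX hXs hXD hY hYs hYD s f g
    rw [e]
    exact tensor _ (T₁.op_mem_domain hs f) _ (T₂.op_mem_domain hs g)
  · rw [map_zero]; exact Submodule.zero_mem _
  · intro a b _ _ ha hb
    rw [map_add]; exact Submodule.add_mem _ ha hb
  · intro c a _ ha
    rw [map_smul]; exact Submodule.smul_mem _ c ha

end ProcessFamily

/-! ### Uniform density of tensor products -/

theorem CompactlySupportedContinuousMap.exists_abs_le {E : Type*} [TopologicalSpace E]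
    (f : C_c(E, ℝ)) : ∃ C, 0 ≤ C ∧ ∀ x, |f x| ≤ C := by
  obtain ⟨C, hC⟩ := f.hasCompactSupport.exists_bound_of_continuous f.continuous
  exact ⟨|C|, abs_nonneg _, fun x => (hC x).trans (le_abs_self C)⟩

section Uniform

variable {E₁ E₂ : Type*} [MetricSpace E₁] [LocallyCompactSpace E₁] [MetricSpace E₂]

/-- The section `y ↦ g(x, y)` of a compactly supported continuous function. -/
def sectionRight (g : C_c(E₁ × E₂, ℝ)) (x : E₁) : C_c(E₂, ℝ) where
  toFun y := g (x, y)
  continuous_toFun := by fun_prop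
  hasCompactSupport' := by
    refine HasCompactSupport.intro (g.hasCompactSupport.isCompact.image continuous_snd)
      fun y hy => image_eq_zero_of_notMem_tsupport fun h => hy ⟨(x, y), h, rfl⟩

/-- Approximation of `g` by `∑ ρ_i ⊗ g(x_i, ·)` for a partition of unity `(ρ_i)` on the projection
of the support of `g`, with `ρ_i` supported close to `x_i`. -/
theorem exists_tensorCore_univ_near (g : C_c(E₁ × E₂, ℝ)) {ε : ℝ} (hε : 0 < ε) :
    ∃ h ∈ tensorCore (Set.univ : Set C_c(E₁, ℝ)) (Set.univ : Set C_c(E₂, ℝ)),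
      ∀ z, |g z - h z| < ε := by
  have huc : UniformContinuous g :=
    g.hasCompactSupport.uniformContinuous_of_continuous g.continuous
  obtain ⟨δ, hδ, hg⟩ := Metric.uniformContinuous_iff.1 huc (ε / 2) (by positivity)
  set K : Set E₁ := Prod.fst '' tsupport g with hKdef
  have hK : IsCompact K := g.hasCompactSupport.isCompact.image continuous_fst
  obtain ⟨V, hV, hKV, hVc⟩ := exists_isOpen_superset_and_isCompact_closure hK
  obtain ⟨t, -, htf, htK⟩ := hK.elim_finite_subcover_image (b := K)
    (c := fun x => Metric.ball x δ) (fun x _ => Metric.isOpen_ball)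
    (fun x hx => Set.mem_biUnion hx (Metric.mem_ball_self hδ))
  have := htf.fintype
  obtain ⟨ρ, hρ⟩ := PartitionOfUnity.exists_isSubordinate_of_locallyFinite hK.isClosed
    (fun i : t => Metric.ball (i : E₁) δ ∩ V) (fun i => Metric.isOpen_ball.inter hV)
    (locallyFinite_of_finite _) (fun x hx => by
      obtain ⟨i, hi, hxi⟩ := Set.mem_iUnion₂.1 (htK hx)
      exact Set.mem_iUnion.2 ⟨⟨i, hi⟩, hxi, hKV hx⟩)
  have hcs : ∀ i, HasCompactSupport (ρ i) := fun i =>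
    hVc.of_isClosed_subset (isClosed_tsupport _)
      ((hρ i).trans (Set.inter_subset_right.trans subset_closure))
  let r : t → C_c(E₁, ℝ) := fun i => ⟨ρ i, hcs i⟩
  refine ⟨∑ i, tensorFun (r i) (sectionRight g i), Submodule.sum_mem _ fun i _ =>
    Submodule.subset_span ⟨_, Set.mem_univ _, _, Set.mem_univ _, rfl⟩, fun z => ?_⟩
  have hsum : ∀ x, ∑ i, ρ i x = ∑ᶠ i, ρ i x := fun x => (finsum_eq_sum_of_fintype _).symm
  -- outside the projection of the support both sides vanish
  have h1 : g z * ∑ i, ρ i z.1 = g z := by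
    by_cases hz : z.1 ∈ K
    · rw [hsum, ρ.sum_eq_one hz, mul_one]
    · rw [image_eq_zero_of_notMem_tsupport fun h => hz ⟨z, h, rfl⟩, zero_mul]
  have h2 : (∑ i, tensorFun (r i) (sectionRight g i)) z = ∑ i, ρ i z.1 * g (i, z.2) := by
    rw [CompactlySupportedContinuousMap.sum_apply]
    rfl
  have h3 : ∀ i, |ρ i z.1 * (g z - g (i, z.2))| ≤ ρ i z.1 * (ε / 2) := by
    intro i
    rw [abs_mul, abs_of_nonneg (ρ.nonneg i z.1)]
    by_cases hz : z.1 ∈ tsupport (ρ i)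
    · refine mul_le_mul_of_nonneg_left ?_ (ρ.nonneg i z.1)
      have hd : dist z (i, z.2) < δ := by
        rw [Prod.dist_eq, dist_self, max_eq_left dist_nonneg]
        exact (hρ i hz).1
      exact (hg hd).le
    · rw [image_eq_zero_of_notMem_tsupport hz, zero_mul, zero_mul]
  calc |g z - (∑ i, tensorFun (r i) (sectionRight g i)) z|
      = |∑ i, ρ i z.1 * (g z - g (i, z.2))| := by
        rw [h2]
        nth_rewrite 1 [← h1]
        rw [Finset.mul_sum, ← Finset.sum_sub_distrib]
        congr 1
        exact Finset.sum_congr rfl fun i _ => by ring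
    _ ≤ ∑ i, ρ i z.1 * (ε / 2) :=
        (Finset.abs_sum_le_sum_abs _ _).trans (Finset.sum_le_sum fun i _ => h3 i)
    _ = (∑ᶠ i, ρ i z.1) * (ε / 2) := by rw [← Finset.sum_mul, hsum]
    _ ≤ 1 * (ε / 2) := by
        gcongr
        exact ρ.sum_le_one z.1
    _ < ε := by linarith

/-- Uniform approximation passes from the factors to the tensor product. -/
theorem exists_tensorCore_near {C₁ : Set C_c(E₁, ℝ)} {C₂ : Set C_c(E₂, ℝ)}
    (h₁ : ∀ g : C_c(E₁, ℝ), ∀ ε > 0, ∃ f ∈ C₁, ∀ x, |g x - f x| < ε)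
    (h₂ : ∀ g : C_c(E₂, ℝ), ∀ ε > 0, ∃ f ∈ C₂, ∀ x, |g x - f x| < ε)
    (g : C_c(E₁ × E₂, ℝ)) {ε : ℝ} (hε : 0 < ε) :
    ∃ h ∈ tensorCore C₁ C₂, ∀ z, |g z - h z| < ε := by
  have key : ∀ k ∈ tensorCore (Set.univ : Set C_c(E₁, ℝ)) (Set.univ : Set C_c(E₂, ℝ)),
      ∀ ε > 0, ∃ h ∈ tensorCore C₁ C₂, ∀ z, |k z - h z| < ε := by
    intro k hk
    refine Submodule.span_induction (p := fun (k : C_c(E₁ × E₂, ℝ)) _ =>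
      ∀ ε > 0, ∃ h ∈ tensorCore C₁ C₂, ∀ z, |k z - h z| < ε) ?_ ?_ ?_ ?_ hk
    · rintro _ ⟨f, -, g, -, rfl⟩ ε hε
      obtain ⟨M, hM, hgM⟩ := g.exists_abs_le
      obtain ⟨f', hf', h1⟩ := h₁ f (ε / (2 * (M + 1))) (by positivity)
      obtain ⟨N, hN, hfN⟩ := f'.exists_abs_le
      obtain ⟨g', hg', h2⟩ := h₂ g (ε / (2 * (N + 1))) (by positivity)
      refine ⟨tensorFun f' g', Submodule.subset_span ⟨f', hf', g', hg', rfl⟩, fun z => ?_⟩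
      have e : tensorFun f g z - tensorFun f' g' z =
          (f z.1 - f' z.1) * g z.2 + f' z.1 * (g z.2 - g' z.2) := by
        change f z.1 * g z.2 - f' z.1 * g' z.2 = _
        ring
      rw [e]
      refine (abs_add_le _ _).trans_lt ?_
      rw [abs_mul, abs_mul]
      have b1 : |f z.1 - f' z.1| * |g z.2| ≤ |f z.1 - f' z.1| * (M + 1) := by
        gcongr; linarith [hgM z.2]
      have b2 : |f' z.1| * |g z.2 - g' z.2| ≤ (N + 1) * |g z.2 - g' z.2| := by
        gcongr; linarith [hfN z.1]
      have b3 := h1 z.1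
      have b4 := h2 z.2
      rw [lt_div_iff₀ (by positivity)] at b3 b4
      nlinarith
    · exact fun ε hε => ⟨0, Submodule.zero_mem _, fun z => by simpa using hε⟩
    · intro a b _ _ ha hb ε hε
      obtain ⟨a', ha', h1⟩ := ha (ε / 2) (by positivity)
      obtain ⟨b', hb', h2⟩ := hb (ε / 2) (by positivity)
      refine ⟨a' + b', Submodule.add_mem _ ha' hb', fun z => ?_⟩
      have e : (a + b) z - (a' + b') z = (a z - a' z) + (b z - b' z) := by
        simp only [CompactlySupportedContinuousMap.add_apply]; ring
      rw [e]
      linarith [abs_add_le (a z - a' z) (b z - b' z), h1 z, h2 z]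
    · intro c a _ ha ε hε
      obtain ⟨a', ha', h1⟩ := ha (ε / (|c| + 1)) (by positivity)
      refine ⟨c • a', Submodule.smul_mem _ c ha', fun z => ?_⟩
      have e : (c • a) z - (c • a') z = c * (a z - a' z) := by
        simp only [CompactlySupportedContinuousMap.smul_apply, smul_eq_mul]; ring
      rw [e, abs_mul]
      have := h1 z
      rw [lt_div_iff₀ (by positivity)] at this
      nlinarith [abs_nonneg (a z - a' z)]
  obtain ⟨k, hk, h1⟩ := exists_tensorCore_univ_near g (half_pos hε)
  obtain ⟨h, hh, h2⟩ := key k hk _ (half_pos hε)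
  refine ⟨h, hh, fun z => ?_⟩
  have := abs_sub_le (g z) (k z) (h z)
  linarith [h1 z, h2 z]

end Uniform

/-! ### Cores -/

theorem DirichletForm.memFun_iff_exists {E : Type*} [MeasurableSpace E] {m : Measure E}
    {D : DirichletForm m} {f : E → ℝ} : D.MemFun f ↔ ∃ w ∈ D.domain, w =ᵐ[m] f := by
  constructor
  · rintro ⟨h, h'⟩
    exact ⟨_, h', h.coeFn_toLp⟩
  · rintro ⟨w, hw, hwf⟩
    have hf : MemLp f 2 m := (Lp.memLp w).ae_eq hwf
    refine ⟨hf, ?_⟩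
    have e : hf.toLp f = w := Lp.ext (hf.coeFn_toLp.trans hwf.symm)
    rwa [e]

namespace ProcessFamily

theorem exists_energyOne_lt {Ω E : Type*} [MeasurableSpace Ω] [TopologicalSpace E]
    [MeasurableSpace E] {X : ProcessFamily Ω E} {m : Measure E} {D : DirichletForm m}
    (hX : X.IsMarkov) (hs : X.IsSymmetric m) (hD : X.HasDirichletForm D) {C : Set C_c(E, ℝ)}
    (hC : D.IsCore C) {f : Lp ℝ 2 m} (hf : f ∈ (semigroup hX hs hD).domain) {ε : ℝ}
    (hε : 0 < ε) : ∃ w ∈ {w : Lp ℝ 2 m | ∃ g ∈ C, w =ᵐ[m] g},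
      (semigroup hX hs hD).energyOne (f - w) < ε := by
  rw [domain_semigroup hX hs hD] at hf
  obtain ⟨g, hg, w, hwg, h⟩ := hC.dense_domain ⟨f, hf⟩ (Real.sqrt ε) (by positivity)
  refine ⟨w, ⟨g, hg, hwg⟩, ?_⟩
  rw [Real.sqrt_lt_sqrt_iff_of_pos hε, DirichletForm.form₁, ← energy_semigroup hX hs hD,
    real_inner_self_eq_norm_sq] at h
  exact h

variable {Ω₁ Ω₂ E₁ E₂ : Type*} [MeasurableSpace Ω₁] [MeasurableSpace Ω₂]
  [MetricSpace E₁] [LocallyCompactSpace E₁] [MeasurableSpace E₁]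
  [MetricSpace E₂] [MeasurableSpace E₂]
  {X : ProcessFamily Ω₁ E₁} {Y : ProcessFamily Ω₂ E₂} {μ₁ : Measure E₁} {μ₂ : Measure E₂}
  [SigmaFinite μ₁] [SigmaFinite μ₂] {D₁ : DirichletForm μ₁} {D₂ : DirichletForm μ₂}

/-- The tensor product of two cores is a core of the Dirichlet form of the coupling. -/
theorem isCore_tensorCore
    (hX : X.IsMarkov) (hXs : X.IsSymmetric μ₁) (hXD : X.HasDirichletForm D₁)
    (hY : Y.IsMarkov) (hYs : Y.IsSymmetric μ₂) (hYD : Y.HasDirichletForm D₂)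
    {C₁ : Set C_c(E₁, ℝ)} {C₂ : Set C_c(E₂, ℝ)} (hC₁ : D₁.IsCore C₁) (hC₂ : D₂.IsCore C₂) :
    (couplingForm hX hXs hXD hY hYs hYD).IsCore (tensorCore C₁ C₂ : Set C_c(E₁ × E₂, ℝ)) := by
  set A₁ : Set (Lp ℝ 2 μ₁) := {w | ∃ g ∈ C₁, w =ᵐ[μ₁] g} with hA₁
  set A₂ : Set (Lp ℝ 2 μ₂) := {w | ∃ g ∈ C₂, w =ᵐ[μ₂] g} with hA₂
  have hA₁' : A₁ ⊆ (semigroup hX hXs hXD).domain := by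
    rintro w ⟨f, hf, hwf⟩
    obtain ⟨w', hw', h⟩ := DirichletForm.memFun_iff_exists.1 (hC₁.memFun f hf)
    rw [domain_semigroup hX hXs hXD, Lp.ext (hwf.trans h.symm)]
    exact hw'
  have hA₂' : A₂ ⊆ (semigroup hY hYs hYD).domain := by
    rintro w ⟨f, hf, hwf⟩
    obtain ⟨w', hw', h⟩ := DirichletForm.memFun_iff_exists.1 (hC₂.memFun f hf)
    rw [domain_semigroup hY hYs hYD, Lp.ext (hwf.trans h.symm)]
    exact hw'
  have hmem : ∀ h ∈ tensorCore C₁ C₂,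
      ∃ w ∈ (couplingSemigroup hX hXs hXD hY hYs hYD).domain, w =ᵐ[μ₁.prod μ₂] h := by
    intro h hh
    refine Submodule.span_induction (p := fun (h : C_c(E₁ × E₂, ℝ)) _ =>
      ∃ w ∈ (couplingSemigroup hX hXs hXD hY hYs hYD).domain, w =ᵐ[μ₁.prod μ₂] h)
      ?_ ?_ ?_ ?_ hh
    · rintro _ ⟨f, hf, g, hg, rfl⟩
      obtain ⟨w, hw, hwf⟩ := DirichletForm.memFun_iff_exists.1 (hC₁.memFun f hf)
      obtain ⟨w', hw', hwg⟩ := DirichletForm.memFun_iff_exists.1 (hC₂.memFun g hg)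
      exact ⟨tensorLp w w', (energyOne_tensorLp_le hX hXs hXD hY hYs hYD (hA₁' ⟨f, hf, hwf⟩)
        (hA₂' ⟨g, hg, hwg⟩)).1, coeFn_tensorLp_of_ae_eq hwf hwg⟩
    · exact ⟨0, Submodule.zero_mem _, Lp.coeFn_zero _ _ _⟩
    · rintro a b - - ⟨w, hw, hwa⟩ ⟨w', hw', hwb⟩
      exact ⟨w + w', Submodule.add_mem _ hw hw', (Lp.coeFn_add _ _).trans (hwa.add hwb)⟩
    · rintro c a - ⟨w, hw, hwa⟩
      exact ⟨c • w, Submodule.smul_mem _ c hw, (Lp.coeFn_smul _ _).trans (hwa.const_smul c)⟩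
  let W : Submodule ℝ (Lp ℝ 2 (μ₁.prod μ₂)) :=
    { carrier := {w | ∃ h ∈ tensorCore C₁ C₂, w =ᵐ[μ₁.prod μ₂] h}
      zero_mem' := ⟨0, Submodule.zero_mem _, Lp.coeFn_zero _ _ _⟩
      add_mem' := by
        rintro a b ⟨h, hh, hah⟩ ⟨k, hk, hbk⟩
        exact ⟨h + k, Submodule.add_mem _ hh hk, (Lp.coeFn_add _ _).trans (hah.add hbk)⟩
      smul_mem' := by
        rintro c a ⟨h, hh, hah⟩
        exact ⟨c • h, Submodule.smul_mem _ c hh, (Lp.coeFn_smul _ _).trans (hah.const_smul c)⟩ }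
  have hW : W ≤ (couplingSemigroup hX hXs hXD hY hYs hYD).domain := by
    rintro w ⟨h, hh, hwh⟩
    obtain ⟨w', hw', h'⟩ := hmem h hh
    rwa [Lp.ext (hwh.trans h'.symm)]
  have hAW : ∀ f ∈ A₁, ∀ g ∈ A₂, tensorLp f g ∈ W := by
    rintro w ⟨f, hf, hwf⟩ w' ⟨g, hg, hwg⟩
    exact ⟨tensorFun f g, Submodule.subset_span ⟨f, hf, g, hg, rfl⟩,
      coeFn_tensorLp_of_ae_eq hwf hwg⟩
  refine ⟨fun h hh => DirichletForm.memFun_iff_exists.2 (hmem h hh), fun u ε hε => ?_,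
    fun g ε hε => exists_tensorCore_near hC₁.dense_continuous hC₂.dense_continuous g hε⟩
  have hu := mem_energyClosure_span hX hXs hXD hY hYs hYD hA₁' hA₂'
    (fun f hf ε hε => exists_energyOne_lt hX hXs hXD hC₁ hf hε)
    (fun f hf ε hε => exists_energyOne_lt hY hYs hYD hC₂ hf hε) hW hAW u.2
  obtain ⟨w, hw, h⟩ := hu.2 (ε ^ 2) (by positivity)
  obtain ⟨k, hk, hwk⟩ := id hw
  refine ⟨k, hk, ⟨w, hW hw⟩, hwk, ?_⟩
  rw [Real.sqrt_lt' hε, DirichletForm.form₁, couplingForm_form, real_inner_self_eq_norm_sq]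
  exact h

end ProcessFamily

theorem proposition3p2 {ΩX ΩY EX EY : Type*} [MeasurableSpace ΩX] [MeasurableSpace ΩY]
    [MetricSpace EX] [LocallyCompactSpace EX] [SecondCountableTopology EX]
    [MeasurableSpace EX] [BorelSpace EX]
    [MetricSpace EY] [LocallyCompactSpace EY] [SecondCountableTopology EY]
    [MeasurableSpace EY] [BorelSpace EY]
    (mX : Measure EX) [IsLocallyFiniteMeasure mX] [mX.IsOpenPosMeasure]
    (mY : Measure EY) [IsLocallyFiniteMeasure mY] [mY.IsOpenPosMeasure]
    (X : ProcessFamily ΩX EX) (hX : X.IsMarkov) (hXsymm : X.IsSymmetric mX)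
    (DX : DirichletForm mX) (hDX : DX.IsRegular) (hXD : X.HasDirichletForm DX)
    (Y : ProcessFamily ΩY EY) (hY : Y.IsMarkov) (hYsymm : Y.IsSymmetric mY)
    (DY : DirichletForm mY) (hDY : DY.IsRegular) (hYD : Y.HasDirichletForm DY) :
    (X.coupling Y).IsMarkov ∧ (X.coupling Y).IsSymmetric (mX.prod mY) ∧
    ∃ D : DirichletForm (mX.prod mY),
      (D.domain : Set (Lp ℝ 2 (mX.prod mY))) =
        fiberDomainLeft DX mY ∩ fiberDomainRight mX DY ∧
      (∀ u ∈ D.domain, ∀ v ∈ D.domain,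
        Integrable (fun y => DX.formFun (fun x => u (x, y)) (fun x => v (x, y))) mY ∧
        Integrable (fun x => DY.formFun (fun y => u (x, y)) (fun y => v (x, y))) mX) ∧
      (∀ u v : D.domain,
        D.form u v =
          (∫ y, DX.formFun (fun x => (u : Lp ℝ 2 (mX.prod mY)) (x, y))
            (fun x => (v : Lp ℝ 2 (mX.prod mY)) (x, y)) ∂mY) +
          ∫ x, DY.formFun (fun y => (u : Lp ℝ 2 (mX.prod mY)) (x, y))
            (fun y => (v : Lp ℝ 2 (mX.prod mY)) (x, y)) ∂mX) ∧
      D.IsRegular ∧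
      (X.coupling Y).HasDirichletForm D ∧
      ∀ (CX : Set C_c(EX, ℝ)) (CY : Set C_c(EY, ℝ)), DX.IsCore CX → DY.IsCore CY →
        D.IsCore (tensorCore CX CY : Set C_c(EX × EY, ℝ)) := by
  have hmem := ProcessFamily.mem_couplingForm_domain hX hXsymm hXD hY hYsymm hYD
  refine ⟨ProcessFamily.isMarkov_coupling hX hY,
    ProcessFamily.isSymmetric_coupling hX hY hXsymm hYsymm,
    ProcessFamily.couplingForm hX hXsymm hXD hY hYsymm hYD, Set.ext hmem, ?_,
    ProcessFamily.couplingForm_form_eq hX hXsymm hXD hY hYsymm hYD, ?_,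
    ProcessFamily.hasDirichletForm_coupling hX hXsymm hXD hY hYsymm hYD,
    fun CX CY hCX hCY =>
      ProcessFamily.isCore_tensorCore hX hXsymm hXD hY hYsymm hYD hCX hCY⟩
  · intro u hu v hv
    have hu' := (hmem u).1 hu
    have hv' := (hmem v).1 hv
    exact ⟨(ProcessFamily.energy_leftSemigroup hX hXsymm hXD hu'.1 hv'.1).1,
      (ProcessFamily.energy_rightSemigroup hY hYsymm hYD hu'.2 hv'.2).1⟩
  · have h := ProcessFamily.isCore_tensorCore hX hXsymm hXD hY hYsymm hYD hDX hDY
    refine ⟨fun f hf => hf, fun u ε hε => ?_, fun g ε hε => ?_⟩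
    · obtain ⟨f, hf, h'⟩ := h.dense_domain u ε hε
      exact ⟨f, h.memFun f hf, h'⟩
    · obtain ⟨f, hf, h'⟩ := h.dense_continuous g ε hε
      exact ⟨f, h.memFun f hf, h'⟩
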